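/- Let $\kappa>0$, $\lambda\in\mathbb C$, $L\ge 10$, $\Lambda=[1,L]=\{1,\dots,L\}$, and write $L=3N+k$ with $k\in\{1,2,3\}$. Let $\mathcal H_\Lambda=\bigotimes_{x=1}^L\mathbb C^2$ with occupation basis $|\mu\rangle$, $\mu\in\{0,1\}^L$; let $\sigma_x^-$ be the lowering operator at site $x$ ($|1\rangle\mapsto|0\rangle$, $|0\rangle\mapsto 0$), $n_x=(\sigma_x^-)^*\sigma_x^-$ and $q_x=\sigma^-_{x+1}\sigma^-_{x+2}-\lambda\,\sigma^-_x\sigma^-_{x+3}$. For $[a,b]\subseteq\Lambda$ put $$H_{[a,b]}=\sum_{x=a}^{b-2}n_xn_{x+2}+\kappa\sum_{x=a}^{b-3}q_x^*q_x ,$$ acting as the identity outside $[a,b]$. A BVMD tiling of $[1,\ell]$ is an ordered sequence of tiles covering exactly the $\ell$ sites, with bulk tiles $V=(0)$, $M=(100)$, $D=(011000)$, the tile $B_l=(11000)$, allowed only as the first tile, and the tiles $M_1=(1)$, $M_2=(10)$, $D_1=(0110)$, $D_2=(01100)$, $B_r=(011)$, allowed only as the last tile. Let $\sigma(T)\in\{0,1\}^\ell$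 be the configuration of $T$, and let $\mathcal C_\Lambda$ be the span of all $|\sigma(T)\rangle$, $T$ a BVMD tiling of $\Lambda$. Tilings are connected, $T\leftrightarrow T'$, if one is transformed into the other by finitely many replacements $MM\leftrightarrow D$, $MM_2\leftrightarrow D_2$, $MM_1\leftrightarrow D_1$ (the last two at the right end). With $d(T)$ the number of dimers $D,D_1,D_2$ in $T$, let $\varphi_n=\sum_{T\leftrightarrow (M,\dots,M)}\lambda^{d(T)}|\sigma(T)\rangle$ be the state on $3n$ sites associated with the tiling by $n$ monomers. For $2\le n\le N$ let $\Lambda_2=[1,6+k]$ and $\Lambda_n=[3n+k-8,3n+k]$ for $n>2$; let $h_n=H_{\Lambda_n}$ and $H_n=\sum_{m=2}^n h_m$, and let $g_n$, $G_n$ be the orthogonal projections onto $\ker h_n$, $\ker H_n$. Let $E_1=1-G_2$, $E_n=G_n-G_{n+1}$ for $2\le n\le N-1$, and $E_N=G_N$. The space $\mathcal C_\Lambda$ is invariant under $H_\Lambda$ and under all $h_n,H_n,g_n$ ($2\le n\le N$) and $E_m$ ($1\le m\le N$); write $A^{\mathcal C_\Lambda}=P_{\mathcal C_\Lambda}AP_{\mathcal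 C_\Lambda}$ for the restriction of $A$, with $P_{\mathcal C_\Lambda}$ the orthogonal projection onto $\mathcal C_\Lambda$. Let $$\beta_n=\frac{\|\varphi_{n-1}\|^2}{\|\varphi_n\|^2}=\frac1{\beta_+}\,\frac{1-\beta^n}{1-\beta^{n+1}}\quad(n\ge1),\qquad \beta_\pm=\tfrac12\bigl(1\pm\sqrt{1+4|\lambda|^2}\bigr),\quad \beta=\beta_- /\beta_+ ,$$ (both the invariance and this equality being part of the claim), which is a function of $r=|\lambda|^2$, and let $f(r)=\sup_{j\ge4}f_j(r)$, which is finite, where $$f_j(r)=r\,\beta_j\beta_{j-2}\left(\frac{[1-\beta_{j-1}(1+r)]^2}{1+2r}+\beta_{j-3}\frac{r(1-\beta_{j-1})^2}{1+r}\right).$$ Then for all $2\le n\le N$: 1. $h_n^{\mathcal C_\Lambda}\ge\kappa(1-g_n)^{\mathcal C_\Lambda}$; 2. for $1\le m\le N$, $[g_n^{\mathcal C_\Lambda},E_m^{\mathcal C_\Lambda}]\ne0$ only if $n-3\le m\le n-1$; 3. if $\lambda\ne0$, then $\|g_n^{\mathcal C_\Lambda}E_{n-1}^{\mathcal C_\Lambda}\|^2\le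 f(|\lambda|^2)$. Consequently, if $\lambda\ne0$ and $f(|\lambda|^2)<1/3$, the spectral gap of $H_\Lambda$ restricted to $\mathcal C_\Lambda$ satisfies $$E_1(\mathcal C_\Lambda):=\inf_{0\ne\psi\in\mathcal C_\Lambda\cap(\ker H_\Lambda)^\perp}\frac{\langle\psi,H_\Lambda\psi\rangle}{\|\psi\|^2}\ \ge\ \frac{\kappa}{3}\Bigl(1-\sqrt{3f(|\lambda|^2)}\Bigr)^2 .$$ -/

import Mathlib

namespace FQH

noncomputable section

/-! ### Configurations, Hilbert space, Hamiltonians -/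

/-- Occupation configurations of the sites `1, …, L`; site `x` is the index `x - 1 : Fin L`. -/
abbrev Config (L : ℕ) : Type := Fin L → Bool

/-- The `L`-fold tensor power of `ℂ²`, written in its orthonormal occupation basis. -/
abbrev Hilb (L : ℕ) : Type := EuclideanSpace ℂ (Config L)

/-- Bounded operators on the Hilbert space. -/
abbrev Op (L : ℕ) : Type := Hilb L →L[ℂ] Hilb L

/-- The lowering operator at an index: it maps `|1⟩` to `|0⟩` and `|0⟩` to `0` there, and is the
identity on the other tensor factors. -/
def lower {L : ℕ} (i : Fin L) : Op L :=
  LinearMap.toContinuousLinearMap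
    { toFun := fun ψ => WithLp.toLp 2 fun μ : Config L =>
        if μ i = false then ψ (Function.update μ i true) else 0
      map_add' := fun ψ χ => by
        ext μ
        by_cases h : μ i = false <;> simp [h]
      map_smul' := fun c ψ => by
        ext μ
        by_cases h : μ i = false <;> simp [h] }

/-- The lowering operator `σ_x⁻` at the site `x ∈ [1, L]` (only such sites are ever used). -/
def sigmaMinus (L x : ℕ) : Op L :=
  if h : 1 ≤ x ∧ x ≤ L then lower ⟨x - 1, by omega⟩ else 0

/-- The number operator `n_x = σ_x⁺ σ_x⁻`. -/
def num (L x : ℕ) : Op L := star (sigmaMinus L x) * sigmaMinus L x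

/-- `q_x = σ_{x+1}⁻ σ_{x+2}⁻ - lam σ_x⁻ σ_{x+3}⁻`. -/
def q (L : ℕ) (lam : ℂ) (x : ℕ) : Op L :=
  sigmaMinus L (x + 1) * sigmaMinus L (x + 2) - lam • (sigmaMinus L x * sigmaMinus L (x + 3))

/-- The Hamiltonian with open boundary conditions of the interval `[a, b]`, `1 ≤ a`, `b ≤ L`,
acting on the Hilbert space of `[1, L]` (it is tensored with the identity outside `[a, b]`). -/
def Ham (L : ℕ) (κ : ℝ) (lam : ℂ) (a b : ℕ) : Op L :=
  ∑ x ∈ Finset.Icc a (b - 2), num L x * num L (x + 2)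
    + (κ : ℂ) • ∑ x ∈ Finset.Icc a (b - 3), star (q L lam x) * q L lam x

/-- The orthogonal projection onto the kernel of an operator. -/
def kerProj {L : ℕ} (A : Op L) : Op L := (LinearMap.ker A.toLinearMap).starProjection

/-! ### Tilings -/

/-- Voids `V`, monomers `M`, dimers `D`, and the boundary tiles. -/
inductive Tile : Type
  | V | M | D | Bl | M1 | M2 | D1 | D2 | Br

/-- The occupation numbers on the sites covered by a tile. -/
def Tile.word : Tile → List Bool
  | .V => [false]
  | .M => [true, false, false]
  | .D => [false, true, true, false, false, false]
  | .Bl => [true, true, false, false, false]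
  | .M1 => [true]
  | .M2 => [true, false]
  | .D1 => [false, true, true, false]
  | .D2 => [false, true, true, false, false]
  | .Br => [false, true, true]

/-- The configuration of an ordered list of tiles, as a word. -/
def conf (T : List Tile) : List Bool := T.flatMap Tile.word

/-- `T` is a BVMD tiling of `[1, L]`: its tiles cover exactly `L` sites, the left boundary tile
occurs at most in the first place, the right boundary tiles at most in the last place. -/
structure IsBVMD (L : ℕ) (T : List Tile) : Prop where
  covers : (conf T).length = L
  left : Tile.Bl ∉ T.tail
  right : ∀ t ∈ T.dropLast, t = Tile.V ∨ t = Tile.M ∨ t = Tile.D ∨ t = Tile.Bl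

/-- The occupation basis vector of a word of length `L`. -/
def ket (L : ℕ) (w : List Bool) : Hilb L :=
  EuclideanSpace.single (fun i : Fin L => w.getD i false) 1

/-- The space `C_Λ` of all BVMD tilings of `Λ = [1, L]`. -/
def tilingSpace (L : ℕ) : Submodule ℂ (Hilb L) :=
  Submodule.span ℂ {v | ∃ T : List Tile, IsBVMD L T ∧ v = ket L (conf T)}

/-- The replacement rules. -/
inductive Replace : List Tile → List Tile → Prop
  | bulk (A B : List Tile) : Replace (A ++ [.M, .M] ++ B) (A ++ [.D] ++ B)
  | two (A : List Tile) : Replace (A ++ [.M, .M2]) (A ++ [.D2])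
  | one (A : List Tile) : Replace (A ++ [.M, .M1]) (A ++ [.D1])

/-- Two tilings are connected if finitely many replacements, in either direction, transform one
into the other. -/
def Connected : List Tile → List Tile → Prop := Relation.EqvGen Replace

/-- One for the dimers `D`, `D1`, `D2`, zero for all other tiles. -/
def Tile.dimers : Tile → ℕ
  | .D => 1
  | .D1 => 1
  | .D2 => 1
  | _ => 0

/-- The number `d(T)` of dimers `D`, `D1`, `D2` in a tiling. -/
def dimerCount (T : List Tile) : ℕ := (T.map Tile.dimers).sum

instance : Finite Tile := by
  refine Finite.of_surjective
    (fun i : Fin 9 => ([.V, .M, .D, .Bl, .M1, .M2, .D1, .D2, .Br] : List Tile).get i) ?_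
  intro t
  cases t
  exacts [⟨0, rfl⟩, ⟨1, rfl⟩, ⟨2, rfl⟩, ⟨3, rfl⟩, ⟨4, rfl⟩, ⟨5, rfl⟩, ⟨6, rfl⟩, ⟨7, rfl⟩, ⟨8, rfl⟩]

theorem length_le_length_conf (T : List Tile) : T.length ≤ (conf T).length := by
  induction T with
  | nil => simp
  | cons t T ih =>
    have h : 1 ≤ t.word.length := by cases t <;> simp [Tile.word]
    simp only [conf, List.flatMap_cons, List.length_append, List.length_cons] at ih ⊢
    omega

theorem finite_connected (L : ℕ) (R : List Tile) :
    {T | IsBVMD L T ∧ Connected T R}.Finite :=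
  (List.finite_length_le Tile L).subset fun T hT => by
    have := length_le_length_conf T
    rw [hT.1.covers] at this
    exact this

/-- The BVMD state `∑_{T ↔ R} lam ^ d(T) |σ(T)⟩` of a root tiling `R` of `[1, L]`. -/
def bvmdState (L : ℕ) (lam : ℂ) (R : List Tile) : Hilb L :=
  ∑ T ∈ (finite_connected L R).toFinset, lam ^ dimerCount T • ket L (conf T)

/-- The squeezed Tao–Thouless state `φ_n` of the root tiling by `n` monomers. -/
def phi (lam : ℂ) (n : ℕ) : Hilb (3 * n) := bvmdState (3 * n) lam (List.replicate n Tile.M)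

/-! ### The function `f` -/

def betaPlus (r : ℝ) : ℝ := (1 + √(1 + 4 * r)) / 2

def betaMinus (r : ℝ) : ℝ := (1 - √(1 + 4 * r)) / 2

/-- The ratios `β_n`, `n ≥ 1`, as a function of `r = |lam|²`. -/
def beta (r : ℝ) (n : ℕ) : ℝ :=
  1 / betaPlus r * ((1 - (betaMinus r / betaPlus r) ^ n)
    / (1 - (betaMinus r / betaPlus r) ^ (n + 1)))

/-- `f_k(r)`, for `k ≥ 4`. -/
def fk (k : ℕ) (r : ℝ) : ℝ :=
  r * beta r k * beta r (k - 2) *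
    ((1 - beta r (k - 1) * (1 + r)) ^ 2 / (1 + 2 * r)
      + beta r (k - 3) * (r * (1 - beta r (k - 1)) ^ 2 / (1 + r)))

/-- `f(r) = sup_{k ≥ 4} f_k(r)`. -/
def f (r : ℝ) : ℝ := sSup ((fun k => fk k r) '' Set.Ici 4)

/-! ### The operators of the martingale method, for `L = 3 N + k` -/

/-- The left end of `Λ_n`; the right end is `3 n + k`. -/
def leftEnd (k n : ℕ) : ℕ := if n = 2 then 1 else 3 * n + k - 8

/-- `h_n = H_{Λ_n}`. -/
def hLoc (L : ℕ) (κ : ℝ) (lam : ℂ) (k n : ℕ) : Op L :=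
  Ham L κ lam (leftEnd k n) (3 * n + k)

/-- `H_n = ∑_{m=2}^n h_m`. -/
def hSum (L : ℕ) (κ : ℝ) (lam : ℂ) (k n : ℕ) : Op L :=
  ∑ m ∈ Finset.Icc 2 n, hLoc L κ lam k m

/-- `g_n`, the orthogonal projection onto `ker h_n`. -/
def gProj (L : ℕ) (κ : ℝ) (lam : ℂ) (k n : ℕ) : Op L := kerProj (hLoc L κ lam k n)

/-- `G_n`, the orthogonal projection onto `ker H_n`. -/
def GProj (L : ℕ) (κ : ℝ) (lam : ℂ) (k n : ℕ) : Op L := kerProj (hSum L κ lam k n)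

/-- `E_n`, for `1 ≤ n ≤ N`. -/
def EProj (L : ℕ) (κ : ℝ) (lam : ℂ) (N k n : ℕ) : Op L :=
  if n = 1 then 1 - GProj L κ lam k 2
  else if n < N then GProj L κ lam k n - GProj L κ lam k (n + 1)
  else GProj L κ lam k N

/-- The restriction `A^C = P_C A P_C` of an operator to `C = C_Λ`, with `P_C` the orthogonal
projection onto `C`. -/
def restr {L : ℕ} (A : Op L) : Op L :=
  (tilingSpace L).starProjection * A * (tilingSpace L).starProjection

/-- `A` maps `C_Λ` into itself. -/
def LeavesInvariant {L : ℕ} (A : Op L) : Prop := ∀ ψ ∈ tilingSpace L, A ψ ∈ tilingSpace L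

/-- The spectral gap `E₁(C_Λ)` of the restriction of `H_Λ` to `C_Λ`, `Λ = [1, L]`: the infimum of
`⟨ψ, H_Λ ψ⟩ / ‖ψ‖²` over the nonzero vectors of `C_Λ` orthogonal to `ker H_Λ`. -/
def E1 (L : ℕ) (κ : ℝ) (lam : ℂ) : ℝ :=
  sInf {e | ∃ ψ ∈ tilingSpace L ⊓ (LinearMap.ker (Ham L κ lam 1 L).toLinearMap)ᗮ, ψ ≠ 0 ∧
    e = (inner ℂ ψ (Ham L κ lam 1 L ψ)).re / ‖ψ‖ ^ 2}

end

end FQH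

namespace FQH

noncomputable section

/-! ### Coordinates of the local operators -/

/-! The whole argument takes place on amplitudes of tilings. Appending two empty sites turns the
truncated tiles into bulk tiles (only `Br` survives, as the word of `D2`), and distinct padded
tilings have distinct configurations, so a vector of the tiling space is a function on padded
tilings (`mem_tilingSpace_iff`, `cfg_inj`). There the terms n_x n_{x+2} vanish, and q_x sends X D Y
and X M M Y to X 000000 Y with coefficients 1 and -λ. Hence the tiling space is invariant, and
inside it ker H_{[a,b]} is described by the relations F(X D Y) = λ F(X M M Y) for the bonds of [a,b]
(`Rel`).

Property 1. A window of at most nine sites has at most six bonds, while two dimers of a tiling start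
at least six sites apart. So a tiling has at most one dimer at a bond of the window, and replacing
its amplitude by what the relation demands gives a kernel vector at squared distance at most ∑ ‖q_x
ψ‖² (`exists_kernel_near`).

Property 2. For m ≤ n - 4 the operators live on disjoint intervals; for m ≥ n the kernels are nested
inside the tiling space.

Property 3. Put b = 3n + k. A tiling vector in the range of E_{n-1} satisfies the relations of [1,
b-3] and is orthogonal to all solutions of the relations of [1, b]. The additional bonds belong to
dimers ending at b, b+1 or b+2, that is, to the end of a run of monomers and dimers. Projecting to
the ground state ∑ λ^d |R⟩ of that run solves all relations up to b, so orthogonality forces the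
vector to vanish on tilings without such a run and to be orthogonal to the ground state of the run
in each remaining class (`rel_projLastRun`, `vanish_of_orthogonal`). In a run with room for j ≥ 4
monomers its amplitude then depends on two numbers, for last tile M or D, tied together by
orthogonality; a vector of ker h_n obeys the relations on the last three monomer places.
Cauchy–Schwarz bounds the overlap by f_j, the β's being ratios of squared norms of run ground states
(`run_estimate`); for j ≤ 3 the overlap is zero. Summing over classes and using ‖g_n φ‖² = ⟨g_n φ,
φ⟩ gives the claim (`norm_gProj_sq_le`).

Gap. For ψ in the tiling space the vectors E_n ψ are orthogonal, and for n < N ‖E_n ψ‖² = ⟨E_n ψ, (1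
- g_{n+1}) ψ⟩ + ⟨g_{n+1} E_n ψ, (E_{n-2} + E_{n-1} + E_n) ψ⟩, terms with index below one being
absent (`increment_sq_le`). Summing with Cauchy–Schwarz, the three increments in the last factor
produce √(3f), and counting each bond at most three times produces κ/3 (`martingale_bound`,
`gap_estimate`). -/

theorem op_star_zero (L : ℕ) : star (0 : Op L) = 0 := star_zero (Op L)

theorem op_star_add {L : ℕ} (A B : Op L) : star (A + B) = star A + star B := star_add A B

theorem op_star_sub {L : ℕ} (A B : Op L) : star (A - B) = star A - star B := star_sub A B

theorem op_star_smul {L : ℕ} (c : ℂ) (A : Op L) : star (c • A) = star c • star A := star_smul c A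

theorem op_star_sum {L : ℕ} {ι : Type*} (s : Finset ι) (F : ι → Op L) :
    star (∑ i ∈ s, F i) = ∑ i ∈ s, star (F i) := star_sum s F

theorem lower_apply {L : ℕ} (i : Fin L) (ψ : Hilb L) (μ : Config L) :
    lower i ψ μ = if μ i = false then ψ (Function.update μ i true) else 0 := rfl

theorem star_lower_apply {L : ℕ} (i : Fin L) (ψ : Hilb L) (μ : Config L) :
    star (lower i) ψ μ = if μ i = true then ψ (Function.update μ i false) else 0 := by
  -- The coordinate at `μ` is the pairing with the basis vector of `μ`, so only the configuration
  -- with index `i` emptied contributes.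
  have h := ContinuousLinearMap.adjoint_inner_right (lower i) (EuclideanSpace.single μ 1) ψ
  rw [EuclideanSpace.inner_single_left, map_one, one_mul] at h
  rw [ContinuousLinearMap.star_eq_adjoint, h, PiLp.inner_apply]
  by_cases hμ : μ i = true
  · rw [if_pos hμ, Finset.sum_eq_single (Function.update μ i false)]
    · simp [lower_apply, ← hμ]
    · intro ν _ hν
      rw [lower_apply]
      split_ifs with h0
      · rw [PiLp.single_apply, if_neg, inner_zero_left]
        rintro rfl
        exact hν (by simp [← h0])
      · simp
    · simp
  · rw [if_neg hμ]
    refine Finset.sum_eq_zero fun ν _ => ?_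
    rw [lower_apply]
    split_ifs with h0
    · rw [PiLp.single_apply, if_neg, inner_zero_left]
      rintro rfl
      simp at hμ
    · simp

/-! ### Commutation of local operators -/

theorem lower_commute {L : ℕ} (i j : Fin L) : Commute (lower i) (lower j) := by
  by_cases hij : i = j
  · rw [hij]
  ext ψ μ
  change lower i (lower j ψ) μ = lower j (lower i ψ) μ
  simp only [lower_apply, Function.update_of_ne hij, Function.update_of_ne (Ne.symm hij),
    Function.update_comm hij]
  split_ifs <;> rfl

theorem lower_commute_star {L : ℕ} {i j : Fin L} (hij : i ≠ j) :
    Commute (lower i) (star (lower j)) := by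
  ext ψ μ
  change lower i (star (lower j) ψ) μ = star (lower j) (lower i ψ) μ
  simp only [lower_apply, star_lower_apply, Function.update_of_ne hij,
    Function.update_of_ne (Ne.symm hij), Function.update_comm hij]
  split_ifs <;> rfl

theorem sigmaMinus_eq {L x : ℕ} (h1 : 1 ≤ x) (h2 : x ≤ L) :
    sigmaMinus L x = lower ⟨x - 1, by omega⟩ := dif_pos ⟨h1, h2⟩

theorem sigmaMinus_commute (L x y : ℕ) : Commute (sigmaMinus L x) (sigmaMinus L y) := by
  unfold sigmaMinus
  split_ifs
  · exact lower_commute _ _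
  · exact Commute.zero_right _
  · exact Commute.zero_left _
  · exact Commute.zero_left _

theorem sigmaMinus_commute_star {L x y : ℕ} (h : x ≠ y) :
    Commute (sigmaMinus L x) (star (sigmaMinus L y)) := by
  unfold sigmaMinus
  split_ifs
  · exact lower_commute_star (by simp [Fin.ext_iff]; omega)
  · rw [op_star_zero]; exact Commute.zero_right _
  · exact Commute.zero_left _
  · exact Commute.zero_left _

/-- Operators commuting with `A` and with its adjoint. -/
def StarCommute {L : ℕ} (A B : Op L) : Prop := Commute A B ∧ Commute A (star B)

namespace StarCommute

variable {L : ℕ} {A B C : Op L}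

theorem symm (h : StarCommute A B) : StarCommute B A := by
  refine ⟨h.1.symm, ?_⟩
  have := h.2.star_star
  rw [star_star] at this
  exact this.symm

theorem star_right (h : StarCommute A B) : StarCommute A (star B) :=
  ⟨h.2, by rw [star_star]; exact h.1⟩

theorem mul_right (h : StarCommute A B) (h' : StarCommute A C) : StarCommute A (B * C) :=
  ⟨h.1.mul_right h'.1, by rw [star_mul]; exact h'.2.mul_right h.2⟩

theorem add_right (h : StarCommute A B) (h' : StarCommute A C) : StarCommute A (B + C) :=
  ⟨h.1.add_right h'.1, by rw [op_star_add]; exact h.2.add_right h'.2⟩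

theorem smul_right (h : StarCommute A B) (c : ℂ) : StarCommute A (c • B) :=
  ⟨h.1.smul_right c, by rw [op_star_smul]; exact h.2.smul_right _⟩

theorem sub_right (h : StarCommute A B) (h' : StarCommute A C) : StarCommute A (B - C) :=
  ⟨h.1.sub_right h'.1, by rw [op_star_sub]; exact h.2.sub_right h'.2⟩

theorem sum_right {ι : Type*} (s : Finset ι) (F : ι → Op L)
    (h : ∀ i ∈ s, StarCommute A (F i)) : StarCommute A (∑ i ∈ s, F i) :=
  ⟨Commute.sum_right _ _ _ fun i hi => (h i hi).1, by
    rw [op_star_sum]; exact Commute.sum_right _ _ _ fun i hi => (h i hi).2⟩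

end StarCommute

/-- An operator commuting with all `σ_y⁻`, `a ≤ y ≤ b`, and their adjoints commutes with the
Hamiltonian of `[a, b]`. -/
theorem starCommute_ham {L : ℕ} {κ : ℝ} {lam : ℂ} {a b : ℕ} {A : Op L}
    (hA : ∀ y, a ≤ y → y ≤ b → StarCommute A (sigmaMinus L y)) (hb : a + 3 ≤ b) :
    StarCommute A (Ham L κ lam a b) := by
  unfold Ham
  refine (StarCommute.sum_right _ _ fun x hx => ?_).add_right
    ((StarCommute.sum_right _ _ fun x hx => ?_).smul_right _)
  · rw [Finset.mem_Icc] at hx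
    have h1 := hA x (by omega) (by omega)
    have h2 := hA (x + 2) (by omega) (by omega)
    exact (h1.star_right.mul_right h1).mul_right (h2.star_right.mul_right h2)
  · rw [Finset.mem_Icc] at hx
    have hq : StarCommute A (q L lam x) :=
      ((hA (x + 1) (by omega) (by omega)).mul_right (hA (x + 2) (by omega) (by omega))).sub_right
        (((hA x (by omega) (by omega)).mul_right (hA (x + 3) (by omega) (by omega))).smul_right _)
    exact hq.star_right.mul_right hq

/-- Hamiltonians of disjoint intervals commute. -/
theorem ham_commute {L : ℕ} {κ : ℝ} {lam : ℂ} {a b c d : ℕ} (hb : a + 3 ≤ b) (hd : c + 3 ≤ d)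
    (h : b < c) : Commute (Ham L κ lam a b) (Ham L κ lam c d) := by
  refine (starCommute_ham (fun y h1 h2 => ?_) hd).1
  refine (starCommute_ham (fun z h3 h4 => ?_) hb).symm
  exact ⟨sigmaMinus_commute _ _ _, sigmaMinus_commute_star (by omega)⟩

theorem star_ham (L : ℕ) (κ : ℝ) (lam : ℂ) (a b : ℕ) :
    star (Ham L κ lam a b) = Ham L κ lam a b := by
  unfold Ham
  rw [op_star_add, op_star_smul, op_star_sum, op_star_sum]
  congr 1
  · refine Finset.sum_congr rfl fun x _ => ?_
    -- Taking the adjoint reverses the order of the two number operators.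
    have h : StarCommute (num L x) (num L (x + 2)) := by
      have h1 : StarCommute (sigmaMinus L (x + 2)) (sigmaMinus L x) :=
        ⟨sigmaMinus_commute _ _ _, sigmaMinus_commute_star (by omega)⟩
      have h2 := (h1.star_right.mul_right h1).symm
      exact h2.star_right.mul_right h2
    rw [star_mul, h.1.eq]
    simp only [num, star_mul, star_star]
  · congr 1
    · simp
    · exact Finset.sum_congr rfl fun x _ => by rw [star_mul, star_star]

/-! ### Number and bond operators in coordinates -/

theorem num_apply {L x : ℕ} (h1 : 1 ≤ x) (h2 : x ≤ L) (ψ : Hilb L) (μ : Config L) :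
    num L x ψ μ = if μ ⟨x - 1, by omega⟩ = true then ψ μ else 0 := by
  rw [num, sigmaMinus_eq h1 h2]
  rw [mul_apply_eq_comp, star_lower_apply]
  split_ifs with h
  · rw [lower_apply]
    simp [← h]
  · rfl

theorem sub_smul_mul_apply {L : ℕ} (A B C D : Op L) (c : ℂ) (ψ : Hilb L) (ν : Config L) :
    (A * B - c • (C * D)) ψ ν = A (B ψ) ν - c * C (D ψ) ν := rfl

/-- `q_x` in coordinates, with the sites of the bond counted from zero. -/
theorem q_apply {L y : ℕ} (h : y + 4 ≤ L) (lam : ℂ) (ψ : Hilb L) (ν : Config L) :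
    q L lam (y + 1) ψ ν =
      (if ν ⟨y + 1, by omega⟩ = false ∧ ν ⟨y + 2, by omega⟩ = false then
        ψ (Function.update (Function.update ν ⟨y + 1, by omega⟩ true) ⟨y + 2, by omega⟩ true)
        else 0)
      - lam * (if ν ⟨y, by omega⟩ = false ∧ ν ⟨y + 3, by omega⟩ = false then
        ψ (Function.update (Function.update ν ⟨y, by omega⟩ true) ⟨y + 3, by omega⟩ true)
        else 0) := by
  unfold q
  rw [sigmaMinus_eq (by omega) (by omega), sigmaMinus_eq (by omega) (by omega),
    sigmaMinus_eq (by omega) (by omega), sigmaMinus_eq (by omega) (by omega)]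
  simp only [sub_smul_mul_apply, lower_apply]
  have e1 : ∀ (c : Bool), Function.update ν ⟨y + 1, by omega⟩ c ⟨y + 2, by omega⟩
      = ν ⟨y + 2, by omega⟩ := fun c => Function.update_of_ne (by simp [Fin.ext_iff]) _ _
  have e2 : ∀ (c : Bool), Function.update ν ⟨y, by omega⟩ c ⟨y + 3, by omega⟩
      = ν ⟨y + 3, by omega⟩ := fun c => Function.update_of_ne (by simp [Fin.ext_iff]) _ _
  simp only [show y + 1 + 1 - 1 = y + 1 by omega, show y + 1 + 2 - 1 = y + 2 by omega,
    show y + 1 - 1 = y by omega, show y + 1 + 3 - 1 = y + 3 by omega, e1, e2, ite_and]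

/-- The adjoint of `q_x` in coordinates. -/
theorem star_q_apply {L y : ℕ} (h : y + 4 ≤ L) (lam : ℂ) (ψ : Hilb L) (ν : Config L) :
    star (q L lam (y + 1)) ψ ν =
      (if ν ⟨y + 1, by omega⟩ = true ∧ ν ⟨y + 2, by omega⟩ = true then
        ψ (Function.update (Function.update ν ⟨y + 1, by omega⟩ false) ⟨y + 2, by omega⟩ false)
        else 0)
      - star lam * (if ν ⟨y, by omega⟩ = true ∧ ν ⟨y + 3, by omega⟩ = true then
        ψ (Function.update (Function.update ν ⟨y, by omega⟩ false) ⟨y + 3, by omega⟩ false)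
        else 0) := by
  unfold q
  -- The lowering operators are swapped before taking adjoints, so that the updates come out in the
  -- same order as in `q_apply`.
  rw [sigmaMinus_eq (by omega) (by omega), sigmaMinus_eq (by omega) (by omega),
    sigmaMinus_eq (by omega) (by omega), sigmaMinus_eq (by omega) (by omega),
    (lower_commute _ _).eq, (lower_commute ⟨y + 1 - 1, by omega⟩ _).eq,
    op_star_sub, op_star_smul, star_mul, star_mul]
  simp only [sub_smul_mul_apply, star_lower_apply]
  have e1 : ∀ (c : Bool), Function.update ν ⟨y + 1, by omega⟩ c ⟨y + 2, by omega⟩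
      = ν ⟨y + 2, by omega⟩ := fun c => Function.update_of_ne (by simp [Fin.ext_iff]) _ _
  have e2 : ∀ (c : Bool), Function.update ν ⟨y, by omega⟩ c ⟨y + 3, by omega⟩
      = ν ⟨y + 3, by omega⟩ := fun c => Function.update_of_ne (by simp [Fin.ext_iff]) _ _
  simp only [show y + 1 + 1 - 1 = y + 1 by omega, show y + 1 + 2 - 1 = y + 2 by omega,
    show y + 1 - 1 = y by omega, show y + 1 + 3 - 1 = y + 3 by omega, e1, e2, ite_and]

end

end FQH

namespace FQH

noncomputable section

/-! ### Padded tilings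

Appending two empty sites to the chain turns the truncated tiles `M1`, `M2`, `D1`, `D2` into bulk
tiles and `Br` into the word of `D2`. In the padded picture the only replacement rule is
`MM ↔ D`. -/

/-- Voids, monomers and dimers. -/
def Bulk (t : Tile) : Prop := t = .V ∨ t = .M ∨ t = .D

/-- Bulk tiles, possibly followed by a padded right boundary tile. -/
def IsTail : List Tile → Prop
  | [] => True
  | t :: T => (Bulk t ∧ IsTail T) ∨ (t = .D2 ∧ T = [])

/-- Bulk tiles, possibly preceded by a left boundary tile. -/
def IsHead (X : List Tile) : Prop :=
  (∀ s ∈ X, Bulk s) ∨ ∃ X', X = .Bl :: X' ∧ ∀ s ∈ X', Bulk s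

/-- Padded tilings of `[1, L + 2]`. -/
def Ext (L : ℕ) (T : List Tile) : Prop :=
  (conf T).length = L + 2 ∧ (IsTail T ∨ ∃ S, T = .Bl :: S ∧ IsTail S)

theorem word_V : Tile.V.word = [false] := rfl

theorem conf_nil : conf [] = [] := rfl

theorem conf_cons (t : Tile) (T : List Tile) : conf (t :: T) = t.word ++ conf T := rfl

theorem conf_append (S T : List Tile) : conf (S ++ T) = conf S ++ conf T := by
  simp [conf, List.flatMap_append]

theorem not_bulk_Bl : ¬ Bulk .Bl := by simp [Bulk]

theorem not_bulk_D2 : ¬ Bulk .D2 := by simp [Bulk]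

theorem isTail_append_cons (X Y : List Tile) (t : Tile) :
    IsTail (X ++ t :: Y) ↔ (∀ s ∈ X, Bulk s) ∧ IsTail (t :: Y) := by
  induction X with
  | nil => simp
  | cons s X ih =>
    rw [List.cons_append, IsTail, ih]
    simp [and_assoc]

theorem isTail_cons_of_bulk {t : Tile} (ht : Bulk t) (T : List Tile) :
    IsTail (t :: T) ↔ IsTail T := by
  rw [IsTail]
  constructor
  · rintro (h | ⟨rfl, -⟩)
    · exact h.2
    · exact absurd ht not_bulk_D2
  · exact fun h => Or.inl ⟨ht, h⟩

theorem isTail_of_bulk {X : List Tile} (h : ∀ s ∈ X, Bulk s) : IsTail X := by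
  induction X with
  | nil => trivial
  | cons s X ih =>
    rw [isTail_cons_of_bulk (h s (by simp))]
    exact ih fun t ht => h t (by simp [ht])

theorem isTail_append {X : List Tile} (h : ∀ s ∈ X, Bulk s) (Y : List Tile) :
    IsTail (X ++ Y) ↔ IsTail Y := by
  induction X with
  | nil => simp
  | cons s X ih =>
    rw [List.cons_append, isTail_cons_of_bulk (h s (by simp))]
    exact ih fun t ht => h t (by simp [ht])

/-- A bulk tile decouples the two boundary conditions: what stands to its left only has to be a
head, what stands to its right only a tail. This is why blocks of bulk tiles can be exchanged
freely. -/
theorem ext_append_cons {t : Tile} (ht : Bulk t) (L : ℕ) (X Y : List Tile) :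
    Ext L (X ++ t :: Y) ↔ (conf (X ++ t :: Y)).length = L + 2 ∧ IsHead X ∧ IsTail Y := by
  rw [Ext, isTail_append_cons, isTail_cons_of_bulk ht, IsHead]
  refine and_congr_right fun _ => ?_
  constructor
  · rintro (h | ⟨S, hS, h⟩)
    · exact ⟨Or.inl h.1, h.2⟩
    · cases X with
      | nil =>
        simp only [List.nil_append, List.cons.injEq] at hS
        exact absurd (hS.1 ▸ ht) not_bulk_Bl
      | cons s X =>
        simp only [List.cons_append, List.cons.injEq] at hS
        obtain ⟨rfl, rfl⟩ := hS
        rw [isTail_append_cons, isTail_cons_of_bulk ht] at h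
        exact ⟨Or.inr ⟨X, rfl, h.1⟩, h.2⟩
  · rintro ⟨h | ⟨X', rfl, h⟩, hY⟩
    · exact Or.inl ⟨h, hY⟩
    · refine Or.inr ⟨X' ++ t :: Y, rfl, ?_⟩
      rw [isTail_append_cons, isTail_cons_of_bulk ht]
      exact ⟨h, hY⟩

theorem ext_MM_iff (L : ℕ) (X Y : List Tile) :
    Ext L (X ++ .M :: .M :: Y) ↔ Ext L (X ++ .D :: Y) := by
  rw [ext_append_cons (by simp [Bulk]), ext_append_cons (by simp [Bulk]),
    isTail_cons_of_bulk (by simp [Bulk])]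
  simp [conf_append, conf_cons, Tile.word]

/-- Replacing a block of bulk tiles by another block of the same length. -/
theorem ext_replace {L : ℕ} {X R R' Y : List Tile} (hR : ∀ s ∈ R, Bulk s) (hR' : ∀ s ∈ R', Bulk s)
    (hne : R ≠ []) (hne' : R' ≠ []) (hl : (conf R').length = (conf R).length)
    (h : Ext L (X ++ (R ++ Y))) : Ext L (X ++ (R' ++ Y)) := by
  obtain ⟨t, R, rfl⟩ := List.exists_cons_of_ne_nil hne
  obtain ⟨t', R', rfl⟩ := List.exists_cons_of_ne_nil hne'
  rw [List.cons_append, ext_append_cons (hR t (by simp)),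
    isTail_append fun s hs => hR s (by simp [hs])] at h
  rw [List.cons_append, ext_append_cons (hR' t' (by simp)),
    isTail_append fun s hs => hR' s (by simp [hs])]
  refine ⟨?_, h.2⟩
  rw [← h.1]
  simp only [conf_append, conf_cons, List.length_append] at hl ⊢
  omega

/-! ### Patterns in configurations -/

/-- The word is read tile by tile: beyond the first tile the induction applies, and inside it
finitely many positions are checked. Every tile of a tail ends with an empty site, so adjacent
particles lie in one tile. -/
theorem dimer_of_isTail {T : List Tile} (hT : IsTail T) {i : ℕ}
    (h1 : (conf T).getD i false = true) (h2 : (conf T).getD (i + 1) false = true) :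
    (∃ X Y, T = X ++ .D :: Y ∧ (conf X).length + 1 = i) ∨
      ∃ X, T = X ++ [.D2] ∧ (conf X).length + 1 = i := by
  induction T generalizing i with
  | nil => simp [conf] at h1
  | cons t T ih =>
    have key : ∀ n, t.word.length = n → Bulk t → n ≤ i →
        (∃ X Y, t :: T = X ++ .D :: Y ∧ (conf X).length + 1 = i) ∨
          ∃ X, t :: T = X ++ [.D2] ∧ (conf X).length + 1 = i := by
      intro n hn ht hi
      rw [conf_cons, List.getD_append_right _ _ _ _ (by omega)] at h1 h2
      rw [show i + 1 - t.word.length = i - n + 1 by omega] at h2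
      rw [hn] at h1
      rcases ih ((isTail_cons_of_bulk ht T).1 hT) h1 h2 with ⟨X, Y, rfl, h⟩ | ⟨X, rfl, h⟩
      · refine Or.inl ⟨t :: X, Y, rfl, ?_⟩
        simp only [conf_cons, List.length_append]
        omega
      · refine Or.inr ⟨t :: X, rfl, ?_⟩
        simp only [conf_cons, List.length_append]
        omega
    rcases hT with ⟨rfl | rfl | rfl, hT⟩ | ⟨rfl, rfl⟩
    · rcases Nat.lt_or_ge i 1 with hi | hi
      · interval_cases i
        simp [conf_cons, Tile.word] at h1
      · exact key 1 rfl (by simp [Bulk]) hi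
    · rcases Nat.lt_or_ge i 3 with hi | hi
      · interval_cases i <;> simp [conf_cons, Tile.word] at h1 h2
      · exact key 3 rfl (by simp [Bulk]) hi
    · rcases Nat.lt_or_ge i 6 with hi | hi
      · interval_cases i <;> first
          | exact Or.inl ⟨[], T, rfl, rfl⟩
          | simp [conf_cons, Tile.word] at h1 h2
      · exact key 6 rfl (by simp [Bulk]) hi
    · rcases Nat.lt_or_ge i 5 with hi | hi
      · interval_cases i <;> first
          | exact Or.inr ⟨[], rfl, rfl⟩
          | simp [conf_cons, Tile.word, conf_nil] at h1 h2
      · rw [List.getD_eq_default _ _ (by simpa [conf_cons, conf_nil, Tile.word] using hi)] at h1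
        simp at h1

/-- A dimer is followed by three empty sites and `D2` ends the tiling, so only the first particles
of two consecutive monomers are at distance three. -/
theorem monomers_of_isTail {T : List Tile} (hT : IsTail T) {i : ℕ}
    (h1 : (conf T).getD i false = true) (h2 : (conf T).getD (i + 3) false = true) :
    ∃ X Y, T = X ++ .M :: .M :: Y ∧ (conf X).length = i := by
  induction T generalizing i with
  | nil => simp [conf] at h1
  | cons t T ih =>
    have key : ∀ n, t.word.length = n → Bulk t → n ≤ i →
        (∃ X Y, t :: T = X ++ .M :: .M :: Y ∧ (conf X).length = i) := by
      intro n hn ht hi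
      rw [conf_cons, List.getD_append_right _ _ _ _ (by omega)] at h1 h2
      rw [show i + 3 - t.word.length = i - n + 3 by omega] at h2
      rw [hn] at h1
      obtain ⟨X, Y, rfl, h⟩ := ih ((isTail_cons_of_bulk ht T).1 hT) h1 h2
      refine ⟨t :: X, Y, rfl, ?_⟩
      simp only [conf_cons, List.length_append]
      omega
    rcases hT with ⟨rfl | rfl | rfl, hT⟩ | ⟨rfl, rfl⟩
    · rcases Nat.lt_or_ge i 1 with hi | hi
      · interval_cases i
        simp [conf_cons, Tile.word] at h1
      · exact key 1 rfl (by simp [Bulk]) hi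
    · rcases Nat.lt_or_ge i 3 with hi | hi
      · interval_cases i
        · cases T with
          | nil => simp [conf_cons, conf_nil, Tile.word] at h2
          | cons s S =>
            rcases hT with ⟨rfl | rfl | rfl, -⟩ | ⟨rfl, -⟩
            · simp [conf_cons, Tile.word] at h2
            · exact ⟨[], S, rfl, rfl⟩
            · simp [conf_cons, Tile.word] at h2
            · simp [conf_cons, Tile.word] at h2
        · simp [conf_cons, Tile.word] at h1
        · simp [conf_cons, Tile.word] at h1
      · exact key 3 rfl (by simp [Bulk]) hi
    · rcases Nat.lt_or_ge i 6 with hi | hi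
      · interval_cases i <;> simp [conf_cons, Tile.word] at h1 h2
      · exact key 6 rfl (by simp [Bulk]) hi
    · rcases Nat.lt_or_ge i 5 with hi | hi
      · interval_cases i <;> simp [conf_cons, Tile.word, conf_nil] at h1 h2
      · rw [List.getD_eq_default _ _ (by simpa [conf_cons, conf_nil, Tile.word] using hi)] at h1
        simp at h1

theorem not_next_nearest_of_isTail {T : List Tile} (hT : IsTail T) {i : ℕ}
    (h1 : (conf T).getD i false = true) (h2 : (conf T).getD (i + 2) false = true) : False := by
  induction T generalizing i with
  | nil => simp [conf] at h1
  | cons t T ih =>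
    have key : ∀ n, t.word.length = n → Bulk t → n ≤ i → False := by
      intro n hn ht hi
      rw [conf_cons, List.getD_append_right _ _ _ _ (by omega)] at h1 h2
      rw [show i + 2 - t.word.length = i - n + 2 by omega] at h2
      rw [hn] at h1
      exact ih ((isTail_cons_of_bulk ht T).1 hT) h1 h2
    rcases hT with ⟨rfl | rfl | rfl, hT⟩ | ⟨rfl, rfl⟩
    · rcases Nat.lt_or_ge i 1 with hi | hi
      · interval_cases i
        simp [conf_cons, Tile.word] at h1
      · exact key 1 rfl (by simp [Bulk]) hi
    · rcases Nat.lt_or_ge i 3 with hi | hi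
      · interval_cases i <;> simp [conf_cons, Tile.word] at h1 h2
      · exact key 3 rfl (by simp [Bulk]) hi
    · rcases Nat.lt_or_ge i 6 with hi | hi
      · interval_cases i <;> simp [conf_cons, Tile.word] at h1 h2
      · exact key 6 rfl (by simp [Bulk]) hi
    · rcases Nat.lt_or_ge i 5 with hi | hi
      · interval_cases i <;> simp [conf_cons, Tile.word, conf_nil] at h1 h2
      · rw [List.getD_eq_default _ _ (by simpa [conf_cons, conf_nil, Tile.word] using hi)] at h1
        simp at h1

/-- Two adjacent particles, not at the left end and followed by another site of the chain, belong
to a dimer. -/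
theorem dimer_of_ext {L : ℕ} {T : List Tile} (hT : Ext L T) {y : ℕ} (hy : y + 4 ≤ L)
    (h1 : (conf T).getD (y + 1) false = true) (h2 : (conf T).getD (y + 2) false = true) :
    ∃ X Y, T = X ++ .D :: Y ∧ (conf X).length = y := by
  obtain ⟨hl, hT | ⟨S, rfl, hS⟩⟩ := hT
  · rcases dimer_of_isTail hT h1 h2 with ⟨X, Y, h, h'⟩ | ⟨X, rfl, h'⟩
    · exact ⟨X, Y, h, by omega⟩
    · simp [conf_append, conf_cons, conf_nil, Tile.word] at hl
      omega
  · rcases Nat.lt_or_ge y 4 with hi | hi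
    · interval_cases y <;> simp [conf_cons, Tile.word] at h1 h2
    · rw [conf_cons, List.getD_append_right _ _ _ _ (by simp [Tile.word]; omega)] at h1 h2
      rw [show y + 2 - Tile.Bl.word.length = y + 1 - Tile.Bl.word.length + 1 by
        simp [Tile.word]; omega] at h2
      simp only [conf_cons, Tile.word, List.length_append, List.length_cons, List.length_nil]
        at hl h1 h2
      rcases dimer_of_isTail hS h1 h2 with ⟨X, Y, rfl, h'⟩ | ⟨X, rfl, h'⟩
      · exact ⟨.Bl :: X, Y, rfl, by simp [conf_cons, Tile.word]; omega⟩
      · simp [conf_append, conf_cons, conf_nil, Tile.word] at hl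
        omega

/-- Particles at distance three belong to two adjacent monomers. -/
theorem monomers_of_ext {L : ℕ} {T : List Tile} (hT : Ext L T) {y : ℕ}
    (h1 : (conf T).getD y false = true) (h2 : (conf T).getD (y + 3) false = true) :
    ∃ X Y, T = X ++ .M :: .M :: Y ∧ (conf X).length = y := by
  obtain ⟨-, hT | ⟨S, rfl, hS⟩⟩ := hT
  · exact monomers_of_isTail hT h1 h2
  · rcases Nat.lt_or_ge y 5 with hi | hi
    · interval_cases y <;> simp [conf_cons, Tile.word] at h1 h2
    · rw [conf_cons, List.getD_append_right _ _ _ _ (by simp [Tile.word]; omega)] at h1 h2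
      rw [show y + 3 - Tile.Bl.word.length = y - Tile.Bl.word.length + 3 by
        simp [Tile.word]; omega] at h2
      obtain ⟨X, Y, rfl, h'⟩ := monomers_of_isTail hS h1 h2
      refine ⟨.Bl :: X, Y, rfl, ?_⟩
      rw [conf_cons, List.length_append, h']
      simp only [Tile.word, List.length_cons, List.length_nil]
      omega

theorem not_next_nearest_of_ext {L : ℕ} {T : List Tile} (hT : Ext L T) {y : ℕ}
    (h1 : (conf T).getD y false = true) (h2 : (conf T).getD (y + 2) false = true) : False := by
  obtain ⟨-, hT | ⟨S, rfl, hS⟩⟩ := hT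
  · exact not_next_nearest_of_isTail hT h1 h2
  · rcases Nat.lt_or_ge y 5 with hi | hi
    · interval_cases y <;> simp [conf_cons, Tile.word] at h1 h2
    · rw [conf_cons, List.getD_append_right _ _ _ _ (by simp [Tile.word]; omega)] at h1 h2
      rw [show y + 2 - Tile.Bl.word.length = y - Tile.Bl.word.length + 2 by
        simp [Tile.word]; omega] at h2
      exact not_next_nearest_of_isTail hS h1 h2

/-! ### Tilings are determined by their configurations -/

/-- The first tile can be read off the word. The one ambiguity, `V` against the leading empty site
of a dimer, is excluded because no tail starts with two particles; `D` and `D2` differ in length,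
the latter ending the word. -/
theorem conf_inj_of_isTail {T T' : List Tile} (hT : IsTail T) (hT' : IsTail T')
    (h : conf T = conf T') : T = T' := by
  induction T generalizing T' with
  | nil =>
    cases T' with
    | nil => rfl
    | cons t T' =>
      have := congrArg List.length h
      cases t <;> simp [conf_cons, conf_nil, Tile.word] at this
  | cons t T ih =>
    cases T' with
    | nil =>
      have := congrArg List.length h
      cases t <;> simp [conf_cons, conf_nil, Tile.word] at this
    | cons t' T' =>
      have aux : ∀ {S : List Tile}, IsTail S → ∀ w, conf S = true :: true :: w → False := by
        intro S hS w hw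
        cases S with
        | nil => simp [conf_nil] at hw
        | cons s S => rcases hS with ⟨rfl | rfl | rfl, -⟩ | ⟨rfl, -⟩ <;>
            simp [conf_cons, Tile.word] at hw
      rcases hT with ⟨rfl | rfl | rfl, hT⟩ | ⟨rfl, rfl⟩ <;>
        rcases hT' with ⟨rfl | rfl | rfl, hT'⟩ | ⟨rfl, rfl⟩ <;>
        simp only [conf_cons, conf_nil, Tile.word, List.cons_append, List.nil_append,
          List.cons.injEq, true_and, reduceCtorEq, false_and, and_false] at h
      · rw [ih hT hT' h]
      · exact (aux hT _ h).elim
      · exact (aux hT _ h).elim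
      · rw [ih hT hT' h]
      · exact (aux hT' _ h.symm).elim
      · rw [ih hT hT' h]
      · exact (aux hT' _ h.symm).elim
      · rfl

theorem conf_inj_of_ext {L : ℕ} {T T' : List Tile} (hT : Ext L T) (hT' : Ext L T')
    (h : conf T = conf T') : T = T' := by
  have aux : ∀ {S : List Tile}, IsTail S → ∀ w, conf S = true :: true :: w → False := by
    intro S hS w hw
    cases S with
    | nil => simp [conf_nil] at hw
    | cons s S => rcases hS with ⟨rfl | rfl | rfl, -⟩ | ⟨rfl, -⟩ <;>
        simp [conf_cons, Tile.word] at hw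
  obtain ⟨-, hT | ⟨S, rfl, hS⟩⟩ := hT <;> obtain ⟨-, hT' | ⟨S', rfl, hS'⟩⟩ := hT'
  · exact conf_inj_of_isTail hT hT' h
  · exact (aux hT _ h).elim
  · exact (aux hT' _ h.symm).elim
  · rw [conf_inj_of_isTail hS hS' (List.append_cancel_left h)]

/-! ### Padding -/

theorem forall_bulk_of_bvmd {t : Tile} {T : List Tile} (hl : Tile.Bl ∉ T)
    (hr : ∀ t ∈ T, t = Tile.V ∨ t = Tile.M ∨ t = Tile.D ∨ t = Tile.Bl) (ht : t ∈ T) : Bulk t := by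
  rcases hr t ht with h | h | h | h
  · exact Or.inl h
  · exact Or.inr (Or.inl h)
  · exact Or.inr (Or.inr h)
  · exact absurd (h ▸ ht) hl

theorem isHead_of_bvmd {X : List Tile} (hl : Tile.Bl ∉ X.tail)
    (hr : ∀ t ∈ X, t = Tile.V ∨ t = Tile.M ∨ t = Tile.D ∨ t = Tile.Bl) : IsHead X := by
  cases X with
  | nil => exact Or.inl (by simp)
  | cons s X =>
    have hX : ∀ t ∈ X, Bulk t := fun t ht =>
      forall_bulk_of_bvmd (T := X) hl (fun u hu => hr u (by simp [hu])) ht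
    rcases hr s (by simp) with rfl | rfl | rfl | rfl
    · exact Or.inl (by simpa [Bulk] using hX)
    · exact Or.inl (by simpa [Bulk] using hX)
    · exact Or.inl (by simpa [Bulk] using hX)
    · exact Or.inr ⟨X, rfl, hX⟩

theorem isHead_iff {X : List Tile} : IsHead X ↔ Tile.Bl ∉ X.tail ∧
    ∀ t ∈ X, t = Tile.V ∨ t = Tile.M ∨ t = Tile.D ∨ t = Tile.Bl := by
  refine ⟨?_, fun h => isHead_of_bvmd h.1 h.2⟩
  have aux : ∀ {X : List Tile}, (∀ s ∈ X, Bulk s) → Tile.Bl ∉ X ∧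
      ∀ t ∈ X, t = Tile.V ∨ t = Tile.M ∨ t = Tile.D ∨ t = Tile.Bl := fun h =>
    ⟨fun hB => not_bulk_Bl (h _ hB), fun t ht => by
      rcases h t ht with h | h | h <;> simp [h]⟩
  rintro (h | ⟨X', rfl, h⟩)
  · exact ⟨fun hB => (aux h).1 (List.mem_of_mem_tail hB), (aux h).2⟩
  · refine ⟨(aux h).1, fun t ht => ?_⟩
    rcases List.mem_cons.1 ht with rfl | ht
    · simp
    · exact (aux h).2 t ht

theorem isBVMD_concat {L : ℕ} {X : List Tile} {t : Tile} (hX : IsHead X) (ht : t ≠ .Bl)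
    (hl : (conf (X ++ [t])).length = L) : IsBVMD L (X ++ [t]) := by
  refine ⟨hl, ?_, ?_⟩
  · cases X with
    | nil => simp
    | cons s X =>
      have := (isHead_iff.1 hX).1
      simp only [List.tail_cons] at this
      simp [this, Ne.symm ht]
  · simpa using (isHead_iff.1 hX).2

theorem isHead_concat {X : List Tile} {t : Tile} (hX : IsHead X) (ht : Bulk t) :
    IsHead (X ++ [t]) := by
  rcases hX with h | ⟨X', rfl, h⟩
  · refine Or.inl fun s hs => ?_
    rcases List.mem_append.1 hs with hs | hs
    · exact h s hs
    · simpa [List.mem_singleton.1 hs] using ht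
  · refine Or.inr ⟨X' ++ [t], rfl, fun s hs => ?_⟩
    rcases List.mem_append.1 hs with hs | hs
    · exact h s hs
    · simpa [List.mem_singleton.1 hs] using ht

theorem ext_of_isHead {L : ℕ} {X : List Tile} (hX : IsHead X)
    (hl : (conf X).length = L + 2) : Ext L X := by
  rcases hX with h | ⟨X', rfl, h⟩
  · exact ⟨hl, Or.inl (isTail_of_bulk h)⟩
  · exact ⟨hl, Or.inr ⟨X', rfl, isTail_of_bulk h⟩⟩

/-- The two empty sites complete `M1` to `M`, `M2` to `M` and `V`, `D1` to `D`, `D2` to `D` and `V`,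
and `Br` to `D2`; behind any other last tile they become two voids. -/
theorem exists_ext_of_isBVMD {L : ℕ} {T : List Tile} (hT : IsBVMD L T) :
    ∃ T', Ext L T' ∧ conf T' = conf T ++ [false, false] := by
  have hl := hT.covers
  have vv : ∀ {X : List Tile}, IsHead X → (conf X).length = L →
      ∃ T', Ext L T' ∧ conf T' = conf X ++ [false, false] := by
    intro X hX hl
    refine ⟨X ++ [.V] ++ [.V], ext_of_isHead
      (isHead_concat (isHead_concat hX (by simp [Bulk])) (by simp [Bulk])) ?_, ?_⟩ <;>
      simp [conf_append, conf_cons, conf_nil, Tile.word, hl]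
  rcases List.eq_nil_or_concat' T with rfl | ⟨X, t, rfl⟩
  · exact vv (Or.inl (by simp)) hl
  have hX : IsHead X := by
    refine isHead_of_bvmd (fun h => hT.left ?_) (by simpa using hT.right)
    cases X with
    | nil => simp at h
    | cons s X => simp at h ⊢; exact Or.inl h
  have one : ∀ s : Tile, Bulk s → s.word = t.word ++ [false, false] →
      ∃ T', Ext L T' ∧ conf T' = conf (X ++ [t]) ++ [false, false] := by
    intro s hs hw
    refine ⟨X ++ [s], ext_of_isHead (isHead_concat hX hs) ?_, ?_⟩
    · simp [conf_append, conf_cons, conf_nil, hw] at hl ⊢; omega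
    · simp [conf_append, conf_cons, conf_nil, hw]
  have two : ∀ s : Tile, Bulk s → s.word = t.word ++ [false] →
      ∃ T', Ext L T' ∧ conf T' = conf (X ++ [t]) ++ [false, false] := by
    intro s hs hw
    refine ⟨X ++ [s] ++ [.V], ext_of_isHead
      (isHead_concat (isHead_concat hX hs) (by simp [Bulk])) ?_, ?_⟩
    · simp [conf_append, conf_cons, conf_nil, hw, word_V] at hl ⊢; omega
    · simp [conf_append, conf_cons, conf_nil, hw, word_V]
  cases t with
  | V => exact vv (isHead_concat hX (by simp [Bulk])) hl
  | M => exact vv (isHead_concat hX (by simp [Bulk])) hl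
  | D => exact vv (isHead_concat hX (by simp [Bulk])) hl
  | Bl =>
    cases X with
    | nil => exact vv (Or.inr ⟨[], rfl, by simp⟩) hl
    | cons s X => exact absurd (by simp) hT.left
  | M1 => exact one .M (by simp [Bulk]) rfl
  | M2 => exact two .M (by simp [Bulk]) rfl
  | D1 => exact one .D (by simp [Bulk]) rfl
  | D2 => exact two .D (by simp [Bulk]) rfl
  | Br =>
    have hl' : (conf (X ++ [Tile.D2])).length = L + 2 := by
      simp [conf_append, conf_cons, conf_nil, Tile.word] at hl ⊢; omega
    refine ⟨X ++ [.D2], ⟨hl', ?_⟩, by simp [conf_append, conf_cons, conf_nil, Tile.word]⟩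
    rcases hX with h | ⟨X', rfl, h⟩
    · exact Or.inl ((isTail_append h _).2 (Or.inr ⟨rfl, rfl⟩))
    · exact Or.inr ⟨X' ++ [.D2], rfl, (isTail_append h _).2 (Or.inr ⟨rfl, rfl⟩)⟩

theorem isTail_cases {T : List Tile} (hT : IsTail T) :
    (∀ s ∈ T, Bulk s) ∨ ∃ X, T = X ++ [.D2] ∧ ∀ s ∈ X, Bulk s := by
  rcases List.eq_nil_or_concat' T with rfl | ⟨X, t, rfl⟩
  · exact Or.inl (by simp)
  · rw [isTail_append_cons] at hT
    obtain ⟨h, h' | ⟨rfl, -⟩⟩ := hT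
    · refine Or.inl fun s hs => ?_
      rcases List.mem_append.1 hs with hs | hs
      · exact h s hs
      · rw [List.mem_singleton.1 hs]; exact h'.1
    · exact Or.inr ⟨X, rfl, h⟩

theorem ext_cases {L : ℕ} {T : List Tile} (hT : Ext L T) :
    IsHead T ∨ ∃ X, T = X ++ [.D2] ∧ IsHead X := by
  obtain ⟨-, hT | ⟨S, rfl, hS⟩⟩ := hT
  · rcases isTail_cases hT with h | ⟨X, rfl, h⟩
    · exact Or.inl (Or.inl h)
    · exact Or.inr ⟨X, rfl, Or.inl h⟩
  · rcases isTail_cases hS with h | ⟨X, rfl, h⟩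
    · exact Or.inl (Or.inr ⟨S, rfl, h⟩)
    · exact Or.inr ⟨.Bl :: X, rfl, Or.inr ⟨X, rfl, h⟩⟩

theorem isHead_last {X : List Tile} {t : Tile} (h : IsHead (X ++ [t])) :
    (IsHead X ∧ Bulk t) ∨ (X = [] ∧ t = .Bl) := by
  rcases h with h | ⟨X', hX, h⟩
  · exact Or.inl ⟨Or.inl fun s hs => h s (by simp [hs]), h t (by simp)⟩
  · cases X with
    | nil => simp at hX; exact Or.inr ⟨rfl, hX.1⟩
    | cons s X =>
      simp only [List.cons_append, List.cons.injEq] at hX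
      obtain ⟨rfl, rfl⟩ := hX
      exact Or.inl ⟨Or.inr ⟨X, rfl, fun s hs => h s (by simp [hs])⟩, h t (by simp)⟩

/-- Inverse of the padding. The bound on `L` excludes the tilings `Bl` and `Bl`, `V` of five and six
sites, where cutting two sites would cut into `Bl`. -/
theorem exists_isBVMD_of_ext {L : ℕ} (hL : 5 ≤ L) {T : List Tile} (hT : Ext L T) :
    ∃ T', IsBVMD L T' ∧ conf T = conf T' ++ [false, false] := by
  have hl := hT.1
  have one : ∀ {X : List Tile} (s t : Tile), IsHead X → T = X ++ [s] → t ≠ .Bl →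
      s.word = t.word ++ [false, false] → ∃ T', IsBVMD L T' ∧ conf T = conf T' ++ [false, false] := by
    rintro X s t hX rfl ht hw
    refine ⟨X ++ [t], isBVMD_concat hX ht ?_, ?_⟩
    · simp [conf_append, conf_cons, conf_nil, hw] at hl ⊢; omega
    · simp [conf_append, conf_cons, conf_nil, hw]
  have two : ∀ {X : List Tile} (s t : Tile), IsHead X → T = X ++ [s] ++ [.V] → t ≠ .Bl →
      s.word = t.word ++ [false] → ∃ T', IsBVMD L T' ∧ conf T = conf T' ++ [false, false] := by
    rintro X s t hX rfl ht hw
    refine ⟨X ++ [t], isBVMD_concat hX ht ?_, ?_⟩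
    · simp [conf_append, conf_cons, conf_nil, hw, word_V] at hl ⊢; omega
    · simp [conf_append, conf_cons, conf_nil, hw, word_V]
  rcases ext_cases hT with hT | ⟨X, rfl, hX⟩
  swap
  · exact one .D2 .Br hX rfl (by simp) rfl
  rcases List.eq_nil_or_concat' T with rfl | ⟨X, t, rfl⟩
  · simp [conf_nil] at hl
  rcases isHead_last hT with ⟨hX, rfl | rfl | rfl⟩ | ⟨rfl, rfl⟩
  · rcases List.eq_nil_or_concat' X with rfl | ⟨Y, s, rfl⟩
    · simp [conf_cons, conf_nil, Tile.word] at hl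
    rcases isHead_last hX with ⟨hY, rfl | rfl | rfl⟩ | ⟨rfl, rfl⟩
    · rcases List.eq_nil_or_concat' Y with rfl | ⟨Z, u, rfl⟩
      · simp [conf_cons, conf_nil, Tile.word] at hl
        omega
      refine ⟨Z ++ [u], ?_, by simp [conf_append, conf_cons, conf_nil, Tile.word]⟩
      refine ⟨?_, (isHead_iff.1 hY).1, fun t ht => (isHead_iff.1 hY).2 t ?_⟩
      · simp [conf_append, conf_cons, conf_nil, Tile.word] at hl ⊢; omega
      · exact List.mem_of_mem_dropLast ht
    · exact two .M .M2 hY rfl (by simp) rfl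
    · exact two .D .D2 hY rfl (by simp) rfl
    · simp [conf_cons, conf_nil, Tile.word] at hl
      omega
  · exact one .M .M1 hX rfl (by simp) rfl
  · exact one .D .D1 hX rfl (by simp) rfl
  · simp [conf_cons, conf_nil, Tile.word] at hl
    omega

end

end FQH

namespace FQH

noncomputable section

/-! ### The tiling space in coordinates -/

/-- The configuration of a word, cut off after `L` letters. -/
def wordConfig (L : ℕ) (w : List Bool) : Config L := fun i => w.getD i false

/-- The configuration on `[1, L]` of a padded tiling. -/
def cfg (L : ℕ) (T : List Tile) : Config L := wordConfig L (conf T)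

theorem ket_apply (L : ℕ) (w : List Bool) (μ : Config L) :
    ket L w μ = if μ = wordConfig L w then 1 else 0 :=
  PiLp.single_apply _ _ _ _ _

theorem finite_ext (L : ℕ) : {T | Ext L T}.Finite :=
  (List.finite_length_le Tile (L + 2)).subset fun T hT => by
    have := length_le_length_conf T
    rw [hT.1] at this
    exact this

/-- The finite set of padded tilings. -/
def tilings (L : ℕ) : Finset (List Tile) := (finite_ext L).toFinset

theorem mem_tilings {L : ℕ} {T : List Tile} : T ∈ tilings L ↔ Ext L T := by
  simp [tilings]

theorem wordConfig_append {L : ℕ} {w : List Bool} (hw : w.length = L) :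
    wordConfig L (w ++ [false, false]) = wordConfig L w := by
  funext i
  simp only [wordConfig]
  rw [List.getD_append _ _ _ _ (by omega)]

theorem wordConfig_inj {L : ℕ} {w w' : List Bool} (hw : w.length = L) (hw' : w'.length = L)
    (h : wordConfig L w = wordConfig L w') : w = w' := by
  refine List.ext_getElem (by omega) fun i h1 h2 => ?_
  have := congrFun h ⟨i, by omega⟩
  simp only [wordConfig] at this
  rwa [List.getD_eq_getElem _ _ h1, List.getD_eq_getElem _ _ h2] at this

/-- Cutting off the padding loses nothing, because the two padding sites are empty in every padded
tiling. -/
theorem cfg_inj {L : ℕ} (hL : 5 ≤ L) {T T' : List Tile} (hT : Ext L T) (hT' : Ext L T')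
    (h : cfg L T = cfg L T') : T = T' := by
  obtain ⟨S, hS, e⟩ := exists_isBVMD_of_ext hL hT
  obtain ⟨S', hS', e'⟩ := exists_isBVMD_of_ext hL hT'
  refine conf_inj_of_ext hT hT' ?_
  rw [cfg, cfg, e, e', wordConfig_append hS.covers, wordConfig_append hS'.covers] at h
  rw [e, e', wordConfig_inj hS.covers hS'.covers h]

theorem mem_tilingSpace_iff {L : ℕ} (hL : 5 ≤ L) {ψ : Hilb L} :
    ψ ∈ tilingSpace L ↔ ∀ μ, (∀ T, Ext L T → cfg L T ≠ μ) → ψ μ = 0 := by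
  constructor
  · intro h
    induction h using Submodule.span_induction with
    | mem v hv =>
      obtain ⟨T, hT, rfl⟩ := hv
      intro μ hμ
      obtain ⟨T', hT', e⟩ := exists_ext_of_isBVMD hT
      rw [ket_apply, if_neg]
      rintro rfl
      exact hμ T' hT' (by rw [cfg, e, wordConfig_append hT.covers])
    | zero => simp
    | add u v _ _ hu hv =>
      intro μ hμ
      rw [PiLp.add_apply, hu μ hμ, hv μ hμ, add_zero]
    | smul c u _ hu =>
      intro μ hμ
      rw [PiLp.smul_apply, hu μ hμ, smul_zero]
  · intro h
    have : ψ = ∑ μ, ψ μ • EuclideanSpace.single μ (1 : ℂ) := by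
      ext ν
      rw [WithLp.ofLp_sum, Finset.sum_apply, Finset.sum_eq_single ν]
      · simp
      · intro μ _ hμ
        rw [PiLp.smul_apply, PiLp.single_apply, if_neg (Ne.symm hμ), smul_zero]
      · simp
    rw [this]
    refine Submodule.sum_mem _ fun μ _ => ?_
    by_cases hμ : ∀ T, Ext L T → cfg L T ≠ μ
    · rw [h μ hμ, zero_smul]
      exact Submodule.zero_mem _
    · push Not at hμ
      obtain ⟨T, hT, rfl⟩ := hμ
      refine Submodule.smul_mem _ _ (Submodule.subset_span ?_)
      obtain ⟨S, hS, e⟩ := exists_isBVMD_of_ext hL hT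
      refine ⟨S, hS, ?_⟩
      rw [cfg, e, wordConfig_append hS.covers]
      rfl

theorem apply_eq_zero_or {L : ℕ} (hL : 5 ≤ L) {ψ : Hilb L} (hψ : ψ ∈ tilingSpace L)
    (μ : Config L) : ψ μ = 0 ∨ ∃ T, Ext L T ∧ cfg L T = μ := by
  by_cases h : ∃ T, Ext L T ∧ cfg L T = μ
  · exact Or.inr h
  · push Not at h
    exact Or.inl ((mem_tilingSpace_iff hL).1 hψ μ h)

theorem sum_config {L : ℕ} (hL : 5 ≤ L) {E : Type*} [AddCommMonoid E] (G : Config L → E)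
    (hG : ∀ μ, (∀ T, Ext L T → cfg L T ≠ μ) → G μ = 0) :
    ∑ μ, G μ = ∑ T ∈ tilings L, G (cfg L T) := by
  classical
  rw [← Finset.sum_image (g := cfg L) (f := G)]
  · refine (Finset.sum_subset (Finset.subset_univ _) fun μ _ hμ => hG μ fun T hT h => hμ ?_).symm
    exact Finset.mem_image.2 ⟨T, mem_tilings.2 hT, h⟩
  · intro T hT T' hT' h
    exact cfg_inj hL (mem_tilings.1 hT) (mem_tilings.1 hT') h

theorem inner_eq_sum {L : ℕ} (hL : 5 ≤ L) (χ : Hilb L) {ψ : Hilb L} (hψ : ψ ∈ tilingSpace L) :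
    inner ℂ χ ψ = ∑ T ∈ tilings L, star (χ (cfg L T)) * ψ (cfg L T) := by
  rw [PiLp.inner_apply, sum_config hL]
  · exact Finset.sum_congr rfl fun T _ => mul_comm _ _
  · intro μ hμ
    rw [(mem_tilingSpace_iff hL).1 hψ μ hμ, inner_zero_right]

theorem norm_sq_eq_sum {L : ℕ} (hL : 5 ≤ L) {ψ : Hilb L} (hψ : ψ ∈ tilingSpace L) :
    ‖ψ‖ ^ 2 = ∑ T ∈ tilings L, ‖ψ (cfg L T)‖ ^ 2 := by
  rw [EuclideanSpace.norm_sq_eq, sum_config hL]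
  intro μ hμ
  rw [(mem_tilingSpace_iff hL).1 hψ μ hμ]
  simp

/-- The vector of the tiling space with given amplitudes. -/
def tilingVec (L : ℕ) (F : List Tile → ℂ) : Hilb L := ∑ T ∈ tilings L, F T • ket L (conf T)

theorem tilingVec_apply {L : ℕ} (hL : 5 ≤ L) (F : List Tile → ℂ) {T : List Tile} (hT : Ext L T) :
    tilingVec L F (cfg L T) = F T := by
  rw [tilingVec, WithLp.ofLp_sum, Finset.sum_apply, Finset.sum_eq_single T]
  · rw [PiLp.smul_apply, ket_apply, if_pos (by rfl), smul_eq_mul, mul_one]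
  · intro S hS hST
    rw [PiLp.smul_apply, ket_apply, if_neg, smul_zero]
    exact fun h => hST (cfg_inj hL (mem_tilings.1 hS) hT h.symm)
  · exact fun h => absurd (mem_tilings.2 hT) h

theorem tilingVec_mem {L : ℕ} (hL : 5 ≤ L) (F : List Tile → ℂ) : tilingVec L F ∈ tilingSpace L := by
  rw [mem_tilingSpace_iff hL]
  intro μ hμ
  rw [tilingVec, WithLp.ofLp_sum, Finset.sum_apply]
  refine Finset.sum_eq_zero fun T hT => ?_
  rw [PiLp.smul_apply, ket_apply, if_neg, smul_zero]
  exact fun h => hμ T (mem_tilings.1 hT) h.symm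

/-! ### The operators `q_x` on the tiling space -/

theorem update_wordConfig {L : ℕ} (u v : List Bool) (j : ℕ) (c : Bool) (hj : j < v.length)
    (h : u.length + j < L) :
    Function.update (wordConfig L (u ++ v)) ⟨u.length + j, h⟩ c
      = wordConfig L (u ++ v.set j c) := by
  funext i
  simp only [wordConfig, Function.update_apply, Fin.ext_iff, List.getD_eq_getElem?_getD]
  rcases Nat.lt_or_ge i u.length with hi | hi
  · rw [if_neg (by omega), List.getElem?_append_left hi, List.getElem?_append_left hi]
  · rw [List.getElem?_append_right hi, List.getElem?_append_right hi, List.getElem?_set]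
    split_ifs with h1 h2 h2
    · rfl
    · omega
    · omega
    · rfl

/-- Six voids. -/
def sixVoids : List Tile := [.V, .V, .V, .V, .V, .V]

theorem ext_sixVoids {L : ℕ} {X Y : List Tile} (h : Ext L (X ++ .D :: Y)) :
    Ext L (X ++ (sixVoids ++ Y)) :=
  ext_replace (R := [.D]) (by simp [Bulk]) (by simp [sixVoids, Bulk]) (by simp) (by simp [sixVoids])
    rfl h

section bond

variable {L y : ℕ} (h : y + 4 ≤ L)

/-- Sets the occupation numbers at two of the four sites of a bond. -/
def setTwo (i j : ℕ) (hi : i < 4) (hj : j < 4) (c : Bool) (μ : Config L) : Config L :=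
  Function.update (Function.update μ ⟨y + i, by omega⟩ c) ⟨y + j, by omega⟩ c

theorem setTwo_inv {i j : ℕ} {hi : i < 4} {hj : j < 4} {c : Bool} {μ : Config L}
    (h1 : μ ⟨y + i, by omega⟩ = c) (h2 : μ ⟨y + j, by omega⟩ = c) (d : Bool) :
    setTwo h i j hi hj c (setTwo h i j hi hj d μ) = μ := by
  funext m
  simp only [setTwo, Function.update_apply]
  split_ifs with h3 h4
  · rw [h3, h2]
  · rw [h4, h1]
  · rfl

theorem setTwo_apply_left {i j : ℕ} {hi : i < 4} {hj : j < 4} (c : Bool)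
    (μ : Config L) : setTwo h i j hi hj c μ ⟨y + i, by omega⟩ = c := by
  simp [setTwo, Function.update_apply, Fin.ext_iff]

theorem setTwo_apply_right {i j : ℕ} {hi : i < 4} {hj : j < 4} (c : Bool)
    (μ : Config L) : setTwo h i j hi hj c μ ⟨y + j, by omega⟩ = c := by
  simp [setTwo]

variable {X Y : List Tile}

theorem setTwo_cfg_D (hX : (conf X).length = y) :
    setTwo h 1 2 (by simp) (by simp) true (cfg L (X ++ (sixVoids ++ Y)))
      = cfg L (X ++ .D :: Y) := by
  subst hX
  simp only [setTwo, cfg, conf_append, sixVoids, conf_cons, Tile.word, List.cons_append,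
    List.nil_append]
  rw [update_wordConfig _ _ _ _ (by simp), update_wordConfig _ _ _ _ (by simp)]
  rfl

theorem setTwo_cfg_MM (hX : (conf X).length = y) :
    setTwo h 0 3 (by simp) (by simp) true (cfg L (X ++ (sixVoids ++ Y)))
      = cfg L (X ++ .M :: .M :: Y) := by
  subst hX
  simp only [setTwo, cfg, conf_append, sixVoids, conf_cons, Tile.word, List.cons_append,
    List.nil_append]
  rw [update_wordConfig _ _ _ _ (by simp), update_wordConfig _ _ _ _ (by simp)]
  rfl

theorem cfg_sixVoids (hX : (conf X).length = y) {i : ℕ} (hi : i < 4) :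
    cfg L (X ++ (sixVoids ++ Y)) ⟨y + i, by omega⟩ = false := by
  subst hX
  simp only [cfg, wordConfig, conf_append, sixVoids, conf_cons, Tile.word,
    List.cons_append, List.nil_append]
  rw [List.getD_append_right _ _ _ _ (by omega)]
  interval_cases i <;> simp

variable (lam : ℂ) (ψ : Hilb L)

theorem q_apply_setTwo (ν : Config L) :
    q L lam (y + 1) ψ ν =
      (if ν ⟨y + 1, by omega⟩ = false ∧ ν ⟨y + 2, by omega⟩ = false then
        ψ (setTwo h 1 2 (by simp) (by simp) true ν) else 0)
      - lam * (if ν ⟨y + 0, by omega⟩ = false ∧ ν ⟨y + 3, by omega⟩ = false then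
        ψ (setTwo h 0 3 (by simp) (by simp) true ν) else 0) :=
  q_apply h lam ψ ν

theorem star_q_apply_setTwo (ν : Config L) :
    star (q L lam (y + 1)) ψ ν =
      (if ν ⟨y + 1, by omega⟩ = true ∧ ν ⟨y + 2, by omega⟩ = true then
        ψ (setTwo h 1 2 (by simp) (by simp) false ν) else 0)
      - star lam * (if ν ⟨y + 0, by omega⟩ = true ∧ ν ⟨y + 3, by omega⟩ = true then
        ψ (setTwo h 0 3 (by simp) (by simp) false ν) else 0) :=
  star_q_apply h lam ψ ν

theorem q_apply_sixVoids (h : y + 4 ≤ L) (lam : ℂ) (ψ : Hilb L) (hX : (conf X).length = y) :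
    q L lam (y + 1) ψ (cfg L (X ++ (sixVoids ++ Y)))
      = ψ (cfg L (X ++ .D :: Y)) - lam * ψ (cfg L (X ++ .M :: .M :: Y)) := by
  rw [q_apply_setTwo h, if_pos ⟨cfg_sixVoids h hX (by simp), cfg_sixVoids h hX (by simp)⟩,
    if_pos ⟨cfg_sixVoids h hX (by simp), cfg_sixVoids h hX (by simp)⟩,
    setTwo_cfg_D h hX, setTwo_cfg_MM h hX]

variable {ψ}

/-- On the tiling space the image of `q_x` lives on configurations with six empty sites in place
of a dimer. -/
theorem exists_of_q_apply_ne_zero (h : y + 4 ≤ L) (lam : ℂ) (hL : 5 ≤ L)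
    (hψ : ψ ∈ tilingSpace L) {ν : Config L}
    (hν : q L lam (y + 1) ψ ν ≠ 0) :
    ∃ X Y, Ext L (X ++ .D :: Y) ∧ (conf X).length = y ∧ ν = cfg L (X ++ (sixVoids ++ Y)) := by
  by_contra hcon
  apply hν
  rw [q_apply_setTwo h]
  have e1 : (if ν ⟨y + 1, by omega⟩ = false ∧ ν ⟨y + 2, by omega⟩ = false then
        ψ (setTwo h 1 2 (by simp) (by simp) true ν) else 0) = 0 := by
    split_ifs with h0
    · rcases apply_eq_zero_or hL hψ (setTwo h 1 2 (by simp) (by simp) true ν) with h1 | ⟨T, hT, e⟩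
      · exact h1
      · obtain ⟨X, Y, rfl, hX⟩ := dimer_of_ext hT h
          (by have := setTwo_apply_left h (i := 1) (j := 2) (hi := by simp) (hj := by simp)
                true ν
              rw [← e] at this; exact this)
          (by have := setTwo_apply_right h (i := 1) (j := 2) (hi := by simp) (hj := by simp)
                true ν
              rw [← e] at this; exact this)
        -- Filling the two sites of `ν` gave the tiling with the dimer; emptying them again recovers
        -- `ν`, and it also turns the dimer into six voids.
        refine absurd ⟨X, Y, hT, hX, ?_⟩ hcon
        rw [← setTwo_inv h (i := 1) (j := 2) (hi := by simp) (hj := by simp) h0.1 h0.2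
          true, ← e, ← setTwo_cfg_D h hX, setTwo_inv h
            (cfg_sixVoids h hX (by simp)) (cfg_sixVoids h hX (by simp))]
    · rfl
  have e2 : (if ν ⟨y + 0, by omega⟩ = false ∧ ν ⟨y + 3, by omega⟩ = false then
        ψ (setTwo h 0 3 (by simp) (by simp) true ν) else 0) = 0 := by
    split_ifs with h0
    · rcases apply_eq_zero_or hL hψ (setTwo h 0 3 (by simp) (by simp) true ν) with h1 | ⟨T, hT, e⟩
      · exact h1
      · obtain ⟨X, Y, rfl, hX⟩ := monomers_of_ext (y := y) hT
          (by have := setTwo_apply_left h (i := 0) (j := 3) (hi := by simp) (hj := by simp)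
                true ν
              rw [← e] at this; exact this)
          (by have := setTwo_apply_right h (i := 0) (j := 3) (hi := by simp) (hj := by simp)
                true ν
              rw [← e] at this; exact this)
        refine absurd ⟨X, Y, (ext_MM_iff _ _ _).1 hT, hX, ?_⟩ hcon
        rw [← setTwo_inv h (i := 0) (j := 3) (hi := by simp) (hj := by simp) h0.1 h0.2
          true, ← e, ← setTwo_cfg_MM h hX, setTwo_inv h
            (cfg_sixVoids h hX (by simp)) (cfg_sixVoids h hX (by simp))]
    · rfl
  rw [e1, e2, mul_zero, sub_zero]

/-- The image vector is supported where a dimer has been emptied, so its vanishing amounts to one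
scalar equation for each tiling with a dimer at the bond. -/
theorem q_eq_zero_iff (h : y + 4 ≤ L) (lam : ℂ) (hL : 5 ≤ L) (hψ : ψ ∈ tilingSpace L) :
    q L lam (y + 1) ψ = 0 ↔ ∀ X Y, Ext L (X ++ .D :: Y) → (conf X).length = y →
      ψ (cfg L (X ++ .D :: Y)) = lam * ψ (cfg L (X ++ .M :: .M :: Y)) := by
  constructor
  · intro h0 X Y _ hX
    rw [← sub_eq_zero, ← q_apply_sixVoids h lam ψ hX, h0]
    rfl
  · intro hrel
    ext ν
    by_contra hν
    obtain ⟨X, Y, hT, hX, rfl⟩ := exists_of_q_apply_ne_zero h lam hL hψ hν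
    exact hν (by rw [q_apply_sixVoids h lam ψ hX, hrel X Y hT hX, sub_self]; rfl)

/-- The adjoint refills the six empty sites as a dimer or as two monomers, and both results are
tilings. -/
theorem star_q_q_mem (h : y + 4 ≤ L) (lam : ℂ) (hL : 5 ≤ L) (hψ : ψ ∈ tilingSpace L) :
    (star (q L lam (y + 1)) * q L lam (y + 1)) ψ ∈ tilingSpace L := by
  rw [mem_tilingSpace_iff hL]
  intro μ hμ
  rw [mul_apply_eq_comp, star_q_apply_setTwo h]
  have e1 : (if μ ⟨y + 1, by omega⟩ = true ∧ μ ⟨y + 2, by omega⟩ = true then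
        q L lam (y + 1) ψ (setTwo h 1 2 (by simp) (by simp) false μ) else 0) = 0 := by
    split_ifs with h0
    · by_contra hν
      obtain ⟨X, Y, hT, hX, e⟩ := exists_of_q_apply_ne_zero h lam hL hψ hν
      refine hμ _ hT ?_
      rw [← setTwo_cfg_D h hX, ← e, setTwo_inv h h0.1 h0.2]
    · rfl
  have e2 : (if μ ⟨y + 0, by omega⟩ = true ∧ μ ⟨y + 3, by omega⟩ = true then
        q L lam (y + 1) ψ (setTwo h 0 3 (by simp) (by simp) false μ) else 0) = 0 := by
    split_ifs with h0
    · by_contra hν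
      obtain ⟨X, Y, hT, hX, e⟩ := exists_of_q_apply_ne_zero h lam hL hψ hν
      refine hμ _ ((ext_MM_iff _ _ _).2 hT) ?_
      rw [← setTwo_cfg_MM h hX, ← e, setTwo_inv h h0.1 h0.2]
    · rfl
  rw [e1, e2, mul_zero, sub_zero]

end bond

theorem num_mul_num_apply {L x : ℕ} (hL : 5 ≤ L) (h1 : 1 ≤ x) (h2 : x + 2 ≤ L) {ψ : Hilb L}
    (hψ : ψ ∈ tilingSpace L) : (num L x * num L (x + 2)) ψ = 0 := by
  ext μ
  rw [mul_apply_eq_comp, num_apply h1 (by omega), num_apply (by omega) h2]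
  split_ifs with h3 h4
  · rcases apply_eq_zero_or hL hψ μ with h | ⟨T, hT, rfl⟩
    · exact h
    · refine (not_next_nearest_of_ext (y := x - 1) hT h3 ?_).elim
      rw [show x - 1 + 2 = x + 2 - 1 by omega]
      exact h4
  · rfl
  · rfl

/-! ### The Hamiltonians on the tiling space -/

section ham

variable {L a b : ℕ} (κ : ℝ) (lam : ℂ) {ψ : Hilb L}

theorem ham_apply (hL : 5 ≤ L) (ha : 1 ≤ a) (hab : a + 3 ≤ b) (hb : b ≤ L)
    (hψ : ψ ∈ tilingSpace L) :
    Ham L κ lam a b ψ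
      = (κ : ℂ) • ∑ x ∈ Finset.Icc a (b - 3), (star (q L lam x) * q L lam x) ψ := by
  rw [Ham, add_apply, smul_apply,
    sum_apply, sum_apply, Finset.sum_eq_zero, zero_add]
  intro x hx
  rw [Finset.mem_Icc] at hx
  exact num_mul_num_apply hL (by omega) (by omega) hψ

theorem ham_mem (hL : 5 ≤ L) (ha : 1 ≤ a) (hab : a + 3 ≤ b) (hb : b ≤ L)
    (hψ : ψ ∈ tilingSpace L) : Ham L κ lam a b ψ ∈ tilingSpace L := by
  rw [ham_apply κ lam hL ha hab hb hψ]
  refine Submodule.smul_mem _ _ (Submodule.sum_mem _ fun x hx => ?_)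
  rw [Finset.mem_Icc] at hx
  obtain ⟨y, rfl⟩ : ∃ y, x = y + 1 := ⟨x - 1, by omega⟩
  exact star_q_q_mem (by omega) lam hL hψ

theorem inner_ham (hL : 5 ≤ L) (ha : 1 ≤ a) (hab : a + 3 ≤ b) (hb : b ≤ L)
    (hψ : ψ ∈ tilingSpace L) :
    inner ℂ ψ (Ham L κ lam a b ψ)
      = ((κ * ∑ x ∈ Finset.Icc a (b - 3), ‖q L lam x ψ‖ ^ 2 : ℝ) : ℂ) := by
  rw [ham_apply κ lam hL ha hab hb hψ, inner_smul_right, inner_sum, Complex.ofReal_mul,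
    Complex.ofReal_sum]
  congr 1
  refine Finset.sum_congr rfl fun x _ => ?_
  rw [mul_apply_eq_comp, ContinuousLinearMap.star_eq_adjoint,
    ContinuousLinearMap.adjoint_inner_right, inner_self_eq_norm_sq_to_K]
  simp

theorem ham_eq_zero_iff (hκ : 0 < κ) (hL : 5 ≤ L) (ha : 1 ≤ a) (hab : a + 3 ≤ b) (hb : b ≤ L)
    (hψ : ψ ∈ tilingSpace L) :
    Ham L κ lam a b ψ = 0 ↔ ∀ x ∈ Finset.Icc a (b - 3), q L lam x ψ = 0 := by
  constructor
  · intro h x hx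
    have := inner_ham κ lam hL ha hab hb hψ
    rw [h, inner_zero_right, eq_comm, Complex.ofReal_eq_zero, mul_eq_zero] at this
    have := (Finset.sum_eq_zero_iff_of_nonneg (fun x _ => by positivity)).1
      (this.resolve_left hκ.ne') x hx
    simpa using this
  · intro h
    rw [ham_apply κ lam hL ha hab hb hψ, Finset.sum_eq_zero, smul_zero]
    intro x hx
    rw [mul_apply_eq_comp, h x hx, map_zero]

/-- The kernel relations `F (X D Y) = lam F (X M M Y)` for all bonds with sites in
`[lo + 1, hi]`. -/
def Rel (L : ℕ) (lam : ℂ) (F : List Tile → ℂ) (lo hi : ℕ) : Prop :=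
  ∀ X Y, Ext L (X ++ .D :: Y) → lo ≤ (conf X).length → (conf X).length + 4 ≤ hi →
    F (X ++ .D :: Y) = lam * F (X ++ .M :: .M :: Y)

theorem forall_q_eq_zero_iff_rel (hL : 5 ≤ L) (ha : 1 ≤ a) (hb : b ≤ L)
    (hψ : ψ ∈ tilingSpace L) : (∀ x ∈ Finset.Icc a (b - 3), q L lam x ψ = 0) ↔
      Rel L lam (fun T => ψ (cfg L T)) (a - 1) b := by
  constructor
  · intro h X Y hT h1 h2
    exact (q_eq_zero_iff (y := (conf X).length) (by omega) lam hL hψ).1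
      (h _ (by rw [Finset.mem_Icc]; omega)) X Y hT rfl
  · intro h x hx
    rw [Finset.mem_Icc] at hx
    obtain ⟨y, rfl⟩ : ∃ y, x = y + 1 := ⟨x - 1, by omega⟩
    rw [q_eq_zero_iff (by omega) lam hL hψ]
    rintro X Y hT rfl
    exact h X Y hT (by omega) (by omega)

end ham

end

end FQH

namespace FQH

noncomputable section

/-! ### Runs of monomers and dimers -/

instance : DecidableEq Tile := Classical.decEq _

/-- Tilings by monomers and dimers of an interval that has room for `j` monomers. -/
def runs : ℕ → Finset (List Tile)
  | 0 => {[]}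
  | 1 => {[.M]}
  | j + 2 => (runs (j + 1)).image (· ++ [.M]) ∪ (runs j).image (· ++ [.D])

theorem sum_runs {E : Type*} [AddCommMonoid E] (F : List Tile → E) (j : ℕ) :
    ∑ R ∈ runs (j + 2), F R = ∑ R ∈ runs (j + 1), F (R ++ [.M]) + ∑ R ∈ runs j, F (R ++ [.D]) := by
  rw [runs, Finset.sum_union, Finset.sum_image, Finset.sum_image]
  · exact fun _ _ _ _ h => List.append_cancel_right h
  · exact fun _ _ _ _ h => List.append_cancel_right h
  · rw [Finset.disjoint_left]
    intro T hT hT'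
    obtain ⟨R, -, rfl⟩ := Finset.mem_image.1 hT
    obtain ⟨R', -, h⟩ := Finset.mem_image.1 hT'
    simpa using congrArg List.getLast? h

/-- Monomers and dimers. -/
def MD (t : Tile) : Prop := t = .M ∨ t = .D

theorem MD.bulk {t : Tile} (h : MD t) : Bulk t := Or.inr h

theorem mem_runs {j : ℕ} {R : List Tile} :
    R ∈ runs j ↔ (∀ t ∈ R, MD t) ∧ (conf R).length = 3 * j := by
  induction j using Nat.strong_induction_on generalizing R with
  | _ j ih =>
    rcases List.eq_nil_or_concat' R with rfl | ⟨S, t, rfl⟩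
    · match j with
      | 0 => simp [runs, conf_nil]
      | 1 => simp [runs, conf_nil]
      | j + 2 => simp [runs, conf_nil]
    · have h0 : (conf (S ++ [t])).length = (conf S).length + t.word.length := by
        simp [conf_append, conf_cons, conf_nil]
      have hpos : 1 ≤ t.word.length := by cases t <;> simp [Tile.word]
      match j with
      | 0 =>
        simp only [runs, Finset.mem_singleton]
        refine iff_of_false (by simp) fun h => ?_
        omega
      | 1 =>
        simp only [runs, Finset.mem_singleton]
        constructor
        · intro h
          rw [h]
          simp [MD, conf_cons, conf_nil, Tile.word]
        · rintro ⟨h1, h2⟩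
          have hS : S = [] := by
            cases S with
            | nil => rfl
            | cons s S =>
              exfalso
              have hs : 3 ≤ s.word.length := by
                rcases h1 s (by simp) with rfl | rfl <;> simp [Tile.word]
              rw [conf_cons, List.length_append] at h0
              omega
          subst hS
          rcases h1 t (by simp) with rfl | rfl
          · rfl
          · simp [conf_cons, conf_nil, Tile.word] at h2
      | j + 2 =>
        simp only [runs, Finset.mem_union, Finset.mem_image]
        constructor
        · rintro (⟨R, hR, h⟩ | ⟨R, hR, h⟩)
          · obtain ⟨rfl, h⟩ := List.append_inj' (t₁ := [Tile.M]) h rfl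
            obtain rfl : Tile.M = t := by simpa using h
            obtain ⟨h1, h2⟩ := (ih (j + 1) (by omega)).1 hR
            refine ⟨fun t ht => ?_, ?_⟩
            · rcases List.mem_append.1 ht with ht | ht
              · exact h1 t ht
              · exact Or.inl (List.mem_singleton.1 ht)
            · simp only [Tile.word, List.length_cons, List.length_nil] at h0
              omega
          · obtain ⟨rfl, h⟩ := List.append_inj' (t₁ := [Tile.D]) h rfl
            obtain rfl : Tile.D = t := by simpa using h
            obtain ⟨h1, h2⟩ := (ih j (by omega)).1 hR
            refine ⟨fun t ht => ?_, ?_⟩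
            · rcases List.mem_append.1 ht with ht | ht
              · exact h1 t ht
              · exact Or.inr (List.mem_singleton.1 ht)
            · simp only [Tile.word, List.length_cons, List.length_nil] at h0
              omega
        · rintro ⟨h1, h2⟩
          have hS : ∀ t ∈ S, MD t := fun t ht => h1 t (by simp [ht])
          rcases h1 t (by simp) with rfl | rfl
          · refine Or.inl ⟨S, (ih (j + 1) (by omega)).2 ⟨hS, ?_⟩, rfl⟩
            simp only [Tile.word, List.length_cons, List.length_nil] at h0
            omega
          · refine Or.inr ⟨S, (ih j (by omega)).2 ⟨hS, ?_⟩, rfl⟩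
            simp only [Tile.word, List.length_cons, List.length_nil] at h0
            omega

theorem dimerCount_append (S T : List Tile) :
    dimerCount (S ++ T) = dimerCount S + dimerCount T := by
  simp [dimerCount]

theorem replicate_mem_runs (j : ℕ) : List.replicate j Tile.M ∈ runs j := by
  rw [mem_runs]
  refine ⟨fun t ht => Or.inl (List.eq_of_mem_replicate ht), ?_⟩
  induction j with
  | zero => rfl
  | succ j ih =>
    rw [List.replicate_succ, conf_cons, List.length_append, ih]
    simp only [Tile.word, List.length_cons, List.length_nil]
    omega

/-! ### Norms of the monomer states -/

/-- The squared norm of `φ_j` as a function of `r = |lam|²`. -/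
def runNorm (r : ℝ) : ℕ → ℝ
  | 0 => 1
  | 1 => 1
  | j + 2 => runNorm r (j + 1) + r * runNorm r j

theorem runNorm_pos {r : ℝ} (hr : 0 ≤ r) : ∀ j, 0 < runNorm r j
  | 0 => one_pos
  | 1 => one_pos
  | j + 2 => by
    have := runNorm_pos hr (j + 1)
    have := runNorm_pos hr j
    rw [runNorm]
    positivity

theorem sum_runs_pow (r : ℝ) (j : ℕ) : ∑ R ∈ runs j, r ^ dimerCount R = runNorm r j := by
  induction j using Nat.strong_induction_on with
  | _ j ih =>
    match j with
    | 0 => simp [runs, runNorm, dimerCount]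
    | 1 => simp [runs, runNorm, dimerCount, Tile.dimers]
    | j + 2 =>
      rw [sum_runs, runNorm, ← ih (j + 1) (by omega), ← ih j (by omega), Finset.mul_sum]
      congr 1 <;> refine Finset.sum_congr rfl fun R _ => ?_
      · simp [dimerCount, Tile.dimers]
      · rw [dimerCount_append, pow_add, mul_comm]
        simp [dimerCount, Tile.dimers]

/-- Binet's formula: β₊ and β₋ are the roots of t² = t + r, the characteristic equation of the
recursion for `runNorm`. -/
theorem betaPlus_sub_mul_runNorm {r : ℝ} (hr : 0 ≤ r) (j : ℕ) :
    (betaPlus r - betaMinus r) * runNorm r j = betaPlus r ^ (j + 1) - betaMinus r ^ (j + 1) := by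
  have hs : √(1 + 4 * r) ^ 2 = 1 + 4 * r := Real.sq_sqrt (by positivity)
  have hp : betaPlus r ^ 2 = betaPlus r + r := by unfold betaPlus; linear_combination hs / 4
  have hm : betaMinus r ^ 2 = betaMinus r + r := by unfold betaMinus; linear_combination hs / 4
  have h1 : betaPlus r + betaMinus r = 1 := by unfold betaPlus betaMinus; ring
  induction j using Nat.strong_induction_on with
  | _ j ih =>
    match j with
    | 0 => simp [runNorm]
    | 1 =>
      rw [runNorm]
      linear_combination (-betaPlus r + betaMinus r) * h1
    | j + 2 =>
      have e1 := ih (j + 1) (by omega)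
      have e0 := ih j (by omega)
      rw [runNorm]
      linear_combination e1 + r * e0 - betaPlus r ^ (j + 1) * hp + betaMinus r ^ (j + 1) * hm

theorem beta_eq {r : ℝ} (hr : 0 ≤ r) (n : ℕ) :
    beta r (n + 1) = runNorm r n / runNorm r (n + 1) := by
  have hs : 1 ≤ √(1 + 4 * r) := by
    rw [Real.one_le_sqrt]
    linarith
  have hp : 0 < betaPlus r := by unfold betaPlus; linarith
  have hd : 0 < betaPlus r - betaMinus r := by unfold betaPlus betaMinus; linarith
  have e0 := betaPlus_sub_mul_runNorm hr n
  have e1 := betaPlus_sub_mul_runNorm hr (n + 1)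
  have p1 := runNorm_pos hr (n + 1)
  have d1 : betaPlus r ^ (n + 1 + 1) - betaMinus r ^ (n + 1 + 1) ≠ 0 := by
    rw [← e1]; positivity
  have e : runNorm r n / runNorm r (n + 1)
      = (betaPlus r ^ (n + 1) - betaMinus r ^ (n + 1))
        / (betaPlus r ^ (n + 1 + 1) - betaMinus r ^ (n + 1 + 1)) := by
    rw [← e0, ← e1, mul_div_mul_left _ _ hd.ne']
  rw [e, beta, div_pow, div_pow, one_sub_div (by positivity), one_sub_div (by positivity)]
  field_simp
  ring

/-! ### Tilings connected to the monomer tiling -/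

theorem connected_cons (t : Tile) {S T : List Tile} (h : Connected S T) :
    Connected (t :: S) (t :: T) := by
  induction h with
  | rel S T h =>
    refine .rel _ _ ?_
    cases h with
    | bulk A B => exact Replace.bulk (t :: A) B
    | two A => exact Replace.two (t :: A)
    | one A => exact Replace.one (t :: A)
  | refl S => exact .refl _
  | symm S T _ ih => exact .symm _ _ ih
  | trans S T U _ _ ih ih' => exact .trans _ _ _ ih ih'

theorem connected_replicate {R : List Tile} (hR : ∀ t ∈ R, MD t) {n : ℕ}
    (hl : (conf R).length = 3 * n) : Connected R (List.replicate n .M) := by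
  induction R generalizing n with
  | nil =>
    obtain rfl : n = 0 := by simpa [conf_nil] using hl
    exact .refl _
  | cons t R ih =>
    have hR' : ∀ t ∈ R, MD t := fun s hs => hR s (by simp [hs])
    rcases hR t (by simp) with rfl | rfl
    · simp only [conf_cons, Tile.word, List.length_append, List.length_cons, List.length_nil] at hl
      obtain ⟨m, rfl⟩ : ∃ m, n = m + 1 := ⟨n - 1, by omega⟩
      exact connected_cons _ (ih hR' (by omega))
    · simp only [conf_cons, Tile.word, List.length_append, List.length_cons, List.length_nil] at hl
      obtain ⟨m, rfl⟩ : ∃ m, n = m + 2 := ⟨n - 2, by omega⟩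
      refine .trans _ _ _ (connected_cons _ (ih hR' (n := m) (by omega))) (.symm _ _ (.rel _ _ ?_))
      exact Replace.bulk [] (List.replicate m .M)

/-- The bulk replacement preserves length and the absence of other tiles; the two boundary
replacements always involve a truncated tile, so neither side is a run. -/
theorem mem_runs_iff_of_connected {S T : List Tile} (h : Connected S T) (n : ℕ) :
    S ∈ runs n ↔ T ∈ runs n := by
  induction h with
  | rel S T h =>
    cases h with
    | bulk A B =>
      rw [mem_runs, mem_runs]
      simp [MD, conf_append, conf_cons, Tile.word, or_imp, forall_and]
    | two A =>
      rw [mem_runs, mem_runs]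
      refine iff_of_false (fun h => ?_) fun h => ?_
      · simpa [MD] using h.1 .M2 (by simp)
      · simpa [MD] using h.1 .D2 (by simp)
    | one A =>
      rw [mem_runs, mem_runs]
      refine iff_of_false (fun h => ?_) fun h => ?_
      · simpa [MD] using h.1 .M1 (by simp)
      · simpa [MD] using h.1 .D1 (by simp)
  | refl S => rfl
  | symm S T _ ih => exact ih.symm
  | trans S T U _ _ ih ih' => exact ih.trans ih'

theorem isBVMD_and_connected_iff {n : ℕ} {T : List Tile} :
    IsBVMD (3 * n) T ∧ Connected T (List.replicate n .M) ↔ T ∈ runs n := by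
  constructor
  · exact fun h => (mem_runs_iff_of_connected h.2 n).2 (replicate_mem_runs n)
  · intro h
    obtain ⟨h1, h2⟩ := mem_runs.1 h
    refine ⟨⟨h2, fun hB => ?_, fun t ht => ?_⟩, connected_replicate h1 h2⟩
    · simpa [MD] using h1 _ (List.mem_of_mem_tail hB)
    · rcases h1 t (List.mem_of_mem_dropLast ht) with h | h <;> simp [h]

theorem norm_phi_sq (lam : ℂ) (n : ℕ) : ‖phi lam n‖ ^ 2 = runNorm (‖lam‖ ^ 2) n := by
  have hs : (finite_connected (3 * n) (List.replicate n .M)).toFinset = runs n := by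
    ext T
    rw [Set.Finite.mem_toFinset]
    exact isBVMD_and_connected_iff
  have ho : Orthonormal ℂ fun R : runs n => ket (3 * n) (conf R) := by
    refine ⟨fun R => by simp [ket], fun R S hRS => ?_⟩
    have hR := mem_runs.1 R.2
    have hS := mem_runs.1 S.2
    change inner ℂ (EuclideanSpace.single (wordConfig (3 * n) (conf R)) 1) (ket (3 * n) (conf S)) = 0
    rw [EuclideanSpace.inner_single_left, map_one, one_mul, ket_apply, if_neg]
    refine fun h => hRS (Subtype.ext (conf_inj_of_isTail
      (isTail_of_bulk fun t ht => (hR.1 t ht).bulk)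
      (isTail_of_bulk fun t ht => (hS.1 t ht).bulk) (wordConfig_inj hR.2 hS.2 h)))
  have key : (‖phi lam n‖ ^ 2 : ℂ) = ∑ R : runs n, (((‖lam‖ ^ 2) ^ dimerCount R.1 : ℝ) : ℂ) := by
    have e : phi lam n = ∑ R : runs n, lam ^ dimerCount R.1 • ket (3 * n) (conf R) := by
      rw [phi, bvmdState, hs, ← Finset.sum_coe_sort]
    have := inner_self_eq_norm_sq_to_K (𝕜 := ℂ) (phi lam n)
    rw [e, ho.inner_sum] at this
    rw [e]
    refine this.symm.trans (Finset.sum_congr rfl fun R _ => ?_)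
    rw [map_pow, ← mul_pow, Complex.conj_mul']
    simp
  rw [← sum_runs_pow, ← Finset.sum_coe_sort]
  exact_mod_cast key

/-! ### Properties of `f` -/

theorem beta_pos {r : ℝ} (hr : 0 ≤ r) {n : ℕ} (hn : 1 ≤ n) : 0 < beta r n := by
  obtain ⟨m, rfl⟩ : ∃ m, n = m + 1 := ⟨n - 1, by omega⟩
  rw [beta_eq hr]
  exact div_pos (runNorm_pos hr _) (runNorm_pos hr _)

theorem beta_le_one {r : ℝ} (hr : 0 ≤ r) {n : ℕ} (hn : 1 ≤ n) : beta r n ≤ 1 := by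
  obtain ⟨m, rfl⟩ : ∃ m, n = m + 1 := ⟨n - 1, by omega⟩
  rw [beta_eq hr, div_le_one (runNorm_pos hr _)]
  cases m with
  | zero => exact le_rfl
  | succ m =>
    rw [runNorm]
    have := runNorm_pos hr m
    nlinarith

theorem fk_nonneg {r : ℝ} (hr : 0 ≤ r) {j : ℕ} (hj : 4 ≤ j) : 0 ≤ fk j r := by
  have h0 := beta_pos hr (n := j) (by omega)
  have h2 := beta_pos hr (n := j - 2) (by omega)
  have h3 := beta_pos hr (n := j - 3) (by omega)
  unfold fk
  positivity

theorem bddAbove_fk {r : ℝ} (hr : 0 ≤ r) : BddAbove ((fun j => fk j r) '' Set.Ici 4) := by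
  -- Every ratio β lies in (0, 1], which bounds the factors of `fk` one by one.
  refine ⟨r * ((1 + r) ^ 2 + r), ?_⟩
  rintro _ ⟨j, hj, rfl⟩
  rw [Set.mem_Ici] at hj
  have h0 := beta_pos hr (n := j) (by omega)
  have h1 := beta_pos hr (n := j - 1) (by omega)
  have h2 := beta_pos hr (n := j - 2) (by omega)
  have h3 := beta_pos hr (n := j - 3) (by omega)
  have l0 := beta_le_one hr (n := j) (by omega)
  have l1 := beta_le_one hr (n := j - 1) (by omega)
  have l2 := beta_le_one hr (n := j - 2) (by omega)
  have l3 := beta_le_one hr (n := j - 3) (by omega)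
  have e1 : r * beta r j * beta r (j - 2) ≤ r := by
    have : beta r j * beta r (j - 2) ≤ 1 := mul_le_one₀ l0 h2.le l2
    nlinarith
  have e2 : (1 - beta r (j - 1) * (1 + r)) ^ 2 / (1 + 2 * r) ≤ (1 + r) ^ 2 := by
    rw [div_le_iff₀ (by positivity)]
    have h : (1 - beta r (j - 1) * (1 + r)) ^ 2 ≤ (1 + r) ^ 2 := by
      have : beta r (j - 1) * (1 + r) ≤ 1 + r := by nlinarith
      have : 0 ≤ beta r (j - 1) * (1 + r) := by positivity
      exact sq_le_sq' (by linarith) (by linarith)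
    nlinarith [sq_nonneg (1 + r)]
  have e3 : beta r (j - 3) * (r * (1 - beta r (j - 1)) ^ 2 / (1 + r)) ≤ r := by
    have h : (1 - beta r (j - 1)) ^ 2 ≤ 1 := by nlinarith
    have h' : r * (1 - beta r (j - 1)) ^ 2 / (1 + r) ≤ r := by
      rw [div_le_iff₀ (by positivity)]
      nlinarith
    exact (mul_le_of_le_one_left (by positivity) l3).trans h'
  simp only [fk]
  refine mul_le_mul e1 (add_le_add e2 e3) (by positivity) hr

theorem fk_le_f {r : ℝ} (hr : 0 ≤ r) {j : ℕ} (hj : 4 ≤ j) : fk j r ≤ f r :=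
  le_csSup (bddAbove_fk hr) ⟨j, hj, rfl⟩

theorem f_nonneg {r : ℝ} (hr : 0 ≤ r) : 0 ≤ f r := (fk_nonneg hr le_rfl).trans (fk_le_f hr le_rfl)

/-- `f_j` in terms of the norms of the monomer states. -/
theorem fk_mul_runNorm {r : ℝ} (hr : 0 ≤ r) (i : ℕ) :
    fk (i + 4) r * (runNorm r (i + 2) * runNorm r (i + 4) / runNorm r (i + 3))
      = r * (1 - runNorm r (i + 2) / runNorm r (i + 3) * (1 + r)) ^ 2 * runNorm r (i + 1)
          / (1 + 2 * r)
        + r ^ 2 * (1 - runNorm r (i + 2) / runNorm r (i + 3)) ^ 2 * runNorm r i / (1 + r) := by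
  have p0 := runNorm_pos hr i
  have p1 := runNorm_pos hr (i + 1)
  have p2 := runNorm_pos hr (i + 2)
  have p3 := runNorm_pos hr (i + 3)
  have p4 := runNorm_pos hr (i + 4)
  simp only [fk, show i + 4 - 2 = i + 1 + 1 by omega, show i + 4 - 1 = i + 2 + 1 by omega,
    show i + 4 - 3 = i + 1 by omega, beta_eq hr]
  field_simp

end

end FQH

namespace FQH

noncomputable section

/-! ### Splitting tilings -/

theorem eq_nil_of_length_conf {C : List Tile} (h : (conf C).length = 0) : C = [] := by
  have := length_le_length_conf C
  exact List.length_eq_zero_iff.1 (by omega)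

theorem append_inj_of_length_conf {A B A' B' : List Tile} (h : A ++ B = A' ++ B')
    (hl : (conf A).length = (conf A').length) : A = A' ∧ B = B' := by
  rcases List.append_eq_append_iff.1 h with ⟨C, rfl, rfl⟩ | ⟨C, rfl, rfl⟩
  · rw [conf_append, List.length_append] at hl
    rw [eq_nil_of_length_conf (C := C) (by omega)]
    simp
  · rw [conf_append, List.length_append] at hl
    rw [eq_nil_of_length_conf (C := C) (by omega)]
    simp

/-- Two dimers of a tiling coincide or are at distance at least six. -/
theorem dimer_dist {X Y X' Y' : List Tile} (h : X ++ .D :: Y = X' ++ .D :: Y') :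
    (conf X).length = (conf X').length ∨ (conf X).length + 6 ≤ (conf X').length ∨
      (conf X').length + 6 ≤ (conf X).length := by
  rcases List.append_eq_append_iff.1 h with ⟨C, rfl, hC⟩ | ⟨C, rfl, hC⟩
  · cases C with
    | nil => simp
    | cons t C =>
      simp only [List.cons_append, List.cons.injEq] at hC
      refine Or.inr (Or.inl ?_)
      simp [conf_append, conf_cons, ← hC.1, Tile.word]
  · cases C with
    | nil => simp
    | cons t C =>
      simp only [List.cons_append, List.cons.injEq] at hC
      refine Or.inr (Or.inr ?_)
      simp [conf_append, conf_cons, ← hC.1, Tile.word]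

/-- A pair of monomers and a dimer of a tiling are at distance at least six. -/
theorem monomers_dimer_dist {X Y X' Y' : List Tile} (h : X ++ .M :: .M :: Y = X' ++ .D :: Y') :
    (conf X).length + 6 ≤ (conf X').length ∨ (conf X').length + 6 ≤ (conf X).length := by
  rcases List.append_eq_append_iff.1 h with ⟨C, rfl, hC⟩ | ⟨C, rfl, hC⟩
  · match C, hC with
    | [], hC => simp at hC
    | [t], hC => simp at hC
    | t :: s :: C, hC =>
      simp only [List.cons_append, List.cons.injEq] at hC
      refine Or.inl ?_
      simp [conf_append, conf_cons, ← hC.1, ← hC.2.1, Tile.word]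
  · cases C with
    | nil => simp at hC
    | cons t C =>
      simp only [List.cons_append, List.cons.injEq] at hC
      refine Or.inr ?_
      simp [conf_append, conf_cons, ← hC.1, Tile.word]

/-- `T` has a dimer after its first `y` sites. -/
def HasDimer (y : ℕ) (T : List Tile) : Prop :=
  ∃ p : List Tile × List Tile, T = p.1 ++ .D :: p.2 ∧ (conf p.1).length = y

theorem HasDimer.choose_eq {y : ℕ} {X Y : List Tile} (h : HasDimer y (X ++ .D :: Y))
    (hX : (conf X).length = y) : Exists.choose h = (X, Y) := by
  have hs := Exists.choose_spec h
  obtain ⟨e1, e2⟩ := append_inj_of_length_conf hs.1 (hX.trans hs.2.symm)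
  simp only [List.cons.injEq, true_and] at e2
  exact Prod.ext e1.symm e2.symm

open Classical in
/-- The violation of the kernel relation at the bond after the first `y` sites. -/
def residual (lam : ℂ) (F : List Tile → ℂ) (y : ℕ) (T : List Tile) : ℂ :=
  if h : HasDimer y T then F T - lam * F ((Exists.choose h).1 ++ .M :: .M :: (Exists.choose h).2) else 0

theorem residual_of_dimer (lam : ℂ) (F : List Tile → ℂ) (X Y : List Tile) :
    residual lam F (conf X).length (X ++ .D :: Y)
      = F (X ++ .D :: Y) - lam * F (X ++ .M :: .M :: Y) := by
  have h : HasDimer (conf X).length (X ++ .D :: Y) := ⟨(X, Y), rfl, rfl⟩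
  rw [residual, dif_pos h, h.choose_eq rfl]

theorem residual_of_not {lam : ℂ} {F : List Tile → ℂ} {y : ℕ} {T : List Tile}
    (h : ¬ HasDimer y T) : residual lam F y T = 0 := dif_neg h

theorem sum_residual_le {L : ℕ} (hL : 5 ≤ L) {y : ℕ} (h : y + 4 ≤ L) (lam : ℂ) {ψ : Hilb L} :
    ∑ T ∈ tilings L, ‖residual lam (fun T => ψ (cfg L T)) y T‖ ^ 2
      ≤ ‖q L lam (y + 1) ψ‖ ^ 2 := by
  classical
  -- `g` empties the dimer at the bond. It is injective on the tilings with that dimer, since the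
  -- emptied tilings are padded tilings too.
  let g : List Tile → Config L := fun T =>
    if h : HasDimer y T then cfg L ((Exists.choose h).1 ++ (sixVoids ++ (Exists.choose h).2))
    else fun _ => false
  have hg : ∀ X Y, (conf X).length = y → g (X ++ .D :: Y) = cfg L (X ++ (sixVoids ++ Y)) := by
    intro X Y hX
    have hh : HasDimer y (X ++ .D :: Y) := ⟨(X, Y), rfl, hX⟩
    simp only [g]
    rw [dif_pos hh, hh.choose_eq hX]
  rw [EuclideanSpace.norm_sq_eq]
  calc ∑ T ∈ tilings L, ‖residual lam (fun T => ψ (cfg L T)) y T‖ ^ 2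
      = ∑ T ∈ tilings L with HasDimer y T,
          ‖residual lam (fun T => ψ (cfg L T)) y T‖ ^ 2 := by
        refine (Finset.sum_filter_of_ne fun T _ hT => ?_).symm
        by_contra hn
        exact hT (by rw [residual_of_not hn]; simp)
    _ = ∑ T ∈ tilings L with HasDimer y T, ‖q L lam (y + 1) ψ (g T)‖ ^ 2 := by
        refine Finset.sum_congr rfl fun T hT => ?_
        obtain ⟨⟨X, Y⟩, rfl, hX⟩ := (Finset.mem_filter.1 hT).2
        simp only at hX ⊢
        rw [hg X Y hX, q_apply_sixVoids h lam ψ hX]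
        subst hX
        rw [residual_of_dimer]
    _ = ∑ ν ∈ ((tilings L).filter (HasDimer y)).image g, ‖q L lam (y + 1) ψ ν‖ ^ 2 := by
        rw [Finset.sum_image]
        intro T hT T' hT' e
        rw [Finset.mem_coe, Finset.mem_filter, mem_tilings] at hT hT'
        obtain ⟨hE, ⟨X, Y⟩, rfl, hX⟩ := hT
        obtain ⟨hE', ⟨X', Y'⟩, rfl, hX'⟩ := hT'
        simp only at hX hX' hE hE' e ⊢
        rw [hg X Y hX, hg X' Y' hX'] at e
        have e := cfg_inj hL (ext_sixVoids hE) (ext_sixVoids hE') e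
        obtain ⟨rfl, e'⟩ := append_inj_of_length_conf e (hX.trans hX'.symm)
        rw [List.append_cancel_left e']
    _ ≤ _ := Finset.sum_le_sum_of_subset_of_nonneg (Finset.subset_univ _)
        fun _ _ _ => by positivity

/-- On an interval of at most nine sites, the distance of a tiling state to the kernel is bounded
by its energy. -/
theorem exists_kernel_near {L a b : ℕ} (hL : 5 ≤ L) (ha : 1 ≤ a) (hab : b ≤ a + 8) (hb : b ≤ L)
    (lam : ℂ) {ψ : Hilb L} (hψ : ψ ∈ tilingSpace L) :
    ∃ χ ∈ tilingSpace L, (∀ x ∈ Finset.Icc a (b - 3), q L lam x χ = 0) ∧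
      ‖ψ - χ‖ ^ 2 ≤ ∑ x ∈ Finset.Icc a (b - 3), ‖q L lam x ψ‖ ^ 2 := by
  set F : List Tile → ℂ := fun T => ψ (cfg L T) with hF
  -- Amplitudes of tilings with a dimer at a bond of the window are set to the value the relation
  -- demands; all others are kept.
  set G : List Tile → ℂ := fun T => F T - ∑ x ∈ Finset.Icc a (b - 3), residual lam F (x - 1) T
    with hG
  -- The window has at most six bonds, and distinct dimers start at least six sites apart.
  have single : ∀ X Y, a - 1 ≤ (conf X).length → (conf X).length + 4 ≤ b →
      ∀ x ∈ Finset.Icc a (b - 3), x ≠ (conf X).length + 1 → ¬ HasDimer (x - 1) (X ++ .D :: Y) := by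
    rintro X Y h1 h2 x hx hne ⟨⟨X', Y'⟩, e, hX'⟩
    rw [Finset.mem_Icc] at hx
    have := dimer_dist e
    dsimp only at hX' this
    omega
  have hsum : ∀ X Y, a - 1 ≤ (conf X).length → (conf X).length + 4 ≤ b →
      ∑ x ∈ Finset.Icc a (b - 3), residual lam F (x - 1) (X ++ .D :: Y)
        = F (X ++ .D :: Y) - lam * F (X ++ .M :: .M :: Y) := by
    intro X Y h1 h2
    rw [Finset.sum_eq_single ((conf X).length + 1), Nat.add_sub_cancel, residual_of_dimer]
    · exact fun x hx hne => residual_of_not (single X Y h1 h2 x hx hne)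
    · exact fun h => absurd (by rw [Finset.mem_Icc]; omega) h
  refine ⟨tilingVec L G, tilingVec_mem hL G, ?_, ?_⟩
  · rw [forall_q_eq_zero_iff_rel lam hL ha hb (tilingVec_mem hL G)]
    intro X Y hT h1 h2
    simp only
    rw [tilingVec_apply hL G hT, tilingVec_apply hL G ((ext_MM_iff _ _ _).2 hT)]
    simp only [hG]
    -- A tiling with two monomers at a bond of the window has no dimer at any bond of it, so the
    -- right side of the relation is uncorrected.
    rw [hsum X Y h1 h2, Finset.sum_eq_zero, sub_sub_cancel, sub_zero]
    intro x hx
    refine residual_of_not ?_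
    rintro ⟨⟨X', Y'⟩, e, hX'⟩
    rw [Finset.mem_Icc] at hx
    have := monomers_dimer_dist e
    dsimp only at hX' this
    omega
  · rw [norm_sq_eq_sum hL (Submodule.sub_mem _ hψ (tilingVec_mem hL G))]
    calc ∑ T ∈ tilings L, ‖(ψ - tilingVec L G) (cfg L T)‖ ^ 2
        = ∑ T ∈ tilings L, ‖∑ x ∈ Finset.Icc a (b - 3), residual lam F (x - 1) T‖ ^ 2 := by
          refine Finset.sum_congr rfl fun T hT => ?_
          rw [PiLp.sub_apply, tilingVec_apply hL G (mem_tilings.1 hT)]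
          simp [hG, hF]
      _ ≤ ∑ T ∈ tilings L, ∑ x ∈ Finset.Icc a (b - 3), ‖residual lam F (x - 1) T‖ ^ 2 := by
          refine Finset.sum_le_sum fun T _ => ?_
          by_cases hT : ∃ x ∈ Finset.Icc a (b - 3), HasDimer (x - 1) T
          · obtain ⟨x, hx, ⟨X, Y⟩, rfl, hX⟩ := hT
            simp only at hX ⊢
            have hx' := Finset.mem_Icc.1 hx
            have e : ∑ x ∈ Finset.Icc a (b - 3), residual lam F (x - 1) (X ++ .D :: Y)
                = residual lam F (x - 1) (X ++ .D :: Y) := by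
              rw [hsum X Y (by omega) (by omega), ← hX, residual_of_dimer]
            rw [e]
            exact Finset.single_le_sum
              (f := fun x => ‖residual lam F (x - 1) (X ++ .D :: Y)‖ ^ 2)
              (fun _ _ => by positivity) hx
          · push Not at hT
            rw [Finset.sum_eq_zero fun x hx => residual_of_not (hT x hx), norm_zero,
              zero_pow two_ne_zero]
            exact Finset.sum_nonneg fun _ _ => by positivity
      _ = ∑ x ∈ Finset.Icc a (b - 3), ∑ T ∈ tilings L, ‖residual lam F (x - 1) T‖ ^ 2 :=
          Finset.sum_comm
      _ ≤ _ := by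
          refine Finset.sum_le_sum fun x hx => ?_
          rw [Finset.mem_Icc] at hx
          obtain ⟨y, rfl⟩ : ∃ y, x = y + 1 := ⟨x - 1, by omega⟩
          exact sum_residual_le hL (by omega) lam

end

end FQH

namespace FQH

noncomputable section

/-! ### The estimate on a single run -/

/-- Sorts a run by its last three monomer places: either no dimer straddles their left border,
leaving three fillings, or one does, leaving two. -/
theorem sum_runs_four {E : Type*} [AddCommMonoid E] (F : List Tile → E) (i : ℕ) :
    ∑ R ∈ runs (i + 4), F R
      = ∑ R ∈ runs (i + 1), (F (R ++ [.M, .M, .M]) + F (R ++ [.D, .M]) + F (R ++ [.M, .D]))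
        + ∑ R ∈ runs i, (F (R ++ [.D, .M, .M]) + F (R ++ [.D, .D])) := by
  have e1 : ∑ R ∈ runs (i + 4), F R
      = ∑ R ∈ runs (i + 3), F (R ++ [.M]) + ∑ R ∈ runs (i + 2), F (R ++ [.D]) := sum_runs F (i + 2)
  have e2 : ∑ R ∈ runs (i + 3), F (R ++ [.M])
      = ∑ R ∈ runs (i + 2), F (R ++ [.M] ++ [.M]) + ∑ R ∈ runs (i + 1), F (R ++ [.D] ++ [.M]) :=
    sum_runs (fun R => F (R ++ [.M])) (i + 1)
  rw [e1, e2, sum_runs (fun R => F (R ++ [Tile.D])),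
    sum_runs (fun R => F (R ++ [Tile.M] ++ [Tile.M]))]
  simp only [List.append_assoc, List.cons_append, List.nil_append, Finset.sum_add_distrib]
  ac_rfl

theorem append_mem_runs {i j k : ℕ} {R S : List Tile} (hR : R ∈ runs i) (hS : S ∈ runs j)
    (h : i + j = k) : R ++ S ∈ runs k := by
  rw [mem_runs] at *
  refine ⟨fun t ht => ?_, ?_⟩
  · rcases List.mem_append.1 ht with ht | ht
    · exact hR.1 t ht
    · exact hS.1 t ht
  · rw [conf_append, List.length_append, hR.2, hS.2, ← h]
    ring

theorem D_mem_runs : [Tile.D] ∈ runs 2 := by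
  rw [mem_runs]
  exact ⟨fun t ht => Or.inr (List.mem_singleton.1 ht), rfl⟩

theorem M_mem_runs : [Tile.M] ∈ runs 1 := by
  rw [mem_runs]
  exact ⟨fun t ht => Or.inl (List.mem_singleton.1 ht), rfl⟩

theorem MM_mem_runs : [Tile.M, Tile.M] ∈ runs 2 := append_mem_runs M_mem_runs M_mem_runs rfl

theorem DM_mem_runs : [Tile.D, Tile.M] ∈ runs 3 := append_mem_runs D_mem_runs M_mem_runs rfl

/-- Cauchy–Schwarz against the ground state of the run, whose squared norm is `runNorm`. -/
theorem norm_sum_star_mul_pow_sq_le (lam : ℂ) (w : List Tile → ℂ) (j : ℕ) :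
    ‖∑ R ∈ runs j, star (w R) * lam ^ dimerCount R‖ ^ 2
      ≤ runNorm (‖lam‖ ^ 2) j * ∑ R ∈ runs j, ‖w R‖ ^ 2 := by
  calc ‖∑ R ∈ runs j, star (w R) * lam ^ dimerCount R‖ ^ 2
      ≤ (∑ R ∈ runs j, ‖w R‖ * ‖lam‖ ^ dimerCount R) ^ 2 := by
        refine pow_le_pow_left₀ (norm_nonneg _) ((norm_sum_le _ _).trans_eq ?_) 2
        exact Finset.sum_congr rfl fun R _ => by simp
    _ ≤ (∑ R ∈ runs j, ‖w R‖ ^ 2) * ∑ R ∈ runs j, (‖lam‖ ^ dimerCount R) ^ 2 :=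
        Finset.sum_mul_sq_le_sq_mul_sq _ _ _
    _ = _ := by
        rw [mul_comm, ← sum_runs_pow]
        congr 1
        exact Finset.sum_congr rfl fun R _ => by rw [← pow_mul, ← pow_mul, mul_comm]

/-- Two-term Cauchy–Schwarz with weights `s`, `s'`; the mixed term is handled by the
arithmetic–geometric mean inequality. -/
theorem add_sq_le_of_sq_le {p x s A Y p' x' s' A' Y' : ℝ} (hs : 0 < s) (hs' : 0 < s') (hA : 0 ≤ A) (hA' : 0 ≤ A')
    (hY : 0 ≤ Y) (hY' : 0 ≤ Y') (h : x ^ 2 ≤ A * Y) (h' : x' ^ 2 ≤ A' * Y') :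
    (p * x + p' * x') ^ 2 ≤ (p ^ 2 * A / s + p' ^ 2 * A' / s') * (s * Y + s' * Y') := by
  have e : (p ^ 2 * A / s + p' ^ 2 * A' / s') * (s * Y + s' * Y')
      = p ^ 2 * (A * Y) + p' ^ 2 * (A' * Y') + (p ^ 2 * A * s' * Y' / s + p' ^ 2 * A' * s * Y / s') := by
    field_simp
    ring
  have m : 2 * (p * x * (p' * x')) ≤ p ^ 2 * A * s' * Y' / s + p' ^ 2 * A' * s * Y / s' := by
    refine le_of_sq_le_sq ?_ (by positivity)
    have h1 : (p * x * (p' * x')) ^ 2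
        ≤ (p ^ 2 * A * s' * Y' / s) * (p' ^ 2 * A' * s * Y / s') := by
      have : (p ^ 2 * A * s' * Y' / s) * (p' ^ 2 * A' * s * Y / s')
          = p ^ 2 * p' ^ 2 * ((A * Y) * (A' * Y')) := by
        field_simp
      rw [this]
      have h2 : x ^ 2 * x' ^ 2 ≤ (A * Y) * (A' * Y') := by gcongr
      calc (p * x * (p' * x')) ^ 2 = p ^ 2 * p' ^ 2 * (x ^ 2 * x' ^ 2) := by ring
        _ ≤ _ := by gcongr
    nlinarith [sq_nonneg (p ^ 2 * A * s' * Y' / s - p' ^ 2 * A' * s * Y / s')]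
  have m1 : p ^ 2 * x ^ 2 ≤ p ^ 2 * (A * Y) := by gcongr
  have m2 : p' ^ 2 * x' ^ 2 ≤ p' ^ 2 * (A' * Y') := by gcongr
  rw [e]
  nlinarith

/-- Here `u` is an excited amplitude obeying all relations except at the end of the run, so it is
known up to the numbers `a` and `c` for last tile `M` and `D`, and `hK` is orthogonality to the
ground state. The amplitude `w` obeys the relations on the last three places and is therefore
determined by its values on R M M M and R D M M. The weights 1 + 2r and 1 + r are the squared norms
of these two local ground states. -/
theorem run_estimate (lam : ℂ) (i : ℕ) (u w : List Tile → ℂ) (a c : ℂ)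
    (hM : ∀ R ∈ runs (i + 3), u (R ++ [.M]) = lam ^ dimerCount R * a)
    (hD : ∀ R ∈ runs (i + 2), u (R ++ [.D]) = lam ^ dimerCount R * c)
    (hK : (runNorm (‖lam‖ ^ 2) (i + 3) : ℂ) * a
      + star lam * (runNorm (‖lam‖ ^ 2) (i + 2) : ℂ) * c = 0)
    (hDM : ∀ R ∈ runs (i + 1), w (R ++ [.D, .M]) = lam * w (R ++ [.M, .M, .M]))
    (hMD : ∀ R ∈ runs (i + 1), w (R ++ [.M, .D]) = lam * w (R ++ [.M, .M, .M]))
    (hDD : ∀ R ∈ runs i, w (R ++ [.D, .D]) = lam * w (R ++ [.D, .M, .M])) :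
    ‖∑ R ∈ runs (i + 4), star (w R) * u R‖ ^ 2
      ≤ f (‖lam‖ ^ 2) * (∑ R ∈ runs (i + 4), ‖w R‖ ^ 2) * ∑ R ∈ runs (i + 4), ‖u R‖ ^ 2 := by
  set r : ℝ := ‖lam‖ ^ 2 with hr
  have hr0 : 0 ≤ r := by positivity
  have hll : star lam * lam = (r : ℂ) := by
    rw [hr]; push_cast; exact Complex.conj_mul' lam
  have p0 := runNorm_pos hr0 i
  have p1 := runNorm_pos hr0 (i + 1)
  have p2 := runNorm_pos hr0 (i + 2)
  have p3 := runNorm_pos hr0 (i + 3)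
  set Y := ∑ R ∈ runs (i + 1), ‖w (R ++ [.M, .M, .M])‖ ^ 2 with hY
  set Z := ∑ R ∈ runs i, ‖w (R ++ [.D, .M, .M])‖ ^ 2 with hZ
  set U := ∑ R ∈ runs (i + 1), star (w (R ++ [.M, .M, .M])) * lam ^ dimerCount R with hU
  set W := ∑ R ∈ runs i, star (w (R ++ [.D, .M, .M])) * lam ^ dimerCount R with hW
  set β := runNorm r (i + 2) / runNorm r (i + 3) with hβ
  -- Orthogonality leaves `c` as the only free amplitude; `β` is the ratio β_{i+3}.
  have ha : a = -(star lam * (β : ℂ) * c) := by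
    have : (runNorm r (i + 3) : ℂ) ≠ 0 := by exact_mod_cast p3.ne'
    rw [hβ]
    push_cast
    field_simp
    linear_combination hK
  -- The coefficients of `U` and `W` in the overlap; their squared moduli are the two squares in
  -- `fk`.
  have hα : a + r * a + star lam * c = ((1 - β * (1 + r) : ℝ) : ℂ) * (star lam * c) := by
    rw [ha]; push_cast; ring
  have hγ : lam * (a + star lam * c) = ((1 - β : ℝ) : ℂ) * (r * c) := by
    rw [ha, ← hll]; push_cast; ring
  have sum_w : ∑ R ∈ runs (i + 4), ‖w R‖ ^ 2 = (1 + 2 * r) * Y + (1 + r) * Z := by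
    rw [sum_runs_four, hY, hZ, Finset.mul_sum, Finset.mul_sum]
    congr 1 <;> refine Finset.sum_congr rfl fun R hR => ?_
    · rw [hDM R hR, hMD R hR, norm_mul, mul_pow, ← hr]; ring
    · rw [hDD R hR, norm_mul, mul_pow, ← hr]; ring
  have sum_u : ∑ R ∈ runs (i + 4), ‖u R‖ ^ 2
      = ‖c‖ ^ 2 * (runNorm r (i + 2) * runNorm r (i + 4) / runNorm r (i + 3)) := by
    rw [sum_runs, Finset.sum_congr rfl fun R hR => by rw [hM R hR],
      Finset.sum_congr (s₁ := runs (i + 2)) rfl fun R hR => by rw [hD R hR]]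
    simp only [norm_mul, norm_pow, mul_pow, ← Finset.sum_mul, pow_right_comm _ _ 2, ← hr]
    rw [sum_runs_pow, sum_runs_pow, show runNorm r (i + 4) = runNorm r (i + 3) + r * runNorm r (i + 2)
      from rfl, ha, norm_neg, norm_mul, norm_mul, norm_star, mul_pow, mul_pow, ← hr,
      Complex.norm_real, Real.norm_eq_abs, sq_abs, hβ]
    field_simp
    ring
  have sum_wu : ∑ R ∈ runs (i + 4), star (w R) * u R
      = (a + r * a + star lam * c) * U + lam * (a + star lam * c) * W := by
    rw [sum_runs_four, hU, hW, Finset.mul_sum, Finset.mul_sum]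
    congr 1 <;> refine Finset.sum_congr rfl fun R hR => ?_
    · have e1 : u (R ++ [.M, .M, .M]) = lam ^ dimerCount R * a := by
        have := hM (R ++ [.M, .M]) (append_mem_runs hR MM_mem_runs rfl)
        simpa [dimerCount, Tile.dimers] using this
      have e2 : u (R ++ [.D, .M]) = lam ^ dimerCount R * lam * a := by
        have := hM (R ++ [.D]) (append_mem_runs hR D_mem_runs rfl)
        simpa [dimerCount, Tile.dimers, pow_add] using this
      have e3 : u (R ++ [.M, .D]) = lam ^ dimerCount R * c := by
        have := hD (R ++ [.M]) (append_mem_runs hR M_mem_runs rfl)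
        simpa [dimerCount, Tile.dimers] using this
      rw [e1, e2, e3, hDM R hR, hMD R hR, ← hll, star_mul]
      ring
    · have e1 : u (R ++ [.D, .M, .M]) = lam ^ dimerCount R * lam * a := by
        have := hM (R ++ [.D, .M]) (append_mem_runs hR DM_mem_runs rfl)
        simpa [dimerCount, Tile.dimers, pow_add] using this
      have e2 : u (R ++ [.D, .D]) = lam ^ dimerCount R * lam * c := by
        have := hD (R ++ [.D]) (append_mem_runs hR D_mem_runs rfl)
        simpa [dimerCount, Tile.dimers, pow_add] using this
      rw [e1, e2, hDD R hR, star_mul]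
      ring
  have nα : ‖a + r * a + star lam * c‖ ^ 2 = r * (1 - β * (1 + r)) ^ 2 * ‖c‖ ^ 2 := by
    rw [hα, norm_mul, norm_mul, norm_star, Complex.norm_real, Real.norm_eq_abs, mul_pow, mul_pow,
      sq_abs, ← hr]
    ring
  have nγ : ‖lam * (a + star lam * c)‖ ^ 2 = r ^ 2 * (1 - β) ^ 2 * ‖c‖ ^ 2 := by
    rw [hγ, norm_mul, norm_mul, Complex.norm_real, Complex.norm_real, Real.norm_eq_abs,
      Real.norm_eq_abs, mul_pow, mul_pow, sq_abs, sq_abs]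
    ring
  have hUle := norm_sum_star_mul_pow_sq_le lam (fun R => w (R ++ [.M, .M, .M])) (i + 1)
  have hWle := norm_sum_star_mul_pow_sq_le lam (fun R => w (R ++ [.D, .M, .M])) i
  rw [sum_wu, sum_w]
  have hY0 : 0 ≤ Y := Finset.sum_nonneg fun _ _ => by positivity
  have hZ0 : 0 ≤ Z := Finset.sum_nonneg fun _ _ => by positivity
  calc ‖(a + r * a + star lam * c) * U + lam * (a + star lam * c) * W‖ ^ 2
      ≤ (‖a + r * a + star lam * c‖ * ‖U‖ + ‖lam * (a + star lam * c)‖ * ‖W‖) ^ 2 := by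
        refine pow_le_pow_left₀ (norm_nonneg _) ((norm_add_le _ _).trans_eq ?_) 2
        rw [norm_mul, norm_mul]
    _ ≤ (‖a + r * a + star lam * c‖ ^ 2 * runNorm r (i + 1) / (1 + 2 * r)
          + ‖lam * (a + star lam * c)‖ ^ 2 * runNorm r i / (1 + r))
            * ((1 + 2 * r) * Y + (1 + r) * Z) :=
        add_sq_le_of_sq_le
          (by positivity) (by positivity) p1.le p0.le hY0 hZ0 hUle hWle
    _ = fk (i + 4) r * ((1 + 2 * r) * Y + (1 + r) * Z) * ∑ R ∈ runs (i + 4), ‖u R‖ ^ 2 := by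
        have := fk_mul_runNorm hr0 i
        rw [← hβ] at this
        rw [nα, nγ, sum_u]
        linear_combination (-(‖c‖ ^ 2 * ((1 + 2 * r) * Y + (1 + r) * Z))) * this
    _ ≤ _ := by
        have h0 : 0 ≤ ∑ R ∈ runs (i + 4), ‖u R‖ ^ 2 := Finset.sum_nonneg fun _ _ => by positivity
        gcongr
        exact fk_le_f hr0 (by omega)

/-! ### Amplitudes on a run -/

theorem eq_replicate_of_dimerCount {R : List Tile} {i : ℕ} (hR : R ∈ runs i)
    (h : .D ∉ R) : R = List.replicate i .M := by
  rw [mem_runs] at hR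
  have hM : ∀ t ∈ R, t = .M := fun t ht =>
    (hR.1 t ht).resolve_right fun e => h (e ▸ ht)
  have e := List.eq_replicate_of_mem hM
  have := (mem_runs.1 (replicate_mem_runs R.length)).2
  rw [← e, hR.2] at this
  rw [e, show i = R.length by omega]

/-- The kernel relations on a run determine all amplitudes from that of the monomer tiling. -/
theorem run_amplitude (lam : ℂ) (g : List Tile → ℂ) (i : ℕ)
    (h : ∀ X Y, X ++ .D :: Y ∈ runs i → g (X ++ .D :: Y) = lam * g (X ++ .M :: .M :: Y))
    {R : List Tile} (hR : R ∈ runs i) :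
    g R = lam ^ dimerCount R * g (List.replicate i .M) := by
  -- Opening one dimer lowers the count by one and costs one factor `lam`.
  induction hd : dimerCount R generalizing R with
  | zero =>
    rw [eq_replicate_of_dimerCount hR, pow_zero, one_mul]
    intro hD
    obtain ⟨X, Y, rfl⟩ := List.append_of_mem hD
    simp [dimerCount, Tile.dimers] at hd
  | succ d ih =>
    have hD : .D ∈ R := by
      by_contra hD
      rw [eq_replicate_of_dimerCount hR hD] at hd
      simp [dimerCount, Tile.dimers] at hd
    obtain ⟨X, Y, rfl⟩ := List.append_of_mem hD
    have hR' : X ++ .M :: .M :: Y ∈ runs i := by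
      rw [mem_runs] at hR ⊢
      refine ⟨fun t ht => ?_, ?_⟩
      · simp only [List.mem_append, List.mem_cons] at ht
        rcases ht with ht | ht | ht | ht
        · exact hR.1 t (by simp [ht])
        · exact Or.inl ht
        · exact Or.inl ht
        · exact hR.1 t (by simp [ht])
      · rw [← hR.2]
        simp [conf_append, conf_cons, Tile.word]
    rw [h X Y hR, ih hR' (by simp [dimerCount, Tile.dimers] at hd ⊢; omega), pow_succ]
    ring

end

end FQH

namespace FQH

noncomputable section

/-! ### The last run of a tiling -/

/-- `A` is followed by a maximal run `R` with room for `j ≥ 2` monomers; the last bond of the run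
has its right end among the last three sites of `[1, b]`. -/
structure IsLastRun (b : ℕ) (A : List Tile) (j : ℕ) (R : List Tile) : Prop where
  run : R ∈ runs j
  two_le : 2 ≤ j
  maximal : ∀ C t, A = C ++ [t] → ¬ MD t
  le_end : b ≤ (conf A).length + 3 * j
  end_le : (conf A).length + 3 * j ≤ b + 2

theorem IsLastRun.ne_nil {b j : ℕ} {A R : List Tile} (h : IsLastRun b A j R) : R ≠ [] := by
  rintro rfl
  have := (mem_runs.1 h.run).2
  have := h.two_le
  simp [conf_nil] at *
  omega

theorem IsLastRun.length {b j : ℕ} {A R : List Tile} (h : IsLastRun b A j R) :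
    (conf R).length = 3 * j := (mem_runs.1 h.run).2

theorem IsLastRun.change {b j : ℕ} {A R R' : List Tile} (h : IsLastRun b A j R)
    (h' : R' ∈ runs j) : IsLastRun b A j R' :=
  ⟨h', h.two_le, h.maximal, h.le_end, h.end_le⟩

/-- The tiles of a run have at least three sites, while the end of a last run is confined to the
three positions b, b+1, b+2; so two such runs in one tiling end at the same place. -/
theorem isLastRun_unique_aux {b j j' : ℕ} {A R B A' R' B' : List Tile} (h : IsLastRun b A j R)
    (h' : IsLastRun b A' j' R') (e : A ++ (R ++ B) = A' ++ (R' ++ B')) :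
    A ++ R = A' ++ R' := by
  have key : ∀ {j j' : ℕ} {A R A' R' C : List Tile}, IsLastRun b A j R → IsLastRun b A' j' R' →
      A' ++ R' = A ++ R ++ C → C = [] := by
    intro j j' A R A' R' C h h' e
    rcases List.eq_nil_or_concat' C with rfl | ⟨C, t, rfl⟩
    · rfl
    · exfalso
      obtain ⟨S, s, hS⟩ : ∃ S s, R' = S ++ [s] := by
        rcases List.eq_nil_or_concat' R' with e' | ⟨S, s, e'⟩
        · exact absurd e' h'.ne_nil
        · exact ⟨S, s, e'⟩
      have hl := congrArg (fun T => (conf T).length) e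
      simp only [conf_append, List.length_append, h.length, h'.length] at hl
      rw [hS, ← List.append_assoc, ← List.append_assoc] at e
      have e2 := (List.append_inj' e rfl).2
      simp only [List.cons.injEq, and_true] at e2
      have hs : MD t := e2 ▸ (mem_runs.1 h'.run).1 s (by simp [hS])
      have : 3 ≤ (conf [t]).length := by
        rcases hs with rfl | rfl <;> simp [conf_cons, conf_nil, Tile.word]
      have := h.le_end
      have := h'.end_le
      omega
  rw [← List.append_assoc, ← List.append_assoc] at e
  rcases List.append_eq_append_iff.1 e with ⟨C, e, -⟩ | ⟨C, e, -⟩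
  · rw [e, key h h' e, List.append_nil]
  · rw [e, key h' h e, List.append_nil]

theorem maximal_unique {A R A' R' : List Tile} (hA : ∀ C t, A = C ++ [t] → ¬ MD t)
    (hA' : ∀ C t, A' = C ++ [t] → ¬ MD t) (hR : ∀ t ∈ R, MD t) (hR' : ∀ t ∈ R', MD t)
    (e : A ++ R = A' ++ R') : A = A' := by
  rcases List.append_eq_append_iff.1 e with ⟨C, e, e'⟩ | ⟨C, e, e'⟩
  · rcases List.eq_nil_or_concat' C with rfl | ⟨C, t, rfl⟩
    · simpa using e.symm
    · rw [← List.append_assoc] at e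
      exact absurd (hR t (by simp [e'])) (hA' _ t e)
  · rcases List.eq_nil_or_concat' C with rfl | ⟨C, t, rfl⟩
    · simpa using e
    · rw [← List.append_assoc] at e
      exact absurd (hR' t (by simp [e'])) (hA _ t e)

theorem IsLastRun.unique {b j j' : ℕ} {A R B A' R' B' : List Tile} (h : IsLastRun b A j R)
    (h' : IsLastRun b A' j' R') (e : A ++ (R ++ B) = A' ++ (R' ++ B')) :
    A = A' ∧ j = j' ∧ R = R' ∧ B = B' := by
  have e1 := isLastRun_unique_aux h h' e
  have hA := maximal_unique h.maximal h'.maximal (mem_runs.1 h.run).1 (mem_runs.1 h'.run).1 e1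
  subst hA
  have hR := List.append_cancel_left e1
  subst hR
  refine ⟨rfl, ?_, rfl, List.append_cancel_left (List.append_cancel_left e)⟩
  have := h.length
  have := h'.length
  omega

theorem exists_maximal (P : List Tile) :
    ∃ A R, P = A ++ R ∧ (∀ C t, A = C ++ [t] → ¬ MD t) ∧ ∀ t ∈ R, MD t := by
  induction P using List.reverseRecOn with
  | nil => exact ⟨[], [], rfl, by simp, by simp⟩
  | append_singleton P t ih =>
    by_cases ht : MD t
    · obtain ⟨A, R, rfl, hA, hR⟩ := ih
      refine ⟨A, R ++ [t], by simp, hA, fun s hs => ?_⟩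
      rcases List.mem_append.1 hs with hs | hs
      · exact hR s hs
      · exact List.mem_singleton.1 hs ▸ ht
    · refine ⟨P ++ [t], [], by simp, fun C s e => ?_, by simp⟩
      have := (List.append_inj' e rfl).2
      simp only [List.cons.injEq, and_true] at this
      exact this ▸ ht

theorem exists_length_conf {R : List Tile} (hR : ∀ t ∈ R, MD t) :
    ∃ j, (conf R).length = 3 * j := by
  induction R with
  | nil => exact ⟨0, rfl⟩
  | cons t R ih =>
    obtain ⟨j, hj⟩ := ih fun s hs => hR s (by simp [hs])
    rcases hR t (by simp) with rfl | rfl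
    · exact ⟨j + 1, by rw [conf_cons, List.length_append, hj]; simp [Tile.word]; ring⟩
    · exact ⟨j + 2, by rw [conf_cons, List.length_append, hj]; simp [Tile.word]; ring⟩

/-- A dimer whose bond lies in [1, b] but not in [1, b-3] ends at b, b+1 or b+2; extending it
maximally to the left gives the last run. -/
theorem exists_isLastRun {b : ℕ} {X : List Tile} (h1 : b ≤ (conf X).length + 6)
    (h2 : (conf X).length + 6 ≤ b + 2) : ∃ A j R, IsLastRun b A j R ∧ X ++ [.D] = A ++ R := by
  obtain ⟨A, R, e, hA, hR⟩ := exists_maximal X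
  obtain ⟨j, hj⟩ := exists_length_conf hR
  have hl := congrArg (fun T => (conf T).length) e
  simp only [conf_append, List.length_append, hj] at hl
  refine ⟨A, j + 2, R ++ [.D], ⟨append_mem_runs (mem_runs.2 ⟨hR, hj⟩) D_mem_runs rfl, by omega, hA,
    by omega, by omega⟩, by rw [e, List.append_assoc]⟩

/-- `T` has a last run. -/
def Active (b : ℕ) (T : List Tile) : Prop :=
  ∃ c : List Tile × ℕ × List Tile × List Tile,
    IsLastRun b c.1 c.2.1 c.2.2.1 ∧ T = c.1 ++ (c.2.2.1 ++ c.2.2.2)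

theorem IsLastRun.active {b j : ℕ} {A R : List Tile} (h : IsLastRun b A j R) (B : List Tile) :
    Active b (A ++ (R ++ B)) := ⟨(A, j, R, B), h, rfl⟩

theorem IsLastRun.choose_eq {b j : ℕ} {A R B : List Tile} (h : IsLastRun b A j R)
    (ha : Active b (A ++ (R ++ B))) : Exists.choose ha = (A, j, R, B) := by
  have hs := Exists.choose_spec ha
  obtain ⟨e1, e2, e3, e4⟩ := h.unique hs.1 hs.2
  exact Prod.ext e1.symm (Prod.ext e2.symm (Prod.ext e3.symm e4.symm))

open Classical in
/-- The tiles outside the last run, and the size of the run. -/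
def runClass (b : ℕ) (T : List Tile) : List Tile × ℕ × List Tile :=
  if h : Active b T then
    ((Exists.choose h).1, (Exists.choose h).2.1, (Exists.choose h).2.2.2) else ([], 0, [])

theorem IsLastRun.runClass_eq {b j : ℕ} {A R : List Tile} (h : IsLastRun b A j R)
    (B : List Tile) : runClass b (A ++ (R ++ B)) = (A, j, B) := by
  rw [runClass, dif_pos (h.active B), h.choose_eq]

open Classical in
/-- The classes of tilings that differ in the last run only. -/
def classes (L b : ℕ) : Finset (List Tile × ℕ × List Tile) :=
  ((tilings L).filter (Active b)).image (runClass b)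

theorem mem_classes {L b : ℕ} {A B : List Tile} {j : ℕ} (h : (A, j, B) ∈ classes L b)
    {R : List Tile} (hR : R ∈ runs j) : IsLastRun b A j R ∧ Ext L (A ++ (R ++ B)) := by
  classical
  obtain ⟨T, hT, e⟩ := Finset.mem_image.1 h
  rw [Finset.mem_filter, mem_tilings] at hT
  obtain ⟨hE, ⟨A', j', R', B'⟩, hl, rfl⟩ := hT
  dsimp only at hl hE e
  rw [hl.runClass_eq] at e
  simp only [Prod.mk.injEq] at e
  obtain ⟨rfl, rfl, rfl⟩ := e
  have hl' := hl.change hR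
  refine ⟨hl', ext_replace (fun t ht => ((mem_runs.1 hl.run).1 t ht).bulk)
    (fun t ht => ((mem_runs.1 hR).1 t ht).bulk) hl.ne_nil hl'.ne_nil ?_ hE⟩
  rw [hl.length, hl'.length]

open Classical in
-- Each class is a full copy of `runs j`: any refilling of the last run is again a padded tiling
-- with the same surroundings.
theorem sum_active {E : Type*} [AddCommMonoid E] (L b : ℕ) (G : List Tile → E) :
    ∑ T ∈ tilings L with Active b T, G T
      = ∑ c ∈ classes L b, ∑ R ∈ runs c.2.1, G (c.1 ++ (R ++ c.2.2)) := by
  rw [← Finset.sum_fiberwise_of_maps_to (g := runClass b) (t := classes L b)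
    fun T hT => Finset.mem_image_of_mem _ hT]
  refine Finset.sum_congr rfl fun c hc => ?_
  obtain ⟨A, j, B⟩ := c
  dsimp only
  rw [← Finset.sum_image (f := G) (g := fun R => A ++ (R ++ B))
    fun R _ R' _ e => List.append_cancel_right (List.append_cancel_left e)]
  refine Finset.sum_congr ?_ fun _ _ => rfl
  ext T
  rw [Finset.mem_filter, Finset.mem_filter, mem_tilings, Finset.mem_image]
  constructor
  · rintro ⟨⟨-, ⟨A', j', R', B'⟩, hl, rfl⟩, e⟩
    dsimp only at hl e ⊢
    rw [hl.runClass_eq] at e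
    simp only [Prod.mk.injEq] at e
    obtain ⟨rfl, rfl, rfl⟩ := e
    exact ⟨R', hl.run, rfl⟩
  · rintro ⟨R, hR, rfl⟩
    obtain ⟨hl, hE⟩ := mem_classes hc hR
    exact ⟨⟨hE, hl.active B⟩, hl.runClass_eq B⟩

/-! ### The component along the ground state of the last run -/

section core

variable {L b : ℕ} (lam : ℂ) (F : List Tile → ℂ)

/-- The overlap of an amplitude with the ground state of a run. -/
def overlap (A : List Tile) (j : ℕ) (B : List Tile) : ℂ :=
  ∑ R ∈ runs j, star (lam ^ dimerCount R) * F (A ++ (R ++ B))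

open Classical in
/-- The projection of an amplitude to the ground state of the last run, where there is one. -/
def projLastRun (b : ℕ) (T : List Tile) : ℂ :=
  if h : Active b T then
    lam ^ dimerCount (Exists.choose h).2.2.1
      * overlap lam F (Exists.choose h).1 (Exists.choose h).2.1 (Exists.choose h).2.2.2
  else F T

theorem IsLastRun.projLastRun_eq {j : ℕ} {A R : List Tile} (h : IsLastRun b A j R)
    (B : List Tile) :
    projLastRun lam F b (A ++ (R ++ B)) = lam ^ dimerCount R * overlap lam F A j B := by
  rw [projLastRun, dif_pos (h.active B), h.choose_eq]

variable {lam F}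

theorem projLastRun_of_not {T : List Tile} (h : ¬ Active b T) : projLastRun lam F b T = F T :=
  dif_neg h

/-- Position of a block inside the left part, the run, or the right part. -/
theorem append_three_cases {X Y A R B : List Tile} {t : Tile}
    (e : X ++ t :: Y = A ++ (R ++ B)) :
    (∃ C, A = X ++ t :: C ∧ Y = C ++ (R ++ B)) ∨
    (∃ R₁ R₂, R = R₁ ++ t :: R₂ ∧ X = A ++ R₁ ∧ Y = R₂ ++ B) ∨
    (∃ C, X = A ++ (R ++ C) ∧ B = C ++ t :: Y) := by
  rcases List.append_eq_append_iff.1 e with ⟨C, e1, e2⟩ | ⟨C, e1, e2⟩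
  · cases C with
    | nil =>
      rw [List.append_nil] at e1
      rw [List.nil_append] at e2
      subst e1
      cases R with
      | nil => exact Or.inr (Or.inr ⟨[], by simp, by simpa using e2.symm⟩)
      | cons s R =>
        simp only [List.cons_append, List.cons.injEq] at e2
        obtain ⟨rfl, rfl⟩ := e2
        exact Or.inr (Or.inl ⟨[], R, rfl, by simp, rfl⟩)
    | cons s C =>
      simp only [List.cons_append, List.cons.injEq] at e2
      obtain ⟨rfl, rfl⟩ := e2
      exact Or.inl ⟨C, e1, rfl⟩
  · rcases List.append_eq_append_iff.1 e2 with ⟨D, e3, e4⟩ | ⟨D, e3, e4⟩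
    · exact Or.inr (Or.inr ⟨D, by rw [e1, e3], e4⟩)
    · cases D with
      | nil =>
        rw [List.append_nil] at e3
        exact Or.inr (Or.inr ⟨[], by rw [e1, e3]; simp, by simpa using e4.symm⟩)
      | cons s D =>
        simp only [List.cons_append, List.cons.injEq] at e4
        obtain ⟨rfl, rfl⟩ := e4
        exact Or.inr (Or.inl ⟨C, D, e3, e1, rfl⟩)

theorem replace_mem_runs {j : ℕ} {R₁ R₂ : List Tile} :
    R₁ ++ .D :: R₂ ∈ runs j ↔ R₁ ++ .M :: .M :: R₂ ∈ runs j :=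
  (mem_runs_iff_of_connected (by
    have := Replace.bulk R₁ R₂
    simp only [List.append_assoc, List.cons_append, List.nil_append] at this
    exact .rel _ _ this) j).symm

theorem maximal_tail {A C : List Tile} (hA : ∀ D t, A ++ C = D ++ [t] → ¬ MD t) (hC : C ≠ [])
    (A' : List Tile) : ∀ D t, A' ++ C = D ++ [t] → ¬ MD t := by
  intro D t e
  rcases List.eq_nil_or_concat' C with rfl | ⟨C, s, rfl⟩
  · exact absurd rfl hC
  · rw [← List.append_assoc] at e
    have := (List.append_inj' e rfl).2
    simp only [List.cons.injEq, and_true] at this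
    exact this ▸ hA (A ++ C) s (by simp)

/-- A dimer to the left of or inside the last run may be opened without changing the rest. -/
theorem rel_projLastRun (hb : 3 ≤ b) (hF : Rel L lam F 0 (b - 3)) :
    Rel L lam (projLastRun lam F b) 0 b := by
  intro X Y hE _ hX
  by_cases h2 : Active b (X ++ .D :: Y)
  · obtain ⟨⟨A, j, R, B⟩, hl, e⟩ := h2
    dsimp only at hl e
    have hle := hl.le_end
    have hel := hl.end_le
    have htwo := hl.two_le
    -- Left of the run, the relations of [1, b-3] apply to each term of the overlap. Inside the run,
    -- a dimer accounts for one factor `lam`. To the right of it, no bond of [1, b] remains.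
    rcases append_three_cases e with ⟨C, rfl, rfl⟩ | ⟨R₁, R₂, rfl, rfl, rfl⟩ | ⟨C, rfl, rfl⟩
    · have hC : C ≠ [] := by
        rintro rfl
        exact hl.maximal X .D rfl (Or.inr rfl)
      have hlen : (conf (X ++ .M :: .M :: C)).length = (conf (X ++ .D :: C)).length := by
        simp [conf_append, conf_cons, Tile.word]
      have hl' : IsLastRun b (X ++ .M :: .M :: C) j R := by
        refine ⟨hl.run, hl.two_le, ?_, by rw [hlen]; exact hl.le_end,
          by rw [hlen]; exact hl.end_le⟩
        have := maximal_tail (A := X ++ [.D]) (C := C) (by simpa using hl.maximal) hC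
          (X ++ [.M, .M])
        simpa using this
      have e1 := hl.projLastRun_eq lam F B
      have e2 := hl'.projLastRun_eq lam F B
      rw [e, e1, show X ++ .M :: .M :: (C ++ (R ++ B)) = X ++ .M :: .M :: C ++ (R ++ B) by simp, e2]
      have : overlap lam F (X ++ .D :: C) j B = lam * overlap lam F (X ++ .M :: .M :: C) j B := by
        rw [overlap, overlap, Finset.mul_sum]
        refine Finset.sum_congr rfl fun S hS => ?_
        have hE' : Ext L (X ++ .D :: (C ++ (S ++ B))) := by
          have := ext_replace (X := X ++ .D :: C) (Y := B)
            (fun t ht => ((mem_runs.1 hl.run).1 t ht).bulk)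
            (fun t ht => ((mem_runs.1 hS).1 t ht).bulk) hl.ne_nil (hl.change hS).ne_nil
            (by rw [hl.length, (hl.change hS).length]) (by simpa using hE)
          simpa using this
        have hlenD : (conf (X ++ .D :: C)).length = (conf X).length + 6 + (conf C).length := by
          simp [conf_append, conf_cons, Tile.word]; ring
        have := hF X (C ++ (S ++ B)) hE' (by omega) (by omega)
        simp only [List.append_assoc, List.cons_append]
        rw [this]
        ring
      rw [this]
      ring
    · have hR' : R₁ ++ .M :: .M :: R₂ ∈ runs j := replace_mem_runs.1 hl.run
      have e1 := hl.projLastRun_eq lam F B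
      have e2 := (hl.change hR').projLastRun_eq lam F B
      rw [e, e1, show A ++ R₁ ++ .M :: .M :: (R₂ ++ B) = A ++ (R₁ ++ .M :: .M :: R₂ ++ B) by simp,
        e2]
      have : dimerCount (R₁ ++ .D :: R₂) = dimerCount (R₁ ++ .M :: .M :: R₂) + 1 := by
        simp [dimerCount, Tile.dimers]; ring
      rw [this, pow_succ]
      ring
    · exfalso
      simp only [conf_append, List.length_append, hl.length] at hX
      omega
  · have h1 : ¬ Active b (X ++ .M :: .M :: Y) := by
      rintro ⟨⟨A, j, R, B⟩, hl, e⟩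
      dsimp only at hl e
      have hle := hl.le_end
      have hel := hl.end_le
      rcases append_three_cases e with ⟨C, rfl, e'⟩ | ⟨R₁, R₂, rfl, rfl, e'⟩ | ⟨C, rfl, rfl⟩
      · cases C with
        | nil => exact hl.maximal X .M rfl (Or.inl rfl)
        | cons s C =>
          simp only [List.cons_append, List.cons.injEq] at e'
          obtain ⟨rfl, rfl⟩ := e'
          have hC : C ≠ [] := by
            rintro rfl
            exact hl.maximal (X ++ [.M]) .M (by simp) (Or.inl rfl)
          have hlen : (conf (X ++ .M :: .M :: C)).length = (conf (X ++ .D :: C)).length := by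
            simp [conf_append, conf_cons, Tile.word]
          have hl' : IsLastRun b (X ++ .D :: C) j R := by
            refine ⟨hl.run, hl.two_le, ?_, by rw [← hlen]; exact hl.le_end,
              by rw [← hlen]; exact hl.end_le⟩
            have := maximal_tail (A := X ++ [.M, .M]) (C := C) (by simpa using hl.maximal) hC
              (X ++ [.D])
            simpa using this
          exact h2 (by simpa using hl'.active B)
      · cases R₂ with
        | nil =>
          have := hl.length
          simp only [conf_append, conf_cons, conf_nil, Tile.word, List.length_append,
            List.length_cons, List.length_nil] at hX this
          omega
        | cons s R₂ =>
          simp only [List.cons_append, List.cons.injEq] at e'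
          obtain ⟨rfl, rfl⟩ := e'
          exact h2 (by simpa using (hl.change (replace_mem_runs.2 hl.run)).active B)
      · simp only [conf_append, List.length_append, hl.length] at hX
        omega
    rw [projLastRun_of_not h2, projLastRun_of_not h1]
    -- A dimer at one of the remaining bonds would be the end of a last run.
    by_cases hX' : (conf X).length + 4 ≤ b - 3
    · exact hF X Y hE (by omega) hX'
    · exfalso
      obtain ⟨A, j, R, hl, e⟩ := exists_isLastRun (b := b) (X := X) (by omega) (by omega)
      refine h2 ?_
      have := hl.active Y
      rwa [← List.append_assoc, ← e, List.append_assoc] at this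

open Classical in
-- Test against the projection `projLastRun` of `F` itself, which solves all relations up to `b`. It
-- is left unnormalised, so the pairing is exactly the sum of |overlap|² over the classes plus the
-- sum of |F|² over tilings without a last run; being zero, it kills every term.
theorem vanish_of_orthogonal (hb : 3 ≤ b) (hF : Rel L lam F 0 (b - 3))
    (ho : ∀ G, Rel L lam G 0 b → ∑ T ∈ tilings L, star (G T) * F T = 0) :
    (∀ T ∈ tilings L, ¬ Active b T → F T = 0) ∧
      ∀ c ∈ classes L b, overlap lam F c.1 c.2.1 c.2.2 = 0 := by
  have h := ho _ (rel_projLastRun hb hF)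
  rw [← Finset.sum_filter_add_sum_filter_not _ (Active b), sum_active] at h
  have e1 : ∀ c ∈ classes L b, ∑ R ∈ runs c.2.1,
      star (projLastRun lam F b (c.1 ++ (R ++ c.2.2))) * F (c.1 ++ (R ++ c.2.2))
        = ((‖overlap lam F c.1 c.2.1 c.2.2‖ ^ 2 : ℝ) : ℂ) := by
    rintro ⟨A, j, B⟩ hc
    dsimp only
    push_cast
    rw [← Complex.conj_mul', starRingEnd_apply]
    change _ = star (overlap lam F A j B)
      * ∑ R ∈ runs j, star (lam ^ dimerCount R) * F (A ++ (R ++ B))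
    rw [Finset.mul_sum]
    refine Finset.sum_congr rfl fun R hR => ?_
    rw [(mem_classes hc hR).1.projLastRun_eq, star_mul]
    ring
  have e2 : ∀ T ∈ (tilings L).filter (fun T => ¬ Active b T), star (projLastRun lam F b T) * F T
      = ((‖F T‖ ^ 2 : ℝ) : ℂ) := by
    intro T hT
    rw [projLastRun_of_not (Finset.mem_filter.1 hT).2]
    push_cast
    exact Complex.conj_mul' _
  rw [Finset.sum_congr rfl e1, Finset.sum_congr rfl e2] at h
  norm_cast at h
  have n1 : 0 ≤ ∑ c ∈ classes L b, ‖overlap lam F c.1 c.2.1 c.2.2‖ ^ 2 :=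
    Finset.sum_nonneg fun _ _ => by positivity
  have n2 : 0 ≤ ∑ T ∈ tilings L with ¬ Active b T, ‖F T‖ ^ 2 :=
    Finset.sum_nonneg fun _ _ => by positivity
  constructor
  · intro T hT hA
    have := (Finset.sum_eq_zero_iff_of_nonneg (fun _ _ => by positivity)).1
      (le_antisymm (by linarith) n2) T (Finset.mem_filter.2 ⟨hT, hA⟩)
    simpa using this
  · intro c hc
    have := (Finset.sum_eq_zero_iff_of_nonneg (fun _ _ => by positivity)).1
      (le_antisymm (by linarith) n1) c hc
    simpa using this

/-! ### Overlap with ground states of the last nine sites -/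

variable {G : List Tile → ℂ}

/-- For j ≤ 3 the relations of `G` cover the whole run, so `G` is a multiple of the ground state
there and the pairing vanishes. For j ≥ 4 they cover the last three monomer places, and the
relations of `F` cover all but the last tile, as `run_estimate` requires. -/
theorem class_estimate (hb : 9 ≤ b) (hF : Rel L lam F 0 (b - 3)) (hG : Rel L lam G (b - 9) b)
    {A B : List Tile} {j : ℕ} (hc : (A, j, B) ∈ classes L b) (hK : overlap lam F A j B = 0) :
    ‖∑ R ∈ runs j, star (G (A ++ (R ++ B))) * F (A ++ (R ++ B))‖ ^ 2
      ≤ f (‖lam‖ ^ 2) * (∑ R ∈ runs j, ‖G (A ++ (R ++ B))‖ ^ 2)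
        * ∑ R ∈ runs j, ‖F (A ++ (R ++ B))‖ ^ 2 := by
  have hf := f_nonneg (r := ‖lam‖ ^ 2) (by positivity)
  have hl0 := (mem_classes hc (replicate_mem_runs j)).1
  have hle := hl0.le_end
  have hel := hl0.end_le
  have htwo := hl0.two_le
  have relG : ∀ X Y, X ++ .D :: Y ∈ runs j → b ≤ (conf A).length + (conf X).length + 9 →
      G (A ++ (X ++ .D :: Y ++ B)) = lam * G (A ++ (X ++ .M :: .M :: Y ++ B)) := by
    intro X Y hR hX
    have hE := (mem_classes hc hR).2
    have hlen := (mem_runs.1 hR).2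
    simp only [conf_append, conf_cons, Tile.word, List.length_append, List.length_cons,
      List.length_nil] at hlen
    have := hG (A ++ X) (Y ++ B) (by simpa using hE)
      (by rw [conf_append, List.length_append]; omega)
      (by rw [conf_append, List.length_append]; omega)
    simpa using this
  by_cases hj : j ≤ 3
  · have hamp : ∀ R ∈ runs j, G (A ++ (R ++ B))
        = lam ^ dimerCount R * G (A ++ (List.replicate j .M ++ B)) := fun R hR =>
      run_amplitude lam (fun R => G (A ++ (R ++ B))) j
        (fun X Y hXY => relG X Y hXY (by omega)) hR
    have h0 : ∑ R ∈ runs j, star (G (A ++ (R ++ B))) * F (A ++ (R ++ B)) = 0 := by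
      have : ∑ R ∈ runs j, star (G (A ++ (R ++ B))) * F (A ++ (R ++ B))
          = star (G (A ++ (List.replicate j .M ++ B))) * overlap lam F A j B := by
        rw [overlap, Finset.mul_sum]
        refine Finset.sum_congr rfl fun R hR => ?_
        rw [hamp R hR, star_mul]
        ring
      rw [this, hK, mul_zero]
    rw [h0, norm_zero, zero_pow two_ne_zero]
    have h1 : 0 ≤ ∑ R ∈ runs j, ‖G (A ++ (R ++ B))‖ ^ 2 :=
      Finset.sum_nonneg fun _ _ => by positivity
    have h2 : 0 ≤ ∑ R ∈ runs j, ‖F (A ++ (R ++ B))‖ ^ 2 :=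
      Finset.sum_nonneg fun _ _ => by positivity
    positivity
  · obtain ⟨i, rfl⟩ : ∃ i, j = i + 4 := ⟨j - 4, by omega⟩
    -- Once the last tile is fixed, the bonds of the rest of the run end at b - 3 or earlier,
    -- because the run ends at b + 2 or earlier.
    have relF : ∀ (i' : ℕ) (t : Tile), [t] ∈ runs i' → ∀ k, k + i' = i + 4 → 1 ≤ i' → ∀ R ∈ runs k,
        F (A ++ (R ++ [t] ++ B))
          = lam ^ dimerCount R * F (A ++ (List.replicate k .M ++ [t] ++ B)) := by
      intro i' t ht k hk hi' R hR
      refine run_amplitude lam (fun R => F (A ++ (R ++ [t] ++ B))) k (fun X Y hXY => ?_) hR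
      have hE := (mem_classes hc (append_mem_runs hXY ht hk)).2
      have hlen := (mem_runs.1 hXY).2
      simp only [conf_append, conf_cons, Tile.word, List.length_append, List.length_cons,
        List.length_nil] at hlen
      have := hF (A ++ X) (Y ++ [t] ++ B) (by simpa using hE) (by omega)
        (by rw [conf_append, List.length_append]; omega)
      simpa using this
    have hM := relF 1 .M M_mem_runs (i + 3) rfl le_rfl
    have hD := relF 2 .D D_mem_runs (i + 2) rfl (by omega)
    refine run_estimate lam i (fun R => F (A ++ (R ++ B))) (fun R => G (A ++ (R ++ B))) _ _
      hM hD ?_ ?_ ?_ ?_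
    · have e : overlap lam F A (i + 4) B
          = ∑ R ∈ runs (i + 3), star (lam ^ dimerCount (R ++ [.M])) * F (A ++ (R ++ [.M] ++ B))
            + ∑ R ∈ runs (i + 2), star (lam ^ dimerCount (R ++ [.D])) * F (A ++ (R ++ [.D] ++ B)) :=
        sum_runs _ (i + 2)
      rw [e, Finset.sum_congr rfl fun R hR => by rw [hM R hR],
        Finset.sum_congr (s₁ := runs (i + 2)) rfl fun R hR => by rw [hD R hR]] at hK
      rw [← hK, ← sum_runs_pow, ← sum_runs_pow]
      push_cast
      rw [Finset.sum_mul, Finset.mul_sum, Finset.sum_mul]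
      congr 1 <;> refine Finset.sum_congr rfl fun R _ => ?_
      · rw [← Complex.conj_mul', mul_pow, starRingEnd_apply]
        simp [dimerCount, Tile.dimers]
        ring
      · rw [← Complex.conj_mul', mul_pow, starRingEnd_apply]
        simp [dimerCount, Tile.dimers, pow_add]
        ring
    · intro R hR
      have := relG R [.M] (append_mem_runs hR DM_mem_runs rfl)
        (by rw [(mem_runs.1 hR).2]; omega)
      simpa using this
    · intro R hR
      have := relG (R ++ [.M]) [] (by
        have := append_mem_runs (append_mem_runs hR M_mem_runs rfl) D_mem_runs
          (show i + 1 + 1 + 2 = i + 4 from rfl)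
        simpa using this)
        (by rw [(mem_runs.1 (append_mem_runs hR M_mem_runs rfl)).2]; omega)
      simpa using this
    · intro R hR
      have := relG (R ++ [.D]) [] (by
        have := append_mem_runs (append_mem_runs hR D_mem_runs rfl) D_mem_runs
          (show i + 2 + 2 = i + 4 from rfl)
        simpa using this)
        (by rw [(mem_runs.1 (append_mem_runs hR D_mem_runs rfl)).2]; omega)
      simpa using this

open Classical in
/-- The overlap of an excited state of the first `b` sites, all of whose excitations are at the
last bonds, with a ground state of the last nine sites. -/
theorem overlap_estimate (hb : 9 ≤ b) (hF : Rel L lam F 0 (b - 3)) (hG : Rel L lam G (b - 9) b)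
    (ho : ∀ G, Rel L lam G 0 b → ∑ T ∈ tilings L, star (G T) * F T = 0) :
    ‖∑ T ∈ tilings L, star (G T) * F T‖ ^ 2
      ≤ f (‖lam‖ ^ 2) * (∑ T ∈ tilings L, ‖G T‖ ^ 2) * ∑ T ∈ tilings L, ‖F T‖ ^ 2 := by
  have hf := f_nonneg (r := ‖lam‖ ^ 2) (by positivity)
  obtain ⟨hv, hK⟩ := vanish_of_orthogonal (by omega) hF ho
  have e : ∑ T ∈ tilings L, star (G T) * F T = ∑ c ∈ classes L b, ∑ R ∈ runs c.2.1,
      star (G (c.1 ++ (R ++ c.2.2))) * F (c.1 ++ (R ++ c.2.2)) := by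
    rw [← Finset.sum_filter_add_sum_filter_not _ (Active b), sum_active,
      Finset.sum_eq_zero (s := (tilings L).filter fun T => ¬ Active b T), add_zero]
    intro T hT
    rw [hv T (Finset.mem_filter.1 hT).1 (Finset.mem_filter.1 hT).2, mul_zero]
  have le : ∀ H : List Tile → ℂ, ∑ c ∈ classes L b, ∑ R ∈ runs c.2.1, ‖H (c.1 ++ (R ++ c.2.2))‖ ^ 2
      ≤ ∑ T ∈ tilings L, ‖H T‖ ^ 2 := by
    intro H
    rw [← sum_active L b fun T => ‖H T‖ ^ 2]
    exact Finset.sum_le_sum_of_subset_of_nonneg (Finset.filter_subset _ _)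
      fun _ _ _ => by positivity
  set y : List Tile × ℕ × List Tile → ℝ := fun c => ∑ R ∈ runs c.2.1, ‖G (c.1 ++ (R ++ c.2.2))‖ ^ 2
  set z : List Tile × ℕ × List Tile → ℝ := fun c => ∑ R ∈ runs c.2.1, ‖F (c.1 ++ (R ++ c.2.2))‖ ^ 2
  have hy : ∀ c, 0 ≤ y c := fun c => Finset.sum_nonneg fun _ _ => by positivity
  have hz : ∀ c, 0 ≤ z c := fun c => Finset.sum_nonneg fun _ _ => by positivity
  rw [e]
  calc ‖∑ c ∈ classes L b, ∑ R ∈ runs c.2.1,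
        star (G (c.1 ++ (R ++ c.2.2))) * F (c.1 ++ (R ++ c.2.2))‖ ^ 2
      ≤ (∑ c ∈ classes L b, √(f (‖lam‖ ^ 2) * y c) * √(z c)) ^ 2 := by
        refine pow_le_pow_left₀ (norm_nonneg _) ((norm_sum_le _ _).trans ?_) 2
        refine Finset.sum_le_sum fun c hc => ?_
        rw [← Real.sqrt_mul (mul_nonneg hf (hy c))]
        exact Real.le_sqrt_of_sq_le (class_estimate hb hF hG hc (hK c hc))
    _ ≤ (∑ c ∈ classes L b, √(f (‖lam‖ ^ 2) * y c) ^ 2) * ∑ c ∈ classes L b, √(z c) ^ 2 :=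
        Finset.sum_mul_sq_le_sq_mul_sq _ _ _
    _ = f (‖lam‖ ^ 2) * (∑ c ∈ classes L b, y c) * ∑ c ∈ classes L b, z c := by
        rw [Finset.sum_congr rfl fun c _ => Real.sq_sqrt (mul_nonneg hf (hy c)),
          Finset.sum_congr rfl fun c _ => Real.sq_sqrt (hz c), ← Finset.mul_sum]
    _ ≤ _ := by
        have h1 := le G
        have h2 := le F
        have h3 : 0 ≤ ∑ c ∈ classes L b, z c := Finset.sum_nonneg fun c _ => hz c
        gcongr

end core

end

end FQH

namespace FQH

noncomputable section

/-! ### Kernel projections -/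

section projections

variable {L : ℕ} {A B : Op L}

/-- Symmetric operators. -/
def Symm (A : Op L) : Prop := ∀ u v, inner ℂ (A u) v = inner ℂ u (A v)

theorem symm_starProjection (W : Submodule ℂ (Hilb L)) : Symm W.starProjection :=
  fun u v => Submodule.inner_starProjection_left_eq_right W u v

theorem symm_kerProj (A : Op L) : Symm (kerProj A) := symm_starProjection _

/-- A symmetric operator that preserves `W` also preserves its orthogonal complement. -/
theorem Symm.commute_starProjection (hA : Symm A) {W : Submodule ℂ (Hilb L)}
    (hW : ∀ v ∈ W, A v ∈ W) : Commute A W.starProjection := by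
  ext1 v
  refine (Submodule.eq_starProjection_of_mem_of_inner_eq_zero
    (hW _ (Submodule.starProjection_apply_mem W v)) fun w hw => ?_).symm
  change inner ℂ (A v - A (W.starProjection v)) w = 0
  rw [← map_sub, hA]
  exact Submodule.starProjection_inner_eq_zero v _ (hW w hw)

theorem mem_ker_iff {v : Hilb L} : v ∈ LinearMap.ker A.toLinearMap ↔ A v = 0 := LinearMap.mem_ker

theorem Symm.commute_kerProj (hB : Symm B) (h : Commute A B) : Commute B (kerProj A) := by
  refine hB.commute_starProjection fun v hv => ?_
  rw [mem_ker_iff] at hv ⊢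
  have : A (B v) = B (A v) := congrArg (fun C : Op L => C v) h.eq
  rw [this, hv, map_zero]

theorem commute_kerProj_kerProj (hB : Symm B) (h : Commute A B) :
    Commute (kerProj A) (kerProj B) :=
  (symm_kerProj A).commute_kerProj (hB.commute_kerProj h)

theorem apply_kerProj (A : Op L) (v : Hilb L) : A (kerProj A v) = 0 :=
  mem_ker_iff.1 (Submodule.starProjection_apply_mem _ v)

theorem kerProj_eq_self {v : Hilb L} (hv : A v = 0) : kerProj A v = v :=
  Submodule.starProjection_eq_self_iff.2 (mem_ker_iff.2 hv)

theorem inner_sub_kerProj (v : Hilb L) {w : Hilb L} (hw : A w = 0) :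
    inner ℂ (v - kerProj A v) w = 0 :=
  Submodule.starProjection_inner_eq_zero v w (mem_ker_iff.2 hw)

theorem inner_kerProj_self (A : Op L) (v : Hilb L) :
    inner ℂ (kerProj A v) v = ((‖kerProj A v‖ ^ 2 : ℝ) : ℂ) := by
  have h : inner ℂ (kerProj A v) v = inner ℂ (kerProj A v) (kerProj A v) := by
    rw [symm_kerProj A v v, symm_kerProj A v (kerProj A v), kerProj_eq_self (apply_kerProj A v)]
  rw [h, inner_self_eq_norm_sq_to_K]
  simp

theorem norm_sub_kerProj_le (v : Hilb L) {w : Hilb L} (hw : A w = 0) :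
    ‖v - kerProj A v‖ ≤ ‖v - w‖ := by
  rw [kerProj, Submodule.starProjection_minimal]
  exact ciInf_le ⟨0, by rintro _ ⟨_, rfl⟩; exact norm_nonneg _⟩
    (⟨w, mem_ker_iff.2 hw⟩ : LinearMap.ker A.toLinearMap)

/-- Commuting with the projection onto the tiling space. -/
def Reduces (A : Op L) : Prop := Commute A (tilingSpace L).starProjection

theorem Symm.reduces (hA : Symm A) (h : LeavesInvariant A) : Reduces A :=
  hA.commute_starProjection h

theorem Reduces.leavesInvariant (h : Reduces A) : LeavesInvariant A := by
  intro ψ hψ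
  have e : A ((tilingSpace L).starProjection ψ) = (tilingSpace L).starProjection (A ψ) :=
    congrArg (fun C : Op L => C ψ) h.eq
  rw [Submodule.starProjection_eq_self_iff.2 hψ] at e
  rw [e]
  exact Submodule.starProjection_apply_mem _ _

theorem Reduces.kerProj (h : Reduces A) : Reduces (kerProj A) :=
  ((symm_starProjection _).commute_kerProj h).symm

theorem Reduces.restr_apply (h : Reduces A) (v : Hilb L) :
    restr A v = A ((tilingSpace L).starProjection v) := by
  have : restr A v = (tilingSpace L).starProjection (A ((tilingSpace L).starProjection v)) := rfl
  rw [this]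
  exact Submodule.starProjection_eq_self_iff.2
    (h.leavesInvariant _ (Submodule.starProjection_apply_mem _ v))

theorem Reduces.restr_mul_restr_apply (hA : Reduces A) (hB : Reduces B) (v : Hilb L) :
    (restr A * restr B) v = A (B ((tilingSpace L).starProjection v)) := by
  rw [mul_apply_eq_comp, hA.restr_apply, hB.restr_apply, Submodule.starProjection_eq_self_iff.2
    (hB.leavesInvariant _ (Submodule.starProjection_apply_mem _ v))]

/-- Nested kernels within the tiling space. -/
theorem kerProj_kerProj_of_le (hA : Reduces A) (h : ∀ ψ ∈ tilingSpace L, A ψ = 0 → B ψ = 0)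
    {φ : Hilb L} (hφ : φ ∈ tilingSpace L) : kerProj B (kerProj A φ) = kerProj A φ :=
  kerProj_eq_self (h _ (hA.kerProj.leavesInvariant φ hφ) (apply_kerProj A φ))

/-- The inclusion of kernels is available only inside the tiling space. The vector η = P_A(φ - P_B
φ) stays there, hence lies in ker B, while φ - P_B φ is orthogonal to ker B; so ‖η‖² = ⟨η, φ - P_B
φ⟩ = 0. -/
theorem kerProj_kerProj_of_le' (hA : Reduces A) (hB : Reduces B)
    (h : ∀ ψ ∈ tilingSpace L, A ψ = 0 → B ψ = 0)
    {φ : Hilb L} (hφ : φ ∈ tilingSpace L) : kerProj A (kerProj B φ) = kerProj A φ := by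
  rw [eq_comm, ← sub_eq_zero, ← map_sub]
  set η := kerProj A (φ - kerProj B φ) with hη
  have h1 : φ - kerProj B φ ∈ tilingSpace L :=
    Submodule.sub_mem _ hφ (hB.kerProj.leavesInvariant φ hφ)
  have h2 : B η = 0 := h _ (hA.kerProj.leavesInvariant _ h1) (apply_kerProj A _)
  have h3 := inner_kerProj_self A (φ - kerProj B φ)
  rw [← inner_conj_symm, ← hη, inner_sub_kerProj φ h2, map_zero] at h3
  have h4 : ‖η‖ ^ 2 = 0 := by exact_mod_cast h3.symm
  simpa using h4

end projections

/-! ### The martingale operators -/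

section martingale

variable {κ : ℝ} (lam : ℂ) {L N k n m : ℕ}

theorem symm_ham (a b : ℕ) : Symm (Ham L κ lam a b) := by
  intro u v
  rw [← ContinuousLinearMap.adjoint_inner_right, ← ContinuousLinearMap.star_eq_adjoint, star_ham]

theorem symm_hLoc : Symm (hLoc L κ lam k n) := symm_ham _ _ _

theorem symm_hSum : Symm (hSum L κ lam k n) := by
  intro u v
  rw [hSum, sum_apply, sum_apply, sum_inner, inner_sum]
  exact Finset.sum_congr rfl fun m _ => symm_hLoc lam u v

/-- Elementary properties of the interval `Λ_n`. -/
theorem leftEnd_spec (hk : 1 ≤ k ∧ k ≤ 3) (hn : 2 ≤ n) :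
    1 ≤ leftEnd k n ∧ leftEnd k n + 3 ≤ 3 * n + k ∧ 3 * n + k ≤ leftEnd k n + 8 := by
  unfold leftEnd
  split_ifs <;> omega

theorem reduces_hLoc (hL : 10 ≤ L) (hk : 1 ≤ k ∧ k ≤ 3) (hLN : L = 3 * N + k)
    (hn : 2 ≤ n) (hnN : n ≤ N) : Reduces (hLoc L κ lam k n) := by
  have := leftEnd_spec hk hn
  exact (symm_hLoc lam).reduces fun ψ hψ =>
    ham_mem κ lam (by omega) (by omega) (by omega) (by omega) hψ

theorem reduces_hSum (hL : 10 ≤ L) (hk : 1 ≤ k ∧ k ≤ 3) (hLN : L = 3 * N + k)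
    (hnN : n ≤ N) : Reduces (hSum L κ lam k n) := by
  refine (symm_hSum lam).reduces fun ψ hψ => ?_
  rw [hSum, sum_apply]
  refine Submodule.sum_mem _ fun m hm => ?_
  rw [Finset.mem_Icc] at hm
  exact (reduces_hLoc lam hL hk hLN hm.1 (by omega)).leavesInvariant ψ hψ

theorem hLoc_eq_zero_iff (hL : 10 ≤ L) (hk : 1 ≤ k ∧ k ≤ 3) (hLN : L = 3 * N + k)
    (hκ : 0 < κ) (hn : 2 ≤ n) (hnN : n ≤ N) {ψ : Hilb L}
    (hψ : ψ ∈ tilingSpace L) : hLoc L κ lam k n ψ = 0 ↔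
      ∀ x ∈ Finset.Icc (leftEnd k n) (3 * n + k - 3), q L lam x ψ = 0 := by
  have := leftEnd_spec hk hn
  exact ham_eq_zero_iff κ lam hκ (by omega) (by omega) (by omega) (by omega) hψ

theorem inner_hLoc (hL : 10 ≤ L) (hk : 1 ≤ k ∧ k ≤ 3) (hLN : L = 3 * N + k)
    (hn : 2 ≤ n) (hnN : n ≤ N) {ψ : Hilb L}
    (hψ : ψ ∈ tilingSpace L) : inner ℂ ψ (hLoc L κ lam k n ψ) =
      ((κ * ∑ x ∈ Finset.Icc (leftEnd k n) (3 * n + k - 3), ‖q L lam x ψ‖ ^ 2 : ℝ) : ℂ) := by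
  have := leftEnd_spec hk hn
  exact inner_ham κ lam (by omega) (by omega) (by omega) (by omega) hψ

/-- The energy is a sum of squares with positive weights, and every bond of [1, 3n + k] lies in some
Λ_m with 2 ≤ m ≤ n. -/
theorem hSum_eq_zero_iff (hL : 10 ≤ L) (hk : 1 ≤ k ∧ k ≤ 3) (hLN : L = 3 * N + k)
    (hκ : 0 < κ) (hn : 2 ≤ n) (hnN : n ≤ N) {ψ : Hilb L}
    (hψ : ψ ∈ tilingSpace L) : hSum L κ lam k n ψ = 0 ↔
      ∀ x ∈ Finset.Icc 1 (3 * n + k - 3), q L lam x ψ = 0 := by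
  constructor
  · intro h
    have e : inner ℂ ψ (hSum L κ lam k n ψ) = ((∑ m ∈ Finset.Icc 2 n,
        κ * ∑ x ∈ Finset.Icc (leftEnd k m) (3 * m + k - 3), ‖q L lam x ψ‖ ^ 2 : ℝ) : ℂ) := by
      rw [hSum, sum_apply, inner_sum, Complex.ofReal_sum]
      refine Finset.sum_congr rfl fun m hm => ?_
      rw [Finset.mem_Icc] at hm
      exact inner_hLoc lam hL hk hLN hm.1 (by omega) hψ
    rw [h, inner_zero_right, eq_comm, Complex.ofReal_eq_zero] at e
    intro x hx
    rw [Finset.mem_Icc] at hx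
    have nn : ∀ m, 0 ≤ ∑ x ∈ Finset.Icc (leftEnd k m) (3 * m + k - 3), ‖q L lam x ψ‖ ^ 2 :=
      fun m => Finset.sum_nonneg fun _ _ => by positivity
    have h1 := (Finset.sum_eq_zero_iff_of_nonneg fun m _ => mul_nonneg hκ.le (nn m)).1 e
    have key : ∀ m ∈ Finset.Icc 2 n, x ∈ Finset.Icc (leftEnd k m) (3 * m + k - 3) →
        q L lam x ψ = 0 := by
      intro m hm hxm
      have h2 := (mul_eq_zero.1 (h1 m hm)).resolve_left hκ.ne'
      simpa using (Finset.sum_eq_zero_iff_of_nonneg fun _ _ => by positivity).1 h2 x hxm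
    by_cases hx2 : x ≤ 3 + k
    · refine key 2 (by rw [Finset.mem_Icc]; omega) ?_
      rw [Finset.mem_Icc, leftEnd, if_pos rfl]
      omega
    -- The least m with x ≤ 3m + k - 3.
    · refine key ((x + 5 - k) / 3) (by rw [Finset.mem_Icc]; omega) ?_
      rw [Finset.mem_Icc, leftEnd, if_neg (by omega)]
      omega
  · intro h
    rw [hSum, sum_apply]
    refine Finset.sum_eq_zero fun m hm => ?_
    rw [Finset.mem_Icc] at hm
    rw [hLoc_eq_zero_iff lam hL hk hLN hκ hm.1 (by omega) hψ]
    intro x hx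
    have := leftEnd_spec hk hm.1
    rw [Finset.mem_Icc] at hx
    exact h x (by rw [Finset.mem_Icc]; omega)

theorem reduces_gProj (hL : 10 ≤ L) (hk : 1 ≤ k ∧ k ≤ 3) (hLN : L = 3 * N + k)
    (hn : 2 ≤ n) (hnN : n ≤ N) : Reduces (gProj L κ lam k n) :=
  (reduces_hLoc lam hL hk hLN hn hnN).kerProj

theorem reduces_GProj (hL : 10 ≤ L) (hk : 1 ≤ k ∧ k ≤ 3) (hLN : L = 3 * N + k)
    (hnN : n ≤ N) : Reduces (GProj L κ lam k n) :=
  (reduces_hSum lam hL hk hLN hnN).kerProj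

theorem hSum_le_hLoc (hL : 10 ≤ L) (hk : 1 ≤ k ∧ k ≤ 3) (hLN : L = 3 * N + k)
    (hκ : 0 < κ) (hn : 2 ≤ n) (hnm : n ≤ m) (hmN : m ≤ N) (ψ : Hilb L)
    (hψ : ψ ∈ tilingSpace L) (h : hSum L κ lam k m ψ = 0) : hLoc L κ lam k n ψ = 0 := by
  rw [hSum_eq_zero_iff lam hL hk hLN hκ (by omega) hmN hψ] at h
  rw [hLoc_eq_zero_iff lam hL hk hLN hκ hn (by omega) hψ]
  intro x hx
  have := leftEnd_spec hk hn
  rw [Finset.mem_Icc] at hx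
  exact h x (by rw [Finset.mem_Icc]; omega)

theorem hSum_le_hSum (hL : 10 ≤ L) (hk : 1 ≤ k ∧ k ≤ 3) (hLN : L = 3 * N + k)
    (hκ : 0 < κ) (hn : 2 ≤ n) (hnm : n ≤ m) (hmN : m ≤ N) (ψ : Hilb L)
    (hψ : ψ ∈ tilingSpace L) (h : hSum L κ lam k m ψ = 0) : hSum L κ lam k n ψ = 0 := by
  rw [hSum_eq_zero_iff lam hL hk hLN hκ (by omega) hmN hψ] at h
  rw [hSum_eq_zero_iff lam hL hk hLN hκ hn (by omega) hψ]
  intro x hx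
  rw [Finset.mem_Icc] at hx
  exact h x (by rw [Finset.mem_Icc]; omega)

/-- The left end 3n + k - 8 of Λ_n exceeds 3m + k, so Λ_n is disjoint from every interval entering
H_m. -/
theorem commute_gProj_GProj (hk : 1 ≤ k ∧ k ≤ 3)
    (hm : m + 3 ≤ n) :
    Commute (gProj L κ lam k n) (GProj L κ lam k m) := by
  refine commute_kerProj_kerProj (symm_hSum lam) ?_
  refine Commute.sum_right _ _ _ fun i hi => ?_
  rw [Finset.mem_Icc] at hi
  have h1 := leftEnd_spec hk hi.1
  have h2 := leftEnd_spec hk (show 2 ≤ n by omega)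
  refine (ham_commute (by omega) (by omega) ?_).symm
  rw [leftEnd, if_neg (by omega)]
  omega

/-- The energy of `h_n` is at least `κ` above its ground states. -/
theorem norm_sub_gProj_sq_le (hL : 10 ≤ L) (hk : 1 ≤ k ∧ k ≤ 3) (hLN : L = 3 * N + k)
    (hκ : 0 < κ) (hn : 2 ≤ n) (hnN : n ≤ N) {ψ : Hilb L}
    (hψ : ψ ∈ tilingSpace L) : κ * ‖ψ - gProj L κ lam k n ψ‖ ^ 2
      ≤ (inner ℂ ψ (hLoc L κ lam k n ψ)).re := by
  have := leftEnd_spec hk hn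
  obtain ⟨χ, hχ, h0, hle⟩ := exists_kernel_near (a := leftEnd k n) (b := 3 * n + k) (by omega)
    (by omega) (by omega) (by omega) lam hψ
  rw [inner_hLoc lam hL hk hLN hn hnN hψ, Complex.ofReal_re]
  refine mul_le_mul_of_nonneg_left (le_trans ?_ hle) hκ.le
  exact pow_le_pow_left₀ (norm_nonneg _) (norm_sub_kerProj_le ψ
    ((hLoc_eq_zero_iff lam hL hk hLN hκ hn hnN hχ).2 h0)) 2

/-- The overlap of the excitations created by `h_n` with the ground states of `h_n`. -/
theorem norm_gProj_sq_le (hL : 10 ≤ L) (hk : 1 ≤ k ∧ k ≤ 3) (hLN : L = 3 * N + k)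
    (hκ : 0 < κ) (hn : 2 ≤ n) (hnN : n ≤ N) {φ : Hilb L}
    (hφ : φ ∈ tilingSpace L) (h1 : 3 ≤ n → hSum L κ lam k (n - 1) φ = 0)
    (h2 : GProj L κ lam k n φ = 0) :
    ‖gProj L κ lam k n φ‖ ^ 2 ≤ f (‖lam‖ ^ 2) * ‖φ‖ ^ 2 := by
  have hf := f_nonneg (r := ‖lam‖ ^ 2) (by positivity)
  have hL5 : 5 ≤ L := by omega
  have hχ := (reduces_gProj (κ := κ) lam hL hk hLN hn hnN).leavesInvariant φ hφ
  -- For n = 2 the operators h_2 and H_2 coincide, so the projection already vanishes by `h2`.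
  rcases Nat.lt_or_ge n 3 with h3 | h3
  · obtain rfl : n = 2 := by omega
    have e : hSum L κ lam k 2 = hLoc L κ lam k 2 := by simp [hSum]
    rw [GProj, e] at h2
    rw [gProj, h2, norm_zero, zero_pow two_ne_zero]
    positivity
  have hrF : Rel L lam (fun T => φ (cfg L T)) 0 (3 * n + k - 3) := by
    have := h1 h3
    rw [hSum_eq_zero_iff lam hL hk hLN hκ (by omega) (by omega) hφ] at this
    have := (forall_q_eq_zero_iff_rel (a := 1) (b := 3 * (n - 1) + k) lam hL5 le_rfl (by omega)
      hφ).1 this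
    rwa [show 3 * (n - 1) + k = 3 * n + k - 3 by omega] at this
  have hrG : Rel L lam (fun T => gProj L κ lam k n φ (cfg L T)) (3 * n + k - 9) (3 * n + k) := by
    have h4 := apply_kerProj (hLoc L κ lam k n) φ
    have := leftEnd_spec hk hn
    have := (forall_q_eq_zero_iff_rel (a := leftEnd k n) (b := 3 * n + k) lam hL5 (by omega)
      (by omega) hχ).1 ((hLoc_eq_zero_iff lam hL hk hLN hκ hn hnN hχ).1 h4)
    rwa [show leftEnd k n - 1 = 3 * n + k - 9 by
      rw [leftEnd, if_neg (by omega)]; omega] at this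
  have ho : ∀ G, Rel L lam G 0 (3 * n + k) →
      ∑ T ∈ tilings L, star (G T) * φ (cfg L T) = 0 := by
    intro G hG
    have hv := tilingVec_mem hL5 G
    have h5 : hSum L κ lam k n (tilingVec L G) = 0 := by
      rw [hSum_eq_zero_iff lam hL hk hLN hκ (by omega) hnN hv]
      refine (forall_q_eq_zero_iff_rel (a := 1) (b := 3 * n + k) lam hL5 le_rfl (by omega) hv).2 ?_
      intro X Y hE h h'
      simp only
      rw [tilingVec_apply hL5 G hE, tilingVec_apply hL5 G ((ext_MM_iff _ _ _).2 hE)]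
      exact hG X Y hE h h'
    have h6 : inner ℂ (tilingVec L G) φ = 0 := by
      have := inner_sub_kerProj φ h5
      rw [show kerProj (hSum L κ lam k n) φ = 0 from h2, sub_zero] at this
      rw [← inner_conj_symm, this, map_zero]
    rw [inner_eq_sum hL5 _ hφ] at h6
    rw [← h6]
    refine Finset.sum_congr rfl fun T hT => ?_
    rw [tilingVec_apply hL5 G (mem_tilings.1 hT)]
  -- Applied to the pair g_n φ, φ, whose inner product is ‖g_n φ‖²; one factor ‖g_n φ‖² then
  -- cancels.
  have key := overlap_estimate (b := 3 * n + k) (by omega) hrF hrG ho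
  rw [← inner_eq_sum hL5 _ hφ, ← norm_sq_eq_sum hL5 hφ, ← norm_sq_eq_sum hL5 hχ] at key
  rw [show inner ℂ (gProj L κ lam k n φ) φ = ((‖gProj L κ lam k n φ‖ ^ 2 : ℝ) : ℂ) from
    inner_kerProj_self _ φ, Complex.norm_real, Real.norm_eq_abs, sq_abs] at key
  rcases eq_or_lt_of_le (sq_nonneg ‖gProj L κ lam k n φ‖) with h0 | h0
  · rw [← h0]; positivity
  · refine le_of_mul_le_mul_left ?_ h0
    linarith [key]

end martingale

end

end FQH

namespace FQH

noncomputable section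

/-! ### The martingale argument -/

section gap

/-- The decreasing family `1, …, 1, G_2, …, G_N, 0, …` whose increments are the `E_n`. -/
def Gam (L : ℕ) (κ : ℝ) (lam : ℂ) (N k n : ℕ) : Op L :=
  if n ≤ 1 then 1 else if n ≤ N then GProj L κ lam k n else 0

variable {κ : ℝ} (lam : ℂ) {L N k n m : ℕ}

theorem EProj_eq (hN : 2 ≤ N) (h1 : 1 ≤ n) (hn : n ≤ N) :
    EProj L κ lam N k n = Gam L κ lam N k n - Gam L κ lam N k (n + 1) := by
  unfold EProj Gam
  rcases Nat.lt_or_ge n 2 with h | h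
  · obtain rfl : n = 1 := by omega
    simp [hN]
  · have a1 : ¬ n = 1 := by omega
    have a2 : ¬ n ≤ 1 := by omega
    have a3 : ¬ n + 1 ≤ 1 := by omega
    rcases Nat.lt_or_ge n N with h' | h'
    · have h'' : n + 1 ≤ N := h'
      simp only [a1, a2, a3, h', h'', hn, if_false, if_true]
    · obtain rfl : n = N := by omega
      have a4 : ¬ n + 1 ≤ n := by omega
      simp only [a1, a2, a3, a4, lt_irrefl, le_rfl, if_false, if_true, sub_zero]

theorem symm_Gam : Symm (Gam L κ lam N k n) := by
  unfold Gam
  split_ifs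
  · exact fun _ _ => rfl
  · exact symm_kerProj _
  · intro u v
    simp

theorem reduces_Gam (hL : 10 ≤ L) (hk : 1 ≤ k ∧ k ≤ 3) (hLN : L = 3 * N + k) :
    Reduces (Gam L κ lam N k n) := by
  unfold Gam
  split_ifs with h1 h2
  · exact Commute.one_left _
  · exact reduces_GProj lam hL hk hLN h2
  · exact Commute.zero_left _

theorem Gam_Gam (hL : 10 ≤ L) (hk : 1 ≤ k ∧ k ≤ 3) (hLN : L = 3 * N + k)
    (hκ : 0 < κ) (h : n ≤ m) {φ : Hilb L} (hφ : φ ∈ tilingSpace L) :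
    Gam L κ lam N k n (Gam L κ lam N k m φ) = Gam L κ lam N k m φ := by
  unfold Gam
  by_cases h1 : n ≤ 1
  · rw [if_pos h1]; rfl
  · rw [if_neg h1, if_neg (show ¬ m ≤ 1 by omega)]
    by_cases h2 : m ≤ N
    · rw [if_pos h2, if_pos (by omega)]
      exact kerProj_kerProj_of_le (reduces_hSum lam hL hk hLN h2)
        (hSum_le_hSum lam hL hk hLN hκ (by omega) h h2) hφ
    · rw [if_neg h2]
      simp

theorem Gam_Gam' (hL : 10 ≤ L) (hk : 1 ≤ k ∧ k ≤ 3) (hLN : L = 3 * N + k)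
    (hκ : 0 < κ) (h : n ≤ m) {φ : Hilb L} (hφ : φ ∈ tilingSpace L) :
    Gam L κ lam N k m (Gam L κ lam N k n φ) = Gam L κ lam N k m φ := by
  unfold Gam
  by_cases h1 : n ≤ 1
  · rw [if_pos h1]; rfl
  · rw [if_neg h1, if_neg (show ¬ m ≤ 1 by omega)]
    by_cases h2 : m ≤ N
    · rw [if_pos h2, if_pos (by omega)]
      exact kerProj_kerProj_of_le' (reduces_hSum lam hL hk hLN h2)
        (reduces_hSum lam hL hk hLN (by omega))
        (hSum_le_hSum lam hL hk hLN hκ (by omega) h h2) hφ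
    · rw [if_neg h2]
      simp

theorem gProj_Gam (hL : 10 ≤ L) (hk : 1 ≤ k ∧ k ≤ 3) (hLN : L = 3 * N + k)
    (hκ : 0 < κ) (hn : 2 ≤ n) (h : n ≤ m) {φ : Hilb L} (hφ : φ ∈ tilingSpace L) :
    gProj L κ lam k n (Gam L κ lam N k m φ) = Gam L κ lam N k m φ := by
  unfold Gam
  rw [if_neg (show ¬ m ≤ 1 by omega)]
  by_cases h2 : m ≤ N
  · rw [if_pos h2]
    exact kerProj_kerProj_of_le (reduces_hSum lam hL hk hLN h2)
      (hSum_le_hLoc lam hL hk hLN hκ hn h h2) hφ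
  · rw [if_neg h2]
    simp

theorem Gam_gProj (hL : 10 ≤ L) (hk : 1 ≤ k ∧ k ≤ 3) (hLN : L = 3 * N + k)
    (hκ : 0 < κ) (hn : 2 ≤ n) (hnN : n ≤ N) (h : n ≤ m) {φ : Hilb L}
    (hφ : φ ∈ tilingSpace L) :
    Gam L κ lam N k m (gProj L κ lam k n φ) = Gam L κ lam N k m φ := by
  unfold Gam
  rw [if_neg (show ¬ m ≤ 1 by omega)]
  by_cases h2 : m ≤ N
  · rw [if_pos h2]
    exact kerProj_kerProj_of_le' (reduces_hSum lam hL hk hLN h2)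
      (reduces_hLoc lam hL hk hLN hn hnN) (hSum_le_hLoc lam hL hk hLN hκ hn h h2) hφ
  · rw [if_neg h2]
    simp

theorem gProj_Gam_comm (hk : 1 ≤ k ∧ k ≤ 3)
    (h : m + 3 ≤ n) (φ : Hilb L) :
    gProj L κ lam k n (Gam L κ lam N k m φ) = Gam L κ lam N k m (gProj L κ lam k n φ) := by
  unfold Gam
  split_ifs
  · rfl
  · exact congrArg (fun C : Op L => C φ) (commute_gProj_GProj lam hk h).eq
  · simp

theorem reduces_EProj (hL : 10 ≤ L) (hk : 1 ≤ k ∧ k ≤ 3) (hLN : L = 3 * N + k)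
    (h1 : 1 ≤ m) (hm : m ≤ N) : Reduces (EProj L κ lam N k m) := by
  rw [EProj_eq lam (by omega) h1 hm]
  exact Commute.sub_left (reduces_Gam lam hL hk hLN) (reduces_Gam lam hL hk hLN)

theorem gProj_EProj_comm (hL : 10 ≤ L) (hk : 1 ≤ k ∧ k ≤ 3) (hLN : L = 3 * N + k)
    (hκ : 0 < κ) (hn : 2 ≤ n) (hnN : n ≤ N) (h1 : 1 ≤ m) (hm : m ≤ N)
    (h : ¬ (n ≤ m + 3 ∧ m + 1 ≤ n)) {φ : Hilb L} (hφ : φ ∈ tilingSpace L) :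
    gProj L κ lam k n (EProj L κ lam N k m φ) = EProj L κ lam N k m (gProj L κ lam k n φ) := by
  rw [EProj_eq lam (by omega) h1 hm, sub_apply, sub_apply, map_sub]
  rcases Nat.lt_or_ge m n with h' | h'
  · rw [gProj_Gam_comm lam hk (by omega), gProj_Gam_comm lam hk (by omega)]
  · rw [gProj_Gam lam hL hk hLN hκ hn h' hφ, gProj_Gam lam hL hk hLN hκ hn (by omega) hφ,
      Gam_gProj lam hL hk hLN hκ hn hnN h' hφ, Gam_gProj lam hL hk hLN hκ hn hnN (by omega) hφ]

theorem norm_Gam_sub_sq (hL : 10 ≤ L) (hk : 1 ≤ k ∧ k ≤ 3) (hLN : L = 3 * N + k)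
    (hκ : 0 < κ) (h : n ≤ m) {φ : Hilb L} (hφ : φ ∈ tilingSpace L) :
    ‖Gam L κ lam N k n φ - Gam L κ lam N k m φ‖ ^ 2
      = ‖Gam L κ lam N k n φ‖ ^ 2 - ‖Gam L κ lam N k m φ‖ ^ 2 := by
  have e : inner ℂ (Gam L κ lam N k n φ - Gam L κ lam N k m φ) (Gam L κ lam N k m φ) = 0 := by
    have := symm_Gam (κ := κ) (L := L) (N := N) (k := k) (n := m) lam
      (Gam L κ lam N k n φ - Gam L κ lam N k m φ) φ
    rw [← this, map_sub, Gam_Gam' lam hL hk hLN hκ h hφ, Gam_Gam' lam hL hk hLN hκ le_rfl hφ,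
      sub_self, inner_zero_left]
  have := norm_add_sq_eq_norm_sq_add_norm_sq_of_inner_eq_zero _ _ e
  rw [sub_add_cancel] at this
  linarith

/-- The increment lies in ker H_n (for n ≥ 2) and has no component in ker H_{n+1}, which is what
`norm_gProj_sq_le` asks for at n + 1. -/
theorem norm_gProj_Gam_sub_le (hL : 10 ≤ L) (hk : 1 ≤ k ∧ k ≤ 3) (hLN : L = 3 * N + k)
    (hκ : 0 < κ) (h1 : 1 ≤ n) (hn : n + 1 ≤ N) {φ : Hilb L}
    (hφ : φ ∈ tilingSpace L) :
    ‖gProj L κ lam k (n + 1) (Gam L κ lam N k n φ - Gam L κ lam N k (n + 1) φ)‖ ^ 2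
      ≤ f (‖lam‖ ^ 2) * ‖Gam L κ lam N k n φ - Gam L κ lam N k (n + 1) φ‖ ^ 2 := by
  have r1 := fun i => (reduces_Gam (κ := κ) (n := i) lam hL hk hLN).leavesInvariant φ hφ
  refine norm_gProj_sq_le lam hL hk hLN hκ (by omega) hn (Submodule.sub_mem _ (r1 _) (r1 _))
    (fun h3 => ?_) ?_
  · rw [Nat.add_sub_cancel, map_sub]
    have e : ∀ i, n ≤ i → hSum L κ lam k n (Gam L κ lam N k i φ) = 0 := by
      intro i hi
      rw [← Gam_Gam lam hL hk hLN hκ hi hφ, Gam, if_neg (by omega), if_pos (by omega)]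
      exact apply_kerProj _ _
    rw [e n le_rfl, e (n + 1) (by omega), sub_zero]
  · have e : GProj L κ lam k (n + 1) = Gam L κ lam N k (n + 1) := by
      rw [Gam, if_neg (by omega), if_pos hn]
    rw [e, map_sub, Gam_Gam' lam hL hk hLN hκ (by omega) hφ,
      Gam_Gam' lam hL hk hLN hκ le_rfl hφ, sub_self]

/-- The increments of a tiling state are controlled by local excitations and by the neighbouring
increments. -/
theorem increment_sq_le (hL : 10 ≤ L) (hk : 1 ≤ k ∧ k ≤ 3) (hLN : L = 3 * N + k)
    (hκ : 0 < κ) (h1 : 1 ≤ n) (hn : n + 1 ≤ N) {ψ : Hilb L}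
    (hψ : ψ ∈ tilingSpace L) :
    ‖Gam L κ lam N k n ψ - Gam L κ lam N k (n + 1) ψ‖ ^ 2
      ≤ ‖Gam L κ lam N k n ψ - Gam L κ lam N k (n + 1) ψ‖ *
        (‖ψ - gProj L κ lam k (n + 1) ψ‖ + √(f (‖lam‖ ^ 2)) *
          ‖Gam L κ lam N k (n - 2) ψ - Gam L κ lam N k (n + 1) ψ‖) := by
  have hf := f_nonneg (r := ‖lam‖ ^ 2) (by positivity)
  set Γ := Gam L κ lam N k with hΓ
  set g := gProj L κ lam k (n + 1) with hg
  set e := Γ n ψ - Γ (n + 1) ψ with he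
  set p := Γ (n - 2) ψ - Γ (n + 1) ψ with hp
  have sg : Symm g := symm_kerProj _
  have r1 := fun i => (reduces_Gam (κ := κ) (n := i) lam hL hk hLN).leavesInvariant ψ hψ
  have e1 : inner ℂ e (Γ (n + 1) ψ) = 0 := by
    have := symm_Gam (κ := κ) (L := L) (N := N) (k := k) (n := n + 1) lam e ψ
    rw [← this, he, map_sub, Gam_Gam' lam hL hk hLN hκ (by omega) hψ,
      Gam_Gam' lam hL hk hLN hκ le_rfl hψ, sub_self, inner_zero_left]
  have e2 : inner ℂ e (ψ - Γ n ψ) = 0 := by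
    have := symm_Gam (κ := κ) (L := L) (N := N) (k := k) (n := n) lam e ψ
    rw [inner_sub_right, ← this, he, map_sub, Gam_Gam lam hL hk hLN hκ le_rfl hψ,
      Gam_Gam lam hL hk hLN hκ (by omega) hψ, sub_self]
  -- For n ≥ 4, g_{n+1} commutes with Γ_{n-2}, which fixes `e`; for n ≤ 3 the truncated index makes
  -- Γ_{n-2} the identity. Moreover g_{n+1} fixes Γ_{n+1} ψ, which is orthogonal to `e`. Only the
  -- three increments in `p` remain.
  have e3 : inner ℂ e (g ψ) = inner ℂ e (g p) := by
    have h3 : inner ℂ e (g (ψ - Γ (n - 2) ψ)) = 0 := by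
      by_cases h2 : n ≤ 3
      · have : Γ (n - 2) = 1 := by rw [hΓ, Gam, if_pos (by omega)]
        rw [this, one_apply_eq_self, sub_self, map_zero, inner_zero_right]
      · have hc : g (Γ (n - 2) ψ) = Γ (n - 2) (g ψ) := gProj_Gam_comm lam hk (by omega) ψ
        have := symm_Gam (κ := κ) (L := L) (N := N) (k := k) (n := n - 2) lam e (g ψ)
        rw [map_sub, hc, inner_sub_right, ← this, he, map_sub,
          Gam_Gam lam hL hk hLN hκ (by omega) hψ, Gam_Gam lam hL hk hLN hκ (by omega) hψ, sub_self]
    have h4 : g (Γ (n + 1) ψ) = Γ (n + 1) ψ := gProj_Gam lam hL hk hLN hκ (by omega) le_rfl hψ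
    have h5 : g ψ = g (ψ - Γ (n - 2) ψ) + g p + Γ (n + 1) ψ := by
      rw [hp, map_sub, map_sub, h4]
      abel
    rw [h5, inner_add_right, inner_add_right, h3, e1, zero_add, add_zero]
  have e4 : inner ℂ e e = inner ℂ e (ψ - g ψ) + inner ℂ (g e) p := by
    have h6 : e = (ψ - g ψ) + g ψ - (ψ - Γ n ψ) - Γ (n + 1) ψ := by rw [he]; abel
    conv_lhs => rhs; rw [h6]
    rw [inner_sub_right, inner_sub_right, inner_add_right, e1, e2, e3, sg]
    ring
  have e5 : ‖e‖ ^ 2 = ‖inner ℂ e e‖ := by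
    rw [inner_self_eq_norm_sq_to_K]; simp
  have e6 : ‖g e‖ ≤ √(f (‖lam‖ ^ 2)) * ‖e‖ := by
    rw [← Real.sqrt_sq (norm_nonneg e), ← Real.sqrt_mul hf]
    exact Real.le_sqrt_of_sq_le (norm_gProj_Gam_sub_le lam hL hk hLN hκ h1 hn hψ)
  rw [e5, e4]
  calc ‖inner ℂ e (ψ - g ψ) + inner ℂ (g e) p‖
      ≤ ‖inner ℂ e (ψ - g ψ)‖ + ‖inner ℂ (g e) p‖ := norm_add_le _ _
    _ ≤ ‖e‖ * ‖ψ - g ψ‖ + ‖g e‖ * ‖p‖ := add_le_add (norm_inner_le_norm _ _) (norm_inner_le_norm _ _)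
    _ ≤ ‖e‖ * ‖ψ - g ψ‖ + √(f (‖lam‖ ^ 2)) * ‖e‖ * ‖p‖ := by gcongr
    _ = _ := by ring

/-- Summing over n and applying Cauchy–Schwarz to both terms gives S ≤ √S √B + √(3F) S, where B is
the sum of the squares of `b`; divide by √S and square. The condition on `F` makes 1 - √(3F)
nonnegative, so that squaring preserves the inequality. -/
theorem martingale_bound {S : ℝ} {F : ℝ} (hF1 : F < 1 / 3) (hS : 0 ≤ S)
    (s : Finset ℕ) (a b p : ℕ → ℝ) (h : ∀ n ∈ s, a n ^ 2 ≤ a n * (b n + √F * p n))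
    (ha : ∑ n ∈ s, a n ^ 2 = S) (hp : ∑ n ∈ s, p n ^ 2 ≤ 3 * S) :
    (1 - √(3 * F)) ^ 2 * S ≤ ∑ n ∈ s, b n ^ 2 := by
  set B := ∑ n ∈ s, b n ^ 2 with hB
  have hB0 : 0 ≤ B := Finset.sum_nonneg fun _ _ => sq_nonneg _
  have h1 : S ≤ √S * √B + √F * (√S * √(3 * S)) := by
    calc S = ∑ n ∈ s, a n ^ 2 := ha.symm
      _ ≤ ∑ n ∈ s, a n * (b n + √F * p n) := Finset.sum_le_sum h
      _ = ∑ n ∈ s, a n * b n + √F * ∑ n ∈ s, a n * p n := by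
        rw [Finset.mul_sum, ← Finset.sum_add_distrib]
        exact Finset.sum_congr rfl fun n _ => by ring
      _ ≤ √S * √B + √F * (√S * √(3 * S)) := by
        have c1 := Real.sum_mul_le_sqrt_mul_sqrt s a b
        have c2 := Real.sum_mul_le_sqrt_mul_sqrt s a p
        rw [ha] at c1 c2
        have c3 : √(∑ n ∈ s, p n ^ 2) ≤ √(3 * S) := Real.sqrt_le_sqrt hp
        have c4 := mul_le_mul_of_nonneg_left c3 (Real.sqrt_nonneg S)
        exact add_le_add c1 (mul_le_mul_of_nonneg_left (c2.trans c4) (Real.sqrt_nonneg F))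
  have h2 : (1 - √(3 * F)) * √S ≤ √B := by
    rcases eq_or_lt_of_le (Real.sqrt_nonneg S) with h0 | h0
    · rw [← h0, mul_zero]; exact Real.sqrt_nonneg _
    · refine le_of_mul_le_mul_left ?_ h0
      have e : √F * (√S * √(3 * S)) = √(3 * F) * √S * √S := by
        rw [Real.sqrt_mul (by norm_num), Real.sqrt_mul (by norm_num)]; ring
      have e' := Real.mul_self_sqrt hS
      rw [e] at h1
      linarith
  have h3 : √(3 * F) ≤ 1 := Real.sqrt_le_one.2 (by linarith)
  have h4 := pow_le_pow_left₀ (mul_nonneg (by linarith) (Real.sqrt_nonneg S)) h2 2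
  rwa [mul_pow, Real.sq_sqrt hS, Real.sq_sqrt hB0] at h4

/-- Every bond belongs to at most three of the intervals `Λ_n`. -/
theorem sum_hLoc_le (hL : 10 ≤ L) (hk : 1 ≤ k ∧ k ≤ 3) (hLN : L = 3 * N + k)
    {w : ℕ → ℝ} (hw : ∀ x, 0 ≤ w x) :
    ∑ n ∈ Finset.Icc 2 N, ∑ x ∈ Finset.Icc (leftEnd k n) (3 * n + k - 3), w x
      ≤ 3 * ∑ x ∈ Finset.Icc 1 (L - 3), w x := by
  have e : ∀ n ∈ Finset.Icc 2 N, ∑ x ∈ Finset.Icc (leftEnd k n) (3 * n + k - 3), w x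
      = ∑ x ∈ Finset.Icc 1 (L - 3),
        if leftEnd k n ≤ x ∧ x ≤ 3 * n + k - 3 then w x else 0 := by
    intro n hn
    rw [Finset.mem_Icc] at hn
    have := leftEnd_spec hk hn.1
    rw [← Finset.sum_filter]
    refine Finset.sum_congr ?_ fun _ _ => rfl
    ext x
    simp only [Finset.mem_filter, Finset.mem_Icc]
    omega
  rw [Finset.sum_congr rfl e, Finset.sum_comm, Finset.mul_sum]
  refine Finset.sum_le_sum fun x hx => ?_
  rw [← Finset.sum_filter, Finset.sum_const, nsmul_eq_mul]
  refine mul_le_mul_of_nonneg_right ?_ (hw x)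
  -- The quotient is the least n with x ≤ 3n + k - 3.
  have hsub : (Finset.Icc 2 N).filter (fun n => leftEnd k n ≤ x ∧ x ≤ 3 * n + k - 3)
      ⊆ Finset.Icc (max 2 ((x + 5 - k) / 3)) (max 2 ((x + 5 - k) / 3) + 2) := by
    intro n hn
    simp only [Finset.mem_filter, Finset.mem_Icc] at hn ⊢
    unfold leftEnd at hn
    split_ifs at hn <;> omega
  have := Finset.card_le_card hsub
  rw [Nat.card_Icc] at this
  exact_mod_cast this.trans (by omega)

theorem gap_estimate (hL : 10 ≤ L) (hk : 1 ≤ k ∧ k ≤ 3) (hLN : L = 3 * N + k)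
    (hκ : 0 < κ) (hf : f (‖lam‖ ^ 2) < 1 / 3) {ψ : Hilb L}
    (hψ : ψ ∈ tilingSpace L) (ho : ψ ∈ (LinearMap.ker (Ham L κ lam 1 L).toLinearMap)ᗮ) :
    κ / 3 * (1 - √(3 * f (‖lam‖ ^ 2))) ^ 2 * ‖ψ‖ ^ 2 ≤ (inner ℂ ψ (Ham L κ lam 1 L ψ)).re := by
  have hN : 3 ≤ N := by omega
  set s : ℕ → ℝ := fun n => ‖Gam L κ lam N k n ψ‖ ^ 2 with hs
  have s0 : ∀ i, i ≤ 1 → s i = ‖ψ‖ ^ 2 := by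
    intro i hi
    simp only [hs]
    rw [Gam, if_pos hi, one_apply_eq_self]
  -- Inside the tiling space H_N and H_Λ have the same kernel, that of all q_x, and ψ is orthogonal
  -- to it.
  have sN : s N = 0 := by
    have hG : GProj L κ lam k N ψ ∈ tilingSpace L :=
      (reduces_GProj lam hL hk hLN le_rfl).leavesInvariant ψ hψ
    have h1 : Ham L κ lam 1 L (GProj L κ lam k N ψ) = 0 := by
      rw [ham_eq_zero_iff κ lam hκ (by omega) le_rfl (by omega) le_rfl hG]
      have := (hSum_eq_zero_iff lam hL hk hLN hκ (by omega) le_rfl hG).1 (apply_kerProj _ ψ)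
      rwa [show 3 * N + k - 3 = L - 3 by omega] at this
    have h2 := (Submodule.mem_orthogonal _ _).1 ho _ (mem_ker_iff.2 h1)
    rw [GProj, inner_kerProj_self] at h2
    simp only [hs]
    rw [Gam, if_neg (by omega), if_pos le_rfl]
    exact_mod_cast h2
  have main := martingale_bound hf (sq_nonneg ‖ψ‖) (Finset.Ico 1 N)
    (fun n => ‖Gam L κ lam N k n ψ - Gam L κ lam N k (n + 1) ψ‖)
    (fun n => ‖ψ - gProj L κ lam k (n + 1) ψ‖)
    (fun n => ‖Gam L κ lam N k (n - 2) ψ - Gam L κ lam N k (n + 1) ψ‖)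
    (fun n hn => by
      rw [Finset.mem_Ico] at hn
      exact increment_sq_le lam hL hk hLN hκ hn.1 (by omega) hψ)
    (by
      rw [Finset.sum_congr rfl fun n _ =>
        norm_Gam_sub_sq lam hL hk hLN hκ (Nat.le_succ n) hψ]
      have := Finset.sum_Ico_sub (fun n => -s n) (show 1 ≤ N by omega)
      rw [sN, s0 1 le_rfl] at this
      rw [show ‖ψ‖ ^ 2 = -0 - -‖ψ‖ ^ 2 by ring, ← this]
      exact Finset.sum_congr rfl fun n _ => by ring)
    (by
      rw [Finset.sum_congr rfl fun n _ =>
        norm_Gam_sub_sq lam hL hk hLN hκ (show n - 2 ≤ n + 1 by omega) hψ]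
      -- Split into three single increments, each of which telescopes to at most ‖ψ‖²; indices
      -- truncated to zero are harmless since `s` equals ‖ψ‖² at 0 and 1.
      have e : ∀ n, s (n - 2) - s (n + 1)
          = (-s (n + 1 - 2) - -s (n - 2)) + (-s (n + 1 - 1) - -s (n - 1)) + (-s (n + 1) - -s n) := by
        intro n
        rw [show n + 1 - 1 = n by omega, show n + 1 - 2 = n - 1 by omega]
        ring
      change ∑ n ∈ Finset.Ico 1 N, (s (n - 2) - s (n + 1)) ≤ _
      rw [Finset.sum_congr rfl fun n _ => e n, Finset.sum_add_distrib, Finset.sum_add_distrib,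
        Finset.sum_Ico_sub (fun n => -s (n - 2)) (show 1 ≤ N by omega),
        Finset.sum_Ico_sub (fun n => -s (n - 1)) (show 1 ≤ N by omega),
        Finset.sum_Ico_sub (fun n => -s n) (show 1 ≤ N by omega)]
      have h0 : ∀ i, 0 ≤ s i := fun i => sq_nonneg _
      have := h0 (N - 2)
      have := h0 (N - 1)
      rw [sN, s0 1 le_rfl, s0 (1 - 1) (by omega)]
      linarith)
  have e1 : ∑ n ∈ Finset.Ico 1 N, κ * ‖ψ - gProj L κ lam k (n + 1) ψ‖ ^ 2
      ≤ ∑ n ∈ Finset.Icc 2 N, κ * ∑ x ∈ Finset.Icc (leftEnd k n) (3 * n + k - 3),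
        ‖q L lam x ψ‖ ^ 2 := by
    have hI : Finset.Icc 2 N = (Finset.Ico 1 N).map (addRightEmbedding 1) := by
      rw [Finset.map_add_right_Ico]
      ext x
      simp only [Finset.mem_Icc, Finset.mem_Ico]
      omega
    rw [hI, Finset.sum_map]
    refine Finset.sum_le_sum fun n hn => ?_
    rw [Finset.mem_Ico] at hn
    have := norm_sub_gProj_sq_le lam hL hk hLN hκ (n := n + 1) (by omega) (by omega) hψ
    rw [inner_hLoc lam hL hk hLN (by omega) (by omega) hψ, Complex.ofReal_re] at this
    exact this
  rw [← Finset.mul_sum, ← Finset.mul_sum] at e1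
  have e2 := sum_hLoc_le hL hk hLN (w := fun x => ‖q L lam x ψ‖ ^ 2) fun x => by positivity
  rw [inner_ham κ lam (by omega) le_rfl (by omega) le_rfl hψ, Complex.ofReal_re]
  have e3 := mul_le_mul_of_nonneg_left main hκ.le
  have e4 := mul_le_mul_of_nonneg_left e2 hκ.le
  linarith

/-- There are excited tiling states. -/
theorem exists_excited (hL : 10 ≤ L) (hLN : L = 3 * N + k)
    (hκ : 0 < κ) : ∃ ψ ∈ tilingSpace L ⊓
    (LinearMap.ker (Ham L κ lam 1 L).toLinearMap)ᗮ, ψ ≠ 0 := by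
  by_contra hcon
  push Not at hcon
  have hL5 : 5 ≤ L := by omega
  -- The indicator of this tiling violates the relation of its dimer, so it is not in the kernel.
  -- Such a vector is needed because the infimum of the empty set of reals is 0; the L - 4 voids
  -- fill up the L + 2 padded sites.
  set T : List Tile := [] ++ .D :: List.replicate (L - 4) .V with hT
  have hE : Ext L T := by
    refine ext_of_isHead (Or.inl fun t ht => ?_) ?_
    · simp only [hT, List.nil_append, List.mem_cons, List.mem_replicate] at ht
      rcases ht with rfl | ⟨-, rfl⟩ <;> simp [Bulk]
    · have : ∀ n, (conf (List.replicate n Tile.V)).length = n := by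
        intro n
        induction n with
        | zero => rfl
        | succ n ih => rw [List.replicate_succ, conf_cons, List.length_append, ih]; simp [Tile.word]; ring
      rw [hT, List.nil_append, conf_cons, List.length_append, this]
      simp only [Tile.word, List.length_cons, List.length_nil]
      omega
  set G : List Tile → ℂ := fun S => if S = T then 1 else 0 with hG
  set v := tilingVec L G with hv
  have hvC := tilingVec_mem hL5 G
  have hred : Reduces (Ham L κ lam 1 L) := (symm_ham lam 1 L).reduces fun ψ hψ =>
    ham_mem κ lam hL5 le_rfl (by omega) le_rfl hψ
  have hK := hred.kerProj.leavesInvariant v hvC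
  have h0 := hcon (v - kerProj (Ham L κ lam 1 L) v)
    ⟨Submodule.sub_mem _ hvC hK, Submodule.sub_starProjection_mem_orthogonal v⟩
  have h1 : Ham L κ lam 1 L v = 0 := by
    rw [sub_eq_zero.1 h0]
    exact apply_kerProj _ v
  rw [ham_eq_zero_iff κ lam hκ hL5 le_rfl (by omega) le_rfl hvC,
    forall_q_eq_zero_iff_rel lam hL5 le_rfl le_rfl hvC] at h1
  have h2 := h1 [] (List.replicate (L - 4) .V) hE (by simp [conf_nil]) (by simp [conf_nil]; omega)
  simp only at h2
  rw [tilingVec_apply hL5 G ((ext_MM_iff _ _ _).2 hE), ← hT, tilingVec_apply hL5 G hE] at h2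
  simp [hG, hT] at h2

theorem le_E1 (hL : 10 ≤ L) (hk : 1 ≤ k ∧ k ≤ 3) (hLN : L = 3 * N + k)
    (hκ : 0 < κ) (hf : f (‖lam‖ ^ 2) < 1 / 3) :
    κ / 3 * (1 - √(3 * f (‖lam‖ ^ 2))) ^ 2 ≤ E1 L κ lam := by
  refine le_csInf ?_ ?_
  · obtain ⟨ψ, hψ, h0⟩ := exists_excited lam hL hLN hκ
    exact ⟨_, ψ, hψ, h0, rfl⟩
  · rintro _ ⟨ψ, ⟨h1, h2⟩, h0, rfl⟩
    rw [le_div_iff₀ (by positivity)]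
    exact gap_estimate lam hL hk hLN hκ hf h1 h2

end gap

end

end FQH

/-! ### The theorem -/

theorem theorem3p1 (κ : ℝ) (hκ : 0 < κ) (lam : ℂ) (L N k : ℕ) (hL : 10 ≤ L)
    (hk : 1 ≤ k ∧ k ≤ 3) (hLN : L = 3 * N + k) :
    -- the tiling space is invariant, so that the restrictions make sense
    FQH.LeavesInvariant (FQH.Ham L κ lam 1 L) ∧
    (∀ n, 2 ≤ n → n ≤ N →
      FQH.LeavesInvariant (FQH.hLoc L κ lam k n) ∧
      FQH.LeavesInvariant (FQH.hSum L κ lam k n) ∧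
      FQH.LeavesInvariant (FQH.gProj L κ lam k n)) ∧
    (∀ m, 1 ≤ m → m ≤ N → FQH.LeavesInvariant (FQH.EProj L κ lam N k m)) ∧
    -- the ratios in the definition of `f`
    (∀ n, 1 ≤ n →
      ‖FQH.phi lam (n - 1)‖ ^ 2 / ‖FQH.phi lam n‖ ^ 2 = FQH.beta (‖lam‖ ^ 2) n) ∧
    -- the supremum defining `f` is finite
    BddAbove ((fun j => FQH.fk j (‖lam‖ ^ 2)) '' Set.Ici 4) ∧
    -- the three properties
    (∀ n, 2 ≤ n → n ≤ N →
      κ • FQH.restr (1 - FQH.gProj L κ lam k n) ≤ FQH.restr (FQH.hLoc L κ lam k n) ∧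
      (∀ m, 1 ≤ m → m ≤ N →
        FQH.restr (FQH.gProj L κ lam k n) * FQH.restr (FQH.EProj L κ lam N k m)
          - FQH.restr (FQH.EProj L κ lam N k m) * FQH.restr (FQH.gProj L κ lam k n) ≠ 0 →
        n ≤ m + 3 ∧ m + 1 ≤ n) ∧
      (lam ≠ 0 →
        ‖FQH.restr (FQH.gProj L κ lam k n) * FQH.restr (FQH.EProj L κ lam N k (n - 1))‖ ^ 2
          ≤ FQH.f (‖lam‖ ^ 2))) ∧
    -- the gap bound
    (lam ≠ 0 → FQH.f (‖lam‖ ^ 2) < 1 / 3 →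
      κ / 3 * (1 - √(3 * FQH.f (‖lam‖ ^ 2))) ^ 2 ≤ FQH.E1 L κ lam) := by
  have hf := FQH.f_nonneg (r := ‖lam‖ ^ 2) (by positivity)
  refine ⟨fun ψ hψ => FQH.ham_mem κ lam (by omega) le_rfl (by omega) le_rfl hψ, fun n hn hnN =>
    ⟨(FQH.reduces_hLoc lam hL hk hLN hn hnN).leavesInvariant,
      (FQH.reduces_hSum lam hL hk hLN hnN).leavesInvariant,
      (FQH.reduces_gProj lam hL hk hLN hn hnN).leavesInvariant⟩,
    fun m h1 hm => (FQH.reduces_EProj lam hL hk hLN h1 hm).leavesInvariant, fun n hn => ?_,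
    FQH.bddAbove_fk (by positivity), fun n hn hnN => ⟨?_, fun m h1 hm => ?_, fun _ => ?_⟩,
    fun _ h => FQH.le_E1 lam hL hk hLN hκ h⟩
  · obtain ⟨m, rfl⟩ : ∃ m, n = m + 1 := ⟨n - 1, by omega⟩
    rw [Nat.add_sub_cancel, FQH.norm_phi_sq, FQH.norm_phi_sq, FQH.beta_eq (by positivity)]
  · set P := (FQH.tilingSpace L).starProjection with hP
    have rg := FQH.reduces_gProj (κ := κ) lam hL hk hLN hn hnN
    have rh := FQH.reduces_hLoc (κ := κ) lam hL hk hLN hn hnN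
    have r1 : FQH.Reduces (1 - FQH.gProj L κ lam k n) := Commute.sub_left (Commute.one_left _) rg
    have sP : ∀ u v, inner ℂ (P u) v = inner ℂ u (P v) := FQH.symm_starProjection _
    have sg : ∀ u v, inner ℂ (FQH.gProj L κ lam k n u) v = inner ℂ u (FQH.gProj L κ lam k n v) :=
      FQH.symm_kerProj _
    have sh : ∀ u v, inner ℂ (FQH.hLoc L κ lam k n u) v = inner ℂ u (FQH.hLoc L κ lam k n v) :=
      FQH.symm_hLoc lam
    have eq1 : ∀ v, FQH.restr (1 - FQH.gProj L κ lam k n) v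
        = P (P v - FQH.gProj L κ lam k n (P v)) := fun v => rfl
    have eq2 : ∀ v, FQH.restr (FQH.hLoc L κ lam k n) v = P (FQH.hLoc L κ lam k n (P v)) :=
      fun v => rfl
    rw [ContinuousLinearMap.le_def, ContinuousLinearMap.isPositive_def]
    constructor
    · intro u v
      change inner ℂ (FQH.restr (FQH.hLoc L κ lam k n) u
          - (κ : ℂ) • FQH.restr (1 - FQH.gProj L κ lam k n) u) v
        = inner ℂ u (FQH.restr (FQH.hLoc L κ lam k n) v
          - (κ : ℂ) • FQH.restr (1 - FQH.gProj L κ lam k n) v)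
      rw [eq1, eq1, eq2, eq2, inner_sub_left, inner_sub_right, inner_smul_left, inner_smul_right,
        Complex.conj_ofReal, sP, sP, sh, inner_sub_left, sg, ← inner_sub_right]
      rw [← sP u, ← sP u]
    · intro v
      have hv : P v ∈ FQH.tilingSpace L := Submodule.starProjection_apply_mem _ v
      have key := FQH.norm_sub_gProj_sq_le lam hL hk hLN hκ hn hnN hv
      change 0 ≤ (inner ℂ (FQH.restr (FQH.hLoc L κ lam k n) v
          - (κ : ℂ) • FQH.restr (1 - FQH.gProj L κ lam k n) v) v).re
      have e3 : inner ℂ (P v - FQH.gProj L κ lam k n (P v)) (P v)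
          = ((‖P v - FQH.gProj L κ lam k n (P v)‖ ^ 2 : ℝ) : ℂ) := by
        have h0 : inner ℂ (P v - FQH.gProj L κ lam k n (P v)) (FQH.gProj L κ lam k n (P v)) = 0 :=
          FQH.inner_sub_kerProj (P v) (FQH.apply_kerProj _ _)
        have h1 : inner ℂ (P v - FQH.gProj L κ lam k n (P v)) (P v)
            = inner ℂ (P v - FQH.gProj L κ lam k n (P v)) (P v - FQH.gProj L κ lam k n (P v)) := by
          rw [inner_sub_right, h0, sub_zero]
        rw [h1, inner_self_eq_norm_sq_to_K]
        simp
      rw [eq1, eq2, inner_sub_left, inner_smul_left, Complex.conj_ofReal, sP, sP, sh, e3,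
        ← Complex.ofReal_mul, Complex.sub_re, Complex.ofReal_re]
      linarith
  · intro h
    by_contra hc
    refine h (sub_eq_zero.2 ?_)
    ext1 v
    have rg := FQH.reduces_gProj (κ := κ) lam hL hk hLN hn hnN
    have rE := FQH.reduces_EProj (κ := κ) lam hL hk hLN h1 hm
    rw [rg.restr_mul_restr_apply rE, rE.restr_mul_restr_apply rg]
    exact FQH.gProj_EProj_comm lam hL hk hLN hκ hn hnN h1 hm hc
      (Submodule.starProjection_apply_mem _ v)
  · have rg := FQH.reduces_gProj (κ := κ) lam hL hk hLN hn hnN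
    have rE := FQH.reduces_EProj (κ := κ) (m := n - 1) lam hL hk hLN (by omega) (by omega)
    have hle : ‖FQH.restr (FQH.gProj L κ lam k n) * FQH.restr (FQH.EProj L κ lam N k (n - 1))‖
        ≤ √(FQH.f (‖lam‖ ^ 2)) := by
      refine ContinuousLinearMap.opNorm_le_bound _ (Real.sqrt_nonneg _) fun v => ?_
      have hv : (FQH.tilingSpace L).starProjection v ∈ FQH.tilingSpace L :=
        Submodule.starProjection_apply_mem _ v
      have hPv := Submodule.norm_starProjection_apply_le (FQH.tilingSpace L) v
      rw [rg.restr_mul_restr_apply rE]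
      set w := (FQH.tilingSpace L).starProjection v with hw
      obtain ⟨m, rfl⟩ : ∃ m, n = m + 1 := ⟨n - 1, by omega⟩
      rw [Nat.add_sub_cancel, FQH.EProj_eq lam (by omega) (by omega) (by omega),
        sub_apply]
      have key := FQH.norm_gProj_Gam_sub_le lam hL hk hLN hκ (n := m) (by omega) hnN hv
      -- The increment is a contraction: Pythagoras between Γ_0 = 1, Γ_m and Γ_{m+1}.
      have hG : ‖FQH.Gam L κ lam N k m w - FQH.Gam L κ lam N k (m + 1) w‖ ≤ ‖v‖ := by
        refine le_trans ?_ hPv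
        refine le_of_sq_le_sq ?_ (norm_nonneg _)
        have e1 := FQH.norm_Gam_sub_sq lam hL hk hLN hκ (Nat.zero_le m) hv
        have e2 := FQH.norm_Gam_sub_sq lam hL hk hLN hκ (Nat.le_succ m) hv
        have e3 : FQH.Gam L κ lam N k 0 w = w := by
          rw [FQH.Gam, if_pos (by omega), one_apply_eq_self]
        rw [e3] at e1
        have := sq_nonneg ‖w - FQH.Gam L κ lam N k m w‖
        have := sq_nonneg ‖FQH.Gam L κ lam N k (m + 1) w‖
        rw [e2]
        linarith
      calc _ ≤ √(FQH.f (‖lam‖ ^ 2)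
            * ‖FQH.Gam L κ lam N k m w - FQH.Gam L κ lam N k (m + 1) w‖ ^ 2) :=
          Real.le_sqrt_of_sq_le key
        _ = √(FQH.f (‖lam‖ ^ 2)) * ‖FQH.Gam L κ lam N k m w - FQH.Gam L κ lam N k (m + 1) w‖ := by
          rw [Real.sqrt_mul hf, Real.sqrt_sq (norm_nonneg _)]
        _ ≤ _ := by gcongr
    calc _ ≤ √(FQH.f (‖lam‖ ^ 2)) ^ 2 := pow_le_pow_left₀ (norm_nonneg _) hle 2
      _ = _ := Real.sq_sqrt hf
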